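/- Let $M$ be a compact $C^\infty$ Riemannian manifold, let $\Omega=(\mathbb R/\mathbb Z)^{\iota}$ be a torus of finite or countably infinite dimension, and let $\theta:\Omega\to\Omega$, $\theta\omega=\omega+\alpha$, be an irrational rotation, i.e. one for which every orbit $\{\omega+n\alpha\}_{n\in\mathbb Z}$ is dense in $\Omega$. Let $f:\Omega\to \mathrm{diff}^2(M)$, $\omega\mapsto f_\omega$, be continuous, where $\mathrm{diff}^2(M)$ is the space of $C^2$ diffeomorphisms of $M$ with the $C^2$ topology, and let $\phi:M\times\Omega\to M\times\Omega$ be the homeomorphism $\phi(x,\omega)=(f_\omega x,\theta\omega)$. Assume that: - $\phi$ is transitive: some orbit $\{\phi^n(x,\omega)\}_{n\in\mathbb Z}$ is dense in $M\times\Omega$; - $\phi$ is Anosov on fibers: there are a constant $\lambda_0>0$ and, for every $(x,\omega)\in M\times\Omega$, a splitting $T_xM=E^u_{(x,\omega)}\oplus E^s_{(x,\omega)}$, depending continuously on $(x,\omega)$, with $\dim E^u_{(x,\omega)}>0$, $Df_\omega(x)E^\tau_{(x,\omega)}=E^\tau_{\phi(x,\omega)}$ for $\tau=u,s$, and $|Df_\omega(x)\xi|\ge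 e^{\lambda_0}|\xi|$ for $\xi\in E^u_{(x,\omega)}$, $|Df_\omega(x)\eta|\le e^{-\lambda_0}|\eta|$ for $\eta\in E^s_{(x,\omega)}$. Let $\mu$ be a $\phi$-invariant ergodic Borel probability measure on $M\times\Omega$ with metric (Kolmogorov–Sinai) entropy $h_\mu(\phi)>0$ and $\operatorname{supp}\mu=M\times\Omega$. Then for every $\gamma>0$ there are integers $n,k\ge 1$ such that 1. $\frac1n\ln k\ \ge\ h_\mu(\phi)-\gamma$; 2. $(\phi^*)^n$ has a bi-invariant horseshoe with $k$ symbols, where $\phi^*$ is the push-forward map $\phi^*(\nu)(A)=\nu(\phi^{-1}(A))$ on the space $\mathcal M(M\times\Omega)$ of Borel probability measures on $M\times\Omega$ with the weak* topology. That is, with $\mathcal S_k=\{1,\dots,k\}^{\mathbb Z}$ (product topology) and $\sigma$ the left shift on $\mathcal S_k$, there is a topological embedding $\Psi:\mathcal S_k\to\mathcal M(M\times\Omega)$ such that $(\phi^*)^n$ maps $\Sigma=\Psi(\mathcal S_k)$ bijectively onto itself and $(\phi^*)^n\circ\Psi=\Psi\circ\sigma$. -/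

import Mathlib

open Set Filter Topology MeasureTheory Bundle
open scoped Manifold ContDiff

noncomputable section

namespace QuasiPeriodicForcing

/-! ### The space of `C^2` diffeomorphisms with the `C^2` topology -/

section DiffC2

variable {d : ℕ} {M : Type*} [TopologicalSpace M] [ChartedSpace (EuclideanSpace ℝ (Fin d)) M]

/-- The group `diff^2(M)` of `C^2` diffeomorphisms of the `d`-dimensional manifold `M`. -/
abbrev DiffTwo (d : ℕ) (M : Type*) [TopologicalSpace M]
    [ChartedSpace (EuclideanSpace ℝ (Fin d)) M] : Type _ :=
  Diffeomorph (𝓡 d) (𝓡 d) M M 2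

/-- The diffeomorphisms `h` which map `K` into the domain of the chart `ψ` and whose
representative `ψ ∘ h ∘ φ⁻¹` in the charts `φ`, `ψ` is `ε`-close to that of `g` on `K`, together
with its derivatives up to order two. -/
def c2Neighborhood (g : DiffTwo d M)
    (φ ψ : OpenPartialHomeomorph M (EuclideanSpace ℝ (Fin d))) (K : Set M) (ε : ℝ) :
    Set (DiffTwo d M) :=
  {h | MapsTo h K ψ.source ∧ ∀ j : ℕ, j ≤ 2 → ∀ x ∈ K,
    ‖iteratedFDeriv ℝ j (fun v => ψ (h (φ.symm v))) (φ x) -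
      iteratedFDeriv ℝ j (fun v => ψ (g (φ.symm v))) (φ x)‖ < ε}

/-- The `C^2` topology on `diff^2(M)`: it is generated by the sets `c2Neighborhood g φ ψ K ε`,
where `φ`, `ψ` are smooth charts, `K` is a compact part of the domain of `φ` which `g` maps into
the domain of `ψ`, and `ε > 0`. For compact `M` it is the topology of any `C^2` norm. -/
instance c2Topology : TopologicalSpace (DiffTwo d M) :=
  TopologicalSpace.generateFrom
    {U | ∃ (g : DiffTwo d M) (φ ψ : OpenPartialHomeomorph M (EuclideanSpace ℝ (Fin d)))
        (K : Set M) (ε : ℝ),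
      φ ∈ IsManifold.maximalAtlas (𝓡 d) ∞ M ∧ ψ ∈ IsManifold.maximalAtlas (𝓡 d) ∞ M ∧
      IsCompact K ∧ K ⊆ φ.source ∧ MapsTo g K ψ.source ∧ 0 < ε ∧
      U = c2Neighborhood g φ ψ K ε}

variable {Ω : Type*} [TopologicalSpace Ω]

/-- A continuous family of `C^2` diffeomorphisms acts jointly continuously. -/
theorem continuous_eval [IsManifold (𝓡 d) ∞ M] {f : Ω → DiffTwo d M} (hf : Continuous f) :
    Continuous fun p : M × Ω => f p.2 p.1 := by
  have : LocallyCompactSpace M :=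
    ChartedSpace.locallyCompactSpace (EuclideanSpace ℝ (Fin d)) M
  refine continuous_iff_continuousAt.2 ?_
  rintro ⟨x₀, w₀⟩
  set φ := chartAt (EuclideanSpace ℝ (Fin d)) x₀ with hφ
  set ψ := chartAt (EuclideanSpace ℝ (Fin d)) (f w₀ x₀) with hψ
  have hcont : Continuous (f w₀) := (f w₀).continuous
  have hU : φ.source ∩ (f w₀) ⁻¹' ψ.source ∈ 𝓝 x₀ :=
    inter_mem (chart_source_mem_nhds _ _)
      (hcont.continuousAt.preimage_mem_nhds (chart_source_mem_nhds _ _))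
  obtain ⟨K, hK, hKU, hKc⟩ := local_compact_nhds hU
  have hclose : ∀ ε > 0, ∀ᶠ w in 𝓝 w₀, f w ∈ c2Neighborhood (f w₀) φ ψ K ε := by
    intro ε hε
    have hopen : IsOpen (c2Neighborhood (f w₀) φ ψ K ε) :=
      TopologicalSpace.isOpen_generateFrom_of_mem
        ⟨f w₀, φ, ψ, K, ε, IsManifold.chart_mem_maximalAtlas _,
          IsManifold.chart_mem_maximalAtlas _, hKc, fun x hx => (hKU hx).1,
          fun x hx => (hKU hx).2, hε, rfl⟩
    refine hf.continuousAt.preimage_mem_nhds (hopen.mem_nhds ⟨fun x hx => (hKU hx).2, ?_⟩)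
    intro j _ x _
    simpa using hε
  have hdist : ∀ w, ∀ x ∈ K, ∀ ε, f w ∈ c2Neighborhood (f w₀) φ ψ K ε →
      ‖ψ (f w x) - ψ (f w₀ x)‖ < ε := by
    intro w x hx ε h
    have h0 := h.2 0 (by norm_num) x hx
    rw [iteratedFDeriv_zero_eq_comp, iteratedFDeriv_zero_eq_comp] at h0
    simp only [Function.comp_apply, φ.left_inv (hKU hx).1] at h0
    rwa [← map_sub, LinearIsometryEquiv.norm_map] at h0
  have hlim : Tendsto (fun p : M × Ω => ψ (f p.2 p.1)) (𝓝 (x₀, w₀)) (𝓝 (ψ (f w₀ x₀))) := by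
    rw [Metric.tendsto_nhds]
    intro ε hε
    have h1 : Tendsto (fun x => ψ (f w₀ x)) (𝓝 x₀) (𝓝 (ψ (f w₀ x₀))) :=
      ((ψ.continuousAt (mem_chart_source _ _)).tendsto).comp hcont.continuousAt
    have h2 := (Metric.tendsto_nhds.1 h1 (ε / 2) (half_pos hε)).and hK
    rw [nhds_prod_eq]
    filter_upwards [h2.prod_mk (hclose (ε / 2) (half_pos hε))] with p hp
    have h3 := hdist p.2 p.1 hp.1.2 _ hp.2
    rw [← dist_eq_norm] at h3
    have := dist_triangle (ψ (f p.2 p.1)) (ψ (f w₀ p.1)) (ψ (f w₀ x₀))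
    linarith [hp.1.1]
  have hsrc : ∀ᶠ p : M × Ω in 𝓝 (x₀, w₀), f p.2 p.1 ∈ ψ.source := by
    rw [nhds_prod_eq]
    have hK' : ∀ᶠ x in 𝓝 x₀, x ∈ K := hK
    filter_upwards [hK'.prod_mk (hclose 1 one_pos)] with p hp
    exact hp.2.1 hp.1
  have hfin : Tendsto (fun p : M × Ω => ψ.symm (ψ (f p.2 p.1))) (𝓝 (x₀, w₀))
      (𝓝 (ψ.symm (ψ (f w₀ x₀)))) :=
    (ψ.continuousAt_symm (ψ.map_source (mem_chart_source _ _))).tendsto.comp hlim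
  rw [ψ.left_inv (mem_chart_source _ _)] at hfin
  refine hfin.congr' ?_
  filter_upwards [hsrc] with p hp
  exact ψ.left_inv hp

/-- The skew product `ϕ (x, ω) = (f_ω x, θ ω)`, a homeomorphism of `M × Ω`. -/
def skewProduct [CompactSpace M] [T2Space M] [IsManifold (𝓡 d) ∞ M] [CompactSpace Ω] [T2Space Ω]
    (f : C(Ω, DiffTwo d M)) (θ : Ω ≃ₜ Ω) : M × Ω ≃ₜ M × Ω :=
  Continuous.homeoOfEquivCompactToT2
    (f := { toFun := fun p => (f p.2 p.1, θ p.2)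
            invFun := fun p => ((f (θ.symm p.2)).symm p.1, θ.symm p.2)
            left_inv := fun p => by simp
            right_inv := fun p => by simp })
    ((continuous_eval f.continuous).prodMk (θ.continuous.comp continuous_snd))

theorem skewProduct_apply [CompactSpace M] [T2Space M] [IsManifold (𝓡 d) ∞ M] [CompactSpace Ω]
    [T2Space Ω] (f : C(Ω, DiffTwo d M)) (θ : Ω ≃ₜ Ω) (p : M × Ω) :
    skewProduct f θ p = (f p.2 p.1, θ p.2) := rfl

end DiffC2

/-! ### Topological dynamics -/

section TopologicalDynamics

variable {X : Type*} [TopologicalSpace X]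

/-- The (two-sided) orbit of `x` under the homeomorphism `T`. -/
def orbit (T : X ≃ₜ X) (x : X) : Set X := range fun n : ℤ => (T ^ n) x

/-- `T` is transitive: some orbit is dense. -/
def IsTransitive (T : X ≃ₜ X) : Prop := ∃ x, Dense (orbit T x)

/-- `T` is minimal: every orbit is dense. -/
def IsMinimalHomeo (T : X ≃ₜ X) : Prop := ∀ x, Dense (orbit T x)

/-- The left shift on two-sided sequences. -/
def shift {A : Type*} (a : ℤ → A) : ℤ → A := fun i => a (i + 1)

/-- `F` has a bi-invariant horseshoe with `k` symbols: there is an embedding `Ψ` of the space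
`{1, …, k}^ℤ` of two-sided sequences (with the product topology) such that `F` restricts to a
bijection of the image `Σ = Ψ ({1, …, k}^ℤ)` which `Ψ` conjugates to the left shift. -/
def HasBiInvariantHorseshoe (F : X → X) (k : ℕ) : Prop :=
  ∃ Ψ : (ℤ → Fin k) → X, IsEmbedding Ψ ∧ BijOn F (range Ψ) (range Ψ) ∧
    ∀ a : ℤ → Fin k, F (Ψ a) = Ψ (shift a)

/-- The push-forward `ϕ^*` on Borel probability measures, `ϕ^* ν (A) = ν (ϕ⁻¹ A)`. -/
def pushforward [MeasurableSpace X] [BorelSpace X] (T : X ≃ₜ X) (ν : ProbabilityMeasure X) :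
    ProbabilityMeasure X :=
  ν.map T.continuous.measurable.aemeasurable

end TopologicalDynamics

/-! ### Measure-theoretic entropy -/

section Entropy

variable {X : Type*} [MeasurableSpace X]

/-- The Shannon entropy `-∑ μ(P_i) ln μ(P_i)` of the finite partition of `X` into the level
sets `P_i = {x | P x = i}` of `P`. -/
def partitionEntropy {A : Type*} [Fintype A] (μ : Measure X) (P : X → A) : ℝ :=
  ∑ i, Real.negMulLog (μ.real (P ⁻¹' {i}))

/-- The labelling of the refined partition `P ∨ T⁻¹ P ∨ ⋯ ∨ T^{-(n-1)} P`. -/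
def itinerary {A : Type*} (T : X → X) (P : X → A) (n : ℕ) : X → (Fin n → A) :=
  fun x i => P (T^[i] x)

/-- The entropy `h_μ(T, P) = lim (1/n) H_μ(P ∨ T⁻¹ P ∨ ⋯ ∨ T^{-(n-1)} P)`. -/
def entropyOfPartition {m : ℕ} (T : X → X) (μ : Measure X) (P : X → Fin m) : EReal :=
  limsup (fun n : ℕ => ((partitionEntropy μ (itinerary T P n) / n : ℝ) : EReal)) atTop

/-- The Kolmogorov–Sinai (metric) entropy `h_μ(T)`: the supremum of `h_μ(T, P)` over all finite
measurable partitions `P`. -/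
def metricEntropy (T : X → X) (μ : Measure X) : EReal :=
  ⨆ (m : ℕ) (P : X → Fin m) (_ : Measurable P), entropyOfPartition T μ P

end Entropy

/-! ### The Anosov condition on fibers -/

section Anosov

variable {d : ℕ} {M : Type*} [TopologicalSpace M] [ChartedSpace (EuclideanSpace ℝ (Fin d)) M]
  [IsManifold (𝓡 d) ∞ M] {Ω : Type*} [TopologicalSpace Ω]

/-- A family of subspaces `V (x, ω) ⊆ T_x M` depends continuously on `(x, ω)`: near every point
it has a continuous frame. -/
def DependsContinuously (V : ∀ p : M × Ω, Submodule ℝ (TangentSpace (𝓡 d) p.1)) : Prop :=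
  ∀ p₀ : M × Ω, ∃ U ∈ 𝓝 p₀, ∃ (m : ℕ) (X : Fin m → ∀ p : M × Ω, TangentSpace (𝓡 d) p.1),
    (∀ i, ContinuousOn (fun p => (⟨p.1, X i p⟩ : TangentBundle (𝓡 d) M)) U) ∧
    ∀ p ∈ U, LinearIndependent ℝ (fun i => X i p) ∧ Submodule.span ℝ (range fun i => X i p) = V p

/-- The skew product of `f` and `θ` is Anosov on fibers, with respect to the given Riemannian
metric on `M`. -/
def IsAnosovOnFibers [RiemannianBundle (fun x : M => TangentSpace (𝓡 d) x)]
    (f : Ω → DiffTwo d M) (θ : Ω → Ω) : Prop :=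
  ∃ (Eu Es : ∀ p : M × Ω, Submodule ℝ (TangentSpace (𝓡 d) p.1)) (lam : ℝ), 0 < lam ∧
    DependsContinuously Eu ∧ DependsContinuously Es ∧
    ∀ (x : M) (w : Ω),
      IsCompl (Eu (x, w)) (Es (x, w)) ∧
      0 < Module.finrank ℝ (Eu (x, w)) ∧
      (Eu (x, w)).map (mfderiv (𝓡 d) (𝓡 d) (f w) x).toLinearMap = Eu (f w x, θ w) ∧
      (Es (x, w)).map (mfderiv (𝓡 d) (𝓡 d) (f w) x).toLinearMap = Es (f w x, θ w) ∧
      (∀ ξ ∈ Eu (x, w), Real.exp lam * ‖ξ‖ ≤ ‖mfderiv (𝓡 d) (𝓡 d) (f w) x ξ‖) ∧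
      (∀ η ∈ Es (x, w), ‖mfderiv (𝓡 d) (𝓡 d) (f w) x η‖ ≤ Real.exp (-lam) * ‖η‖)

end Anosov

end QuasiPeriodicForcing

end

/-!
The space of measures carries horseshoes with many more symbols than the entropy of `ϕ` requires:
one fixed iterate of `ϕ^*` has horseshoes with `2 ^ (m + 1)` symbols for every `m`. Since the
entropy of `μ` is finite, a large `m` satisfies the entropy inequality.

*Hyperbolicity.* Embed `M` into a Euclidean space by a smooth embedding `e`. The splitting, the
derivative along the fibres and the Riemannian norm become continuous families of operators and
seminorms on the ambient space (`HyperbolicData`, `exists_hyperbolicData`), so that no charts are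
needed for the dynamics. From these data one obtains expansivity along the fibres
(`HyperbolicData.exists_fiberExpansive`: a chord between two orbits which stay close contracts
forwards in its stable and backwards in its unstable component) and shadowing along the fibres
(`HyperbolicData.fiberShadowing`: for finite pseudo-orbits, a Newton step which halves the errors
combined with a minimisation over a compact product; for infinite ones, a compactness argument).

*Finite entropy.* Base points of two orbits keep their difference under a rotation. Hence the base
point up to a small error, together with the itinerary of the fibre coordinate with respect to a
fixed partition into small sets, determines by expansivity the itinerary with respect to any given
partition, except at visits to a set of small measure (`FiberExpansive.metricEntropy_lt_top`).

*A binary family of measures.* By the pigeonhole principle and expansivity, there are two orbit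
segments over the same base segment which start close together and end close together but separate
in between (`FiberExpansive.exists_separating_pair`). At each visit of a `μ`-random orbit to a small
open set `B`, at times divisible by `n`, follow the first segment or the second one according to a
binary sequence `a`, and shadow the result by an orbit (`exists_coding`). The law `Ψ a` of the
shadowing orbit depends continuously on `a`, is shifted by `(ϕ^*)^n`, and knows `a 0` because
`μ B > 0` (`exists_binary_family`). Full support of `μ` enters here.

*Many symbols.* For sequences of `m + 1` bits, take the convex combination of the measures `Ψ` of
the single bits with weights proportional to `5⁻ʲ`. The first bit at which two sequences differ
dominates the others, so this remains injective (`hasBiInvariantHorseshoe_of_binary_family`).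
-/

noncomputable section

namespace QuasiPeriodicForcing

/-! ### Uniformity from compactness -/

/-- A property which holds near the zero set of a continuous function `h` on a compact space holds
on a whole sublevel set `{h < ρ}`. -/
theorem exists_pos_forall_lt_of_eventually {Y : Type*} [TopologicalSpace Y] [CompactSpace Y]
    {h : Y → ℝ} (hh : Continuous h) {R : Y → Prop}
    (hR : ∀ y, h y ≤ 0 → ∀ᶠ y' in 𝓝 y, R y') : ∃ ρ > 0, ∀ y, h y < ρ → R y := by
  set S : Set Y := {y | ¬ ∀ᶠ y' in 𝓝 y, R y'} with hS
  have hSc : IsClosed S := by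
    have : S = (interior {y | R y})ᶜ := by
      ext y; simp [hS, mem_interior_iff_mem_nhds, Filter.Eventually]
    rw [this]
    exact isOpen_interior.isClosed_compl
  rcases S.eq_empty_or_nonempty with hE | hne
  · refine ⟨1, one_pos, fun y _ => ?_⟩
    have : y ∉ S := by simp [hE]
    exact (not_not.1 this).self_of_nhds
  · obtain ⟨y₀, hy₀, hmin⟩ := hSc.isCompact.exists_isMinOn hne hh.continuousOn
    have hpos : 0 < h y₀ := by
      by_contra hc
      exact hy₀ (hR y₀ (not_lt.1 hc))
    refine ⟨h y₀, hpos, fun y hy => ?_⟩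
    by_contra hc
    have : y ∈ S := fun he => hc he.self_of_nhds
    exact absurd hy (not_lt.2 (hmin this))

/-! ### Hyperbolic skew products in Euclidean coordinates -/

section Expansive

theorem zpow_snd {M Ω : Type*} [TopologicalSpace M] [TopologicalSpace Ω] {T : M × Ω ≃ₜ M × Ω}
    {θ : Ω ≃ₜ Ω} (hT : ∀ p, (T p).2 = θ p.2) (i : ℤ) (p : M × Ω) :
    ((T ^ i) p).2 = (θ ^ i) p.2 := by
  have hnat : ∀ (n : ℕ) p, ((T ^ n) p).2 = (θ ^ n) p.2 := fun n => by
    induction n with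
    | zero => intro p; simp
    | succ n ih => intro p; rw [pow_succ, Homeomorph.mul_apply, ih, hT, pow_succ]; rfl
  obtain ⟨n, rfl | rfl⟩ := i.eq_nat_or_neg
  · rw [zpow_natCast, zpow_natCast]; exact hnat n p
  · have h := hnat n ((T ^ (-(n : ℤ))) p)
    rw [← Homeomorph.mul_apply, ← zpow_natCast, ← zpow_add, add_neg_cancel, zpow_zero,
      Homeomorph.one_apply] at h
    rw [h, ← Homeomorph.mul_apply, ← zpow_natCast, ← zpow_add, neg_add_cancel, zpow_zero]
    rfl

variable {M Ω F : Type*} [TopologicalSpace M] [TopologicalSpace Ω] [NormedAddCommGroup F]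
  [NormedSpace ℝ F]

/-- Two points of a fibre whose orbits stay `ε`-close (in the norm of the ambient space of the
embedding `e`) for all times are equal. -/
def FiberExpansive (T : M × Ω ≃ₜ M × Ω) (e : M → F) (ε : ℝ) : Prop :=
  ∀ (x y : M) (w : Ω),
    (∀ i : ℤ, ‖e ((T ^ i) (x, w)).1 - e ((T ^ i) (y, w)).1‖ ≤ ε) → x = y

/-- Every sequence of points over a base orbit which is an orbit of `T` up to sufficiently small
errors in the fibres is uniformly close to an orbit of `T` over the same base orbit. -/
def FiberShadowing (T : M × Ω ≃ₜ M × Ω) (θ : Ω ≃ₜ Ω) (e : M → F) : Prop :=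
  ∀ ε > 0, ∃ δ > 0, ∀ (w : Ω) (z : ℤ → M),
    (∀ i, ‖e (z (i + 1)) - e (T (z i, (θ ^ i) w)).1‖ ≤ δ) →
      ∃ x, ∀ i, ‖e ((T ^ i) (x, w)).1 - e (z i)‖ ≤ ε

/-- Hyperbolicity along the fibres of the skew product `T`, expressed in the ambient vector space
of an embedding `e` of the fibre: continuous projections `Pu`, `Ps` of the ambient space onto the
unstable and stable subspaces of the tangent space (their sum is a projection onto the tangent
space), the derivative `A` of `T` along the fibres (extended to the ambient space), and
continuous adapted seminorms `Nu`, `Ns` which measure the unstable and stable components. -/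
structure HyperbolicData (T : M × Ω ≃ₜ M × Ω) (e : M → F) where
  /-- The projection onto the unstable subspace. -/
  Pu : M × Ω → F →L[ℝ] F
  /-- The projection onto the stable subspace. -/
  Ps : M × Ω → F →L[ℝ] F
  /-- The derivative along the fibre. -/
  A : M × Ω → F →L[ℝ] F
  /-- The adapted norm of the unstable component. -/
  Nu : M × Ω → Seminorm ℝ F
  /-- The adapted norm of the stable component. -/
  Ns : M × Ω → Seminorm ℝ F
  /-- The contraction rate. -/
  κ : ℝ
  /-- The constant which compares the ambient norm with the adapted norms. -/
  C : ℝ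
  κ_nonneg : 0 ≤ κ
  κ_lt : κ < 1
  continuous_Pu : Continuous Pu
  continuous_Ps : Continuous Ps
  continuous_A : Continuous A
  continuous_Nu : Continuous fun q : (M × Ω) × F => Nu q.1 q.2
  continuous_Ns : Continuous fun q : (M × Ω) × F => Ns q.1 q.2
  Pu_Pu : ∀ p v, Pu p (Pu p v) = Pu p v
  Ps_Ps : ∀ p v, Ps p (Ps p v) = Ps p v
  Pu_Ps : ∀ p v, Pu p (Ps p v) = 0
  Ps_Pu : ∀ p v, Ps p (Pu p v) = 0
  A_Ps : ∀ p v, A p (Ps p v) = Ps (T p) (A p v)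
  exists_unstable : ∀ p w, ∃ u, Pu p u = u ∧ A p u = Pu (T p) w
  Ns_A : ∀ p v, Ns (T p) (A p v) ≤ κ * Ns p v
  Nu_A : ∀ p v, Nu p v ≤ κ * Nu (T p) (A p v)
  Ns_Ps : ∀ p v, Ns p (Ps p v) = Ns p v
  Nu_Pu : ∀ p v, Nu p (Pu p v) = Nu p v
  norm_Pu_le : ∀ p v, ‖Pu p v‖ ≤ C * Nu p v
  norm_Ps_le : ∀ p v, ‖Ps p v‖ ≤ C * Ns p v
  /-- Small chords of the embedded fibre are tangent up to higher order. -/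
  chord_tangent : ∀ η > 0, ∃ ρ > 0, ∀ (p : M × Ω) (y : M), ‖e y - e p.1‖ < ρ →
    ‖e y - e p.1 - (Pu p (e y - e p.1) + Ps p (e y - e p.1))‖ ≤ η * ‖e y - e p.1‖
  /-- `A` is the derivative of `T` along the fibres, uniformly. -/
  chord_map : ∀ η > 0, ∃ ρ > 0, ∀ (p : M × Ω) (y : M), ‖e y - e p.1‖ < ρ →
    ‖e (T (y, p.2)).1 - e (T p).1 - A p (e y - e p.1)‖ ≤ η * ‖e y - e p.1‖
  /-- Small tangent vectors are chords up to higher order. -/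
  tangent_chord : ∀ η > 0, ∃ ρ > 0, ∀ (p : M × Ω) (v : F), Pu p v + Ps p v = v → ‖v‖ < ρ →
    ∃ y, ‖e y - e p.1 - v‖ ≤ η * ‖v‖

namespace HyperbolicData

variable {T : M × Ω ≃ₜ M × Ω} {e : M → F}

theorem exists_bound (H : HyperbolicData T e) [CompactSpace M] [CompactSpace Ω] :
    ∃ K, 1 ≤ K ∧ H.C ≤ K ∧ (∀ p v, ‖H.Pu p v‖ ≤ K * ‖v‖) ∧ (∀ p v, ‖H.Ps p v‖ ≤ K * ‖v‖) ∧
      (∀ p v, ‖H.A p v‖ ≤ K * ‖v‖) := by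
  obtain ⟨a, ha⟩ := isCompact_univ.exists_bound_of_continuousOn H.continuous_Pu.continuousOn
  obtain ⟨b, hb⟩ := isCompact_univ.exists_bound_of_continuousOn H.continuous_Ps.continuousOn
  obtain ⟨c, hc⟩ := isCompact_univ.exists_bound_of_continuousOn H.continuous_A.continuousOn
  refine ⟨max 1 (max H.C (max a (max b c))), le_max_left _ _, by simp, fun p v => ?_,
    fun p v => ?_, fun p v => ?_⟩
  · exact (H.Pu p).le_of_opNorm_le ((ha p (mem_univ _)).trans (by simp)) v
  · exact (H.Ps p).le_of_opNorm_le ((hb p (mem_univ _)).trans (by simp)) v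
  · exact (H.A p).le_of_opNorm_le ((hc p (mem_univ _)).trans (by simp)) v

/-- A continuous family of seminorms over a compact space is uniformly bounded by the norm. -/
theorem _root_.QuasiPeriodicForcing.exists_seminorm_bound {X : Type*} [TopologicalSpace X]
    [CompactSpace X] [FiniteDimensional ℝ F] {N : X → Seminorm ℝ F}
    (hN : Continuous fun q : X × F => N q.1 q.2) : ∃ K, 1 ≤ K ∧ ∀ p v, N p v ≤ K * ‖v‖ := by
  have : ProperSpace F := FiniteDimensional.proper ℝ F
  obtain ⟨a, ha⟩ := (isCompact_univ.prod (isCompact_closedBall (0 : F)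
    1)).exists_bound_of_continuousOn hN.continuousOn
  refine ⟨max 1 a, le_max_left _ _, fun p v => ?_⟩
  rcases eq_or_ne v 0 with rfl | hv
  · simp
  have hv' : 0 < ‖v‖ := norm_pos_iff.2 hv
  have h1 : (p, (‖v‖⁻¹ : ℝ) • v) ∈ (univ : Set X) ×ˢ Metric.closedBall (0 : F) 1 := by
    refine ⟨mem_univ _, ?_⟩
    simp [norm_smul, hv'.ne']
  have h2 := (le_abs_self _).trans (ha _ h1)
  simp only [map_smul_eq_mul, norm_inv, norm_norm] at h2
  rw [inv_mul_le_iff₀ hv', mul_comm] at h2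
  exact h2.trans (by gcongr; exact le_max_right _ _)

/-- Uniform continuity, in the fibre variable, of a continuous family of seminorms. -/
theorem _root_.QuasiPeriodicForcing.exists_seminorm_close [CompactSpace M] [CompactSpace Ω]
    [FiniteDimensional ℝ F] (he : Continuous e) (hinj : Function.Injective e)
    {N : M × Ω → Seminorm ℝ F} (hN : Continuous fun q : (M × Ω) × F => N q.1 q.2) {η : ℝ}
    (hη : 0 < η) :
    ∃ ρ > 0, ∀ (x y : M) (w : Ω), ‖e y - e x‖ < ρ → ∀ v, N (x, w) v ≤ N (y, w) v + η * ‖v‖ := by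
  have : ProperSpace F := FiniteDimensional.proper ℝ F
  have : CompactSpace (Metric.closedBall (0 : F) 1) :=
    isCompact_iff_compactSpace.1 (isCompact_closedBall _ _)
  obtain ⟨ρ, hρ, h⟩ := exists_pos_forall_lt_of_eventually
    (Y := (M × M × Ω) × Metric.closedBall (0 : F) 1)
    (h := fun q => ‖e q.1.2.1 - e q.1.1‖) (by fun_prop)
    (R := fun q => N (q.1.1, q.1.2.2) q.2 < N (q.1.2.1, q.1.2.2) q.2 + η) (by
      rintro ⟨⟨x, y, w⟩, v⟩ hq
      have hyx : y = x := hinj (sub_eq_zero.1 (norm_le_zero_iff.1 hq))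
      subst hyx
      refine ContinuousAt.eventually_lt ?_ ?_ (by simpa using hη)
      · exact (hN.comp (by fun_prop : Continuous fun q : (M × M × Ω) × Metric.closedBall (0 : F) 1
          => (((q.1.1, q.1.2.2) : M × Ω), (q.2 : F)))).continuousAt
      · exact ((hN.comp (by fun_prop : Continuous fun q : (M × M × Ω) × Metric.closedBall (0 : F) 1
          => (((q.1.2.1, q.1.2.2) : M × Ω), (q.2 : F)))).add continuous_const).continuousAt)
  refine ⟨ρ, hρ, fun x y w hxy v => ?_⟩
  rcases eq_or_ne v 0 with rfl | hv
  · simp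
  have hv' : 0 < ‖v‖ := norm_pos_iff.2 hv
  have h1 := (h ((x, y, w), ⟨(‖v‖⁻¹ : ℝ) • v, by simp [norm_smul, hv'.ne']⟩) hxy).le
  simp only [map_smul_eq_mul, norm_inv, norm_norm] at h1
  have h2 := mul_le_mul_of_nonneg_left h1 hv'.le
  rw [mul_add, mul_inv_cancel_left₀ hv'.ne', mul_inv_cancel_left₀ hv'.ne'] at h2
  linarith

/-- Uniform continuity, in the fibre variable, of a continuous family of operators. -/
theorem _root_.QuasiPeriodicForcing.exists_operator_close [CompactSpace M] [CompactSpace Ω]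
    (he : Continuous e) (hinj : Function.Injective e)
    {P : M × Ω → F →L[ℝ] F} (hP : Continuous P) {η : ℝ} (hη : 0 < η) :
    ∃ ρ > 0, ∀ (x y : M) (w : Ω), ‖e y - e x‖ < ρ → ∀ v,
      ‖P (y, w) v - P (x, w) v‖ ≤ η * ‖v‖ := by
  obtain ⟨ρ, hρ, h⟩ := exists_pos_forall_lt_of_eventually
    (Y := M × M × Ω) (h := fun q => ‖e q.2.1 - e q.1‖) (by fun_prop)
    (R := fun q => ‖P (q.2.1, q.2.2) - P (q.1, q.2.2)‖ < η) (by
      rintro ⟨x, y, w⟩ hq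
      have hyx : y = x := hinj (sub_eq_zero.1 (norm_le_zero_iff.1 hq))
      subst hyx
      refine ContinuousAt.eventually_lt ?_ continuousAt_const (by simpa using hη)
      exact Continuous.continuousAt (by fun_prop))
  refine ⟨ρ, hρ, fun x y w hxy v => ?_⟩
  rw [← sub_apply]
  exact (P (y, w) - P (x, w)).le_of_opNorm_le (h (x, y, w) hxy).le v

/-- A bounded two-sided sequence with `a (i + 1) ≤ κ a i + c` is bounded by `c / (1 - κ)`. -/
theorem _root_.QuasiPeriodicForcing.le_of_contracting {a : ℤ → ℝ} {κ c B : ℝ} (hκ : 0 ≤ κ)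
    (hκ' : κ < 1) (hB : ∀ i, a i ≤ B) (h : ∀ i, a (i + 1) ≤ κ * a i + c) (i : ℤ) :
    a i ≤ c / (1 - κ) := by
  have hbdd : BddAbove (range a) := ⟨B, by rintro _ ⟨i, rfl⟩; exact hB i⟩
  have h1 : ⨆ i, a i ≤ κ * (⨆ i, a i) + c := by
    refine ciSup_le fun i => ?_
    have h2 := h (i - 1)
    rw [sub_add_cancel] at h2
    have := mul_le_mul_of_nonneg_left (le_ciSup hbdd (i - 1)) hκ
    linarith
  refine (le_ciSup hbdd i).trans ?_
  rw [le_div_iff₀ (by linarith)]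
  linarith

/-- Fibrewise hyperbolic skew products are expansive along the fibres: the stable component of
the chord between two orbits is contracted forwards, and the unstable one backwards, up to errors
of higher order. -/
theorem exists_fiberExpansive (H : HyperbolicData T e) [CompactSpace M] [CompactSpace Ω]
    [FiniteDimensional ℝ F] (hinj : Function.Injective e) {θ : Ω ≃ₜ Ω} (hT : ∀ p, (T p).2 = θ p.2) :
    ∃ ε > 0, FiberExpansive T e ε := by
  obtain ⟨K, hK1, hCK, hPu, hPs, hA⟩ := H.exists_bound
  obtain ⟨Ku, hKu1, hKu⟩ := exists_seminorm_bound H.continuous_Nu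
  obtain ⟨Ks, hKs1, hKs⟩ := exists_seminorm_bound H.continuous_Ns
  have hκ0 := H.κ_nonneg
  have hκ1 : 0 < 1 - H.κ := sub_pos.2 H.κ_lt
  -- If `β` bounds all chords between the two orbits, then so does `D * η * β`, which is `β / 2`.
  set D : ℝ := K * (Ku / (1 - H.κ)) + K * (Ks / (1 - H.κ)) + 1 with hD
  have hDpos : 0 < D := by positivity
  set η : ℝ := 1 / (2 * D) with hη
  have hηpos : 0 < η := by positivity
  obtain ⟨ρ₁, hρ₁, h1⟩ := H.chord_tangent η hηpos
  obtain ⟨ρ₂, hρ₂, h2⟩ := H.chord_map η hηpos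
  refine ⟨min ρ₁ ρ₂ / 2, by positivity, fun x y w hxy => ?_⟩
  have hbase : ∀ (z z' : M) (i : ℤ), ((T ^ i) (z, w)).2 = ((T ^ i) (z', w)).2 := fun z z' i => by
    rw [zpow_snd hT, zpow_snd hT]
  set p : ℤ → M × Ω := fun i => (T ^ i) (x, w) with hp
  set q : ℤ → M := fun i => ((T ^ i) (y, w)).1 with hq
  have hpT : ∀ i, p (i + 1) = T (p i) := fun i => by
    simp only [hp]; rw [add_comm, zpow_add, zpow_one, Homeomorph.mul_apply]
  have hqT : ∀ i, q (i + 1) = (T (q i, (p i).2)).1 := fun i => by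
    simp only [hp, hq]
    rw [add_comm, zpow_add, zpow_one, Homeomorph.mul_apply, hbase x y i]
  set Δ : ℤ → F := fun i => e (q i) - e (p i).1 with hΔ
  have hΔb : ∀ i, ‖Δ i‖ ≤ min ρ₁ ρ₂ / 2 := fun i => by
    rw [hΔ, norm_sub_rev]; exact hxy i
  have hm : 0 < min ρ₁ ρ₂ := lt_min hρ₁ hρ₂
  have hbdd : BddAbove (range fun i => ‖Δ i‖) := ⟨_, by rintro _ ⟨i, rfl⟩; exact hΔb i⟩
  set β : ℝ := ⨆ i, ‖Δ i‖ with hβ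
  have hβi : ∀ i, ‖Δ i‖ ≤ β := fun i => le_ciSup hbdd i
  have hβ0 : 0 ≤ β := (norm_nonneg _).trans (hβi 0)
  have hlt1 : ∀ i, ‖Δ i‖ < ρ₁ := fun i => by
    have := hΔb i; have := min_le_left ρ₁ ρ₂; linarith
  have hlt2 : ∀ i, ‖Δ i‖ < ρ₂ := fun i => by
    have := hΔb i; have := min_le_right ρ₁ ρ₂; linarith
  have hstep : ∀ i, ‖Δ (i + 1) - H.A (p i) (Δ i)‖ ≤ η * β := by
    intro i
    have := h2 (p i) (q i) (hlt2 i)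
    rw [← hqT, ← hpT] at this
    exact this.trans (by gcongr; exact hβi i)
  -- The stable component is contracted forwards.
  have hs : ∀ i, H.Ns (p i) (Δ i) ≤ Ks * (η * β) / (1 - H.κ) := by
    refine le_of_contracting (B := Ks * β) hκ0 H.κ_lt (fun i => (hKs _ _).trans ?_) fun i => ?_
    · gcongr; exact hβi i
    · have h3 : Δ (i + 1) = H.A (p i) (Δ i) + (Δ (i + 1) - H.A (p i) (Δ i)) := by abel
      rw [h3]
      refine (map_add_le_add _ _ _).trans (add_le_add ?_ ((hKs _ _).trans ?_))
      · rw [hpT]; exact H.Ns_A _ _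
      · gcongr; exact hstep i
  -- The unstable component is contracted backwards.
  have hu : ∀ i, H.Nu (p (-i)) (Δ (-i)) ≤ Ku * (η * β) / (1 - H.κ) := by
    refine le_of_contracting (a := fun i => H.Nu (p (-i)) (Δ (-i))) (B := Ku * β) hκ0 H.κ_lt
      (fun i => (hKu _ _).trans ?_) fun i => ?_
    · gcongr; exact hβi _
    · have h3 := hstep (-(i + 1))
      have h4 := H.Nu_A (p (-(i + 1))) (Δ (-(i + 1)))
      rw [← hpT] at h4
      have hi : -(i + 1) + 1 = -i := by ring
      rw [hi] at h3 h4
      have h5 : H.A (p (-(i + 1))) (Δ (-(i + 1))) =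
          Δ (-i) - (Δ (-i) - H.A (p (-(i + 1))) (Δ (-(i + 1)))) := by abel
      rw [h5] at h4
      have h6 := map_sub_le_add (H.Nu (p (-i))) (Δ (-i))
        (Δ (-i) - H.A (p (-(i + 1))) (Δ (-(i + 1))))
      have h7 := (hKu (p (-i)) (Δ (-i) - H.A (p (-(i + 1))) (Δ (-(i + 1))))).trans
        (mul_le_mul_of_nonneg_left h3 (by positivity))
      have h8 := mul_le_mul_of_nonneg_left (h6.trans (add_le_add_right h7 _)) hκ0
      have h9 : H.κ * (Ku * (η * β)) ≤ Ku * (η * β) := by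
        have : 0 ≤ Ku * (η * β) := by positivity
        nlinarith [H.κ_lt]
      rw [mul_add] at h8
      linarith
  have hfin : ∀ i, ‖Δ i‖ ≤ β / 2 := by
    intro i
    have h3 := h1 (p i) (q i) (hlt1 i)
    have h4 : ‖Δ i‖ ≤ ‖H.Pu (p i) (Δ i) + H.Ps (p i) (Δ i)‖ + η * β := by
      have h31 := norm_le_norm_add_norm_sub' (Δ i) (H.Pu (p i) (Δ i) + H.Ps (p i) (Δ i))
      have h32 := h3.trans (mul_le_mul_of_nonneg_left (hβi i) hηpos.le)
      exact h31.trans (add_le_add_right h32 _)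
    have h5 : ‖H.Pu (p i) (Δ i)‖ ≤ K * (Ku * (η * β) / (1 - H.κ)) := by
      have := hu (-i)
      rw [neg_neg] at this
      exact (H.norm_Pu_le _ _).trans (mul_le_mul hCK this (apply_nonneg _ _) (by positivity))
    have h6 : ‖H.Ps (p i) (Δ i)‖ ≤ K * (Ks * (η * β) / (1 - H.κ)) :=
      (H.norm_Ps_le _ _).trans (mul_le_mul hCK (hs i) (apply_nonneg _ _) (by positivity))
    have h7 : K * (Ku * (η * β) / (1 - H.κ)) + K * (Ks * (η * β) / (1 - H.κ)) + η * β = β / 2 := by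
      have : K * (Ku * (η * β) / (1 - H.κ)) + K * (Ks * (η * β) / (1 - H.κ)) + η * β =
        D * η * β := by rw [hD]; ring
      rw [this, hη]; field_simp
    have h8 := norm_add_le (H.Pu (p i) (Δ i)) (H.Ps (p i) (Δ i))
    linarith
  have hβ1 : β ≤ β / 2 := ciSup_le hfin
  have hβ2 : β = 0 := by linarith
  have h0 := hβi 0
  rw [hβ2, norm_le_zero_iff] at h0
  exact (hinj (sub_eq_zero.1 h0)).symm

end HyperbolicData

end Expansive

/-! ### Shadowing of pseudo-orbits -/

section Shadowing

variable {M Ω F : Type*} [TopologicalSpace M] [TopologicalSpace Ω] [NormedAddCommGroup F]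
  [NormedSpace ℝ F]

namespace HyperbolicData

variable {T : M × Ω ≃ₜ M × Ω} {e : M → F}

/-- The bounded solution of the linearized equation along a finite pseudo-orbit: the stable part
`s` is found forwards and the unstable part `u` backwards. -/
theorem exists_linear_correction (H : HyperbolicData T e) {K η ρ : ℝ} (hK1 : 1 ≤ K) (hCK : H.C ≤ K)
    (hA : ∀ p v, ‖H.A p v‖ ≤ K * ‖v‖) (hKu : ∀ p v, H.Nu p v ≤ K * ‖v‖)
    (hKs : ∀ p v, H.Ns p v ≤ K * ‖v‖) (hηpos : 0 < η) (hηκ : 2 * (η * K ^ 2) ≤ 1 - H.κ)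
    (h4 : ∀ (x y : M) (w : Ω), ‖e y - e x‖ < ρ → ∀ v, H.Nu (x, w) v ≤ H.Nu (y, w) v + η * ‖v‖)
    (h5 : ∀ (x y : M) (w : Ω), ‖e y - e x‖ < ρ → ∀ v, H.Ns (x, w) v ≤ H.Ns (y, w) v + η * ‖v‖)
    {L : ℕ} {w : ℕ → Ω} {z : ℕ → M} {β : ℝ} (hw : ∀ x i, (T (x, w i)).2 = w (i + 1))
    (hβ : 0 < β) (hβρ : β < ρ) {J : ℕ → F}
    (hJz : ∀ i, J i = e (z (i + 1)) - e (T (z i, w i)).1) (hJ : ∀ i < L, ‖J i‖ ≤ β) :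
    ∃ s u : ℕ → F, (∀ i, H.Ps (z i, w i) (s i) = s i) ∧
      (∀ i, s (i + 1) = H.Ps (z (i + 1), w (i + 1)) (H.A (z i, w i) (s i) - J i)) ∧
      (∀ i ≤ L, H.Pu (z i, w i) (u i) = u i) ∧
      (∀ i < L, H.A (z i, w i) (u i) = H.Pu (T (z i, w i)) (u (i + 1) + J i)) ∧
      (∀ i ≤ L, ‖s i‖ ≤ 2 * K ^ 2 / (1 - H.κ) * β) ∧
      ∀ i ≤ L, ‖u i‖ ≤ 2 * K ^ 2 / (1 - H.κ) * β := by
  have hK0 : 0 < K := by linarith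
  have hκ0 := H.κ_nonneg
  have hκ1 : 0 < 1 - H.κ := sub_pos.2 H.κ_lt
  set K₁ : ℝ := 2 * K ^ 2 / (1 - H.κ) with hK₁
  have hTp : ∀ i, T (z i, w i) = ((T (z i, w i)).1, w (i + 1)) := fun i =>
    Prod.ext rfl (hw _ _)
  -- The stable part of the correction.
  let s : ℕ → F := fun i => Nat.rec 0
    (fun i si => H.Ps (z (i + 1), w (i + 1)) (H.A (z i, w i) si - J i)) i
  have hs0 : s 0 = 0 := rfl
  have hss : ∀ i, s (i + 1) = H.Ps (z (i + 1), w (i + 1)) (H.A (z i, w i) (s i) - J i) :=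
    fun i => rfl
  have hsP : ∀ i, H.Ps (z i, w i) (s i) = s i := by
    intro i
    cases i with
    | zero => rw [hs0, map_zero]
    | succ i => rw [hss, H.Ps_Ps]
  -- The unstable part of the correction.
  choose g hg1 hg2 using H.exists_unstable
  let r : ℕ → F := fun k => Nat.rec 0
    (fun k rk => g (z (L - (k + 1)), w (L - (k + 1))) (rk + J (L - (k + 1)))) k
  let u : ℕ → F := fun i => r (L - i)
  have huL : u L = 0 := by simp [u, r]
  have huu : ∀ i < L, u i = g (z i, w i) (u (i + 1) + J i) := by
    intro i hi
    obtain ⟨k, hk⟩ : ∃ k, L - i = k + 1 := ⟨L - i - 1, by omega⟩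
    have hk1 : L - (i + 1) = k := by omega
    have hk2 : L - (k + 1) = i := by omega
    have : u i = g (z (L - (k + 1)), w (L - (k + 1))) (r k + J (L - (k + 1))) := by
      simp only [u, hk]; rfl
    rw [this, hk2]
    simp only [u, hk1]
  have huP : ∀ i ≤ L, H.Pu (z i, w i) (u i) = u i := by
    intro i hi
    rcases hi.lt_or_eq with hi | rfl
    · rw [huu i hi, hg1]
    · rw [huL, map_zero]
  have huA : ∀ i < L, H.A (z i, w i) (u i) = H.Pu (T (z i, w i)) (u (i + 1) + J i) := by
    intro i hi
    rw [huu i hi, hg2]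
  -- Each recursion contracts the adapted norm, up to the change of base point.
  have hsn : ∀ i, ‖s i‖ ≤ K * H.Ns (z i, w i) (s i) := fun i => by
    have := H.norm_Ps_le (z i, w i) (s i)
    rw [hsP] at this
    exact this.trans (mul_le_mul_of_nonneg_right hCK (apply_nonneg _ _))
  have hun : ∀ i ≤ L, ‖u i‖ ≤ K * H.Nu (z i, w i) (u i) := fun i hi => by
    have := H.norm_Pu_le (z i, w i) (u i)
    rw [huP i hi] at this
    exact this.trans (mul_le_mul_of_nonneg_right hCK (apply_nonneg _ _))
  have hKβ : 0 < K * β := by positivity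
  set a : ℝ := 2 * (K * β) / (1 - H.κ) with ha
  have ha0 : 0 < a := by positivity
  have haK : K * a = K₁ * β := by rw [ha, hK₁]; ring
  have ha' : a * (1 - H.κ) = 2 * (K * β) := by rw [ha]; field_simp
  have hsb : ∀ i ≤ L, H.Ns (z i, w i) (s i) ≤ a := by
    intro i
    induction i with
    | zero => intro _; rw [hs0, map_zero]; exact ha0.le
    | succ i ih =>
      intro hi
      have hi' : i < L := hi
      have ih := ih hi'.le
      set N := H.Ns (z i, w i) (s i) with hN
      have hN0 : 0 ≤ N := apply_nonneg _ _
      rw [hss, H.Ns_Ps]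
      have e1 := map_sub_le_add (H.Ns (z (i + 1), w (i + 1))) (H.A (z i, w i) (s i)) (J i)
      have e2 := (hKs (z (i + 1), w (i + 1)) (J i)).trans
        (mul_le_mul_of_nonneg_left (hJ i hi') hK0.le)
      have e3 := h5 (z (i + 1)) (T (z i, w i)).1 (w (i + 1))
        (by rw [norm_sub_rev, ← hJz]; exact (hJ i hi').trans_lt hβρ)
        (H.A (z i, w i) (s i))
      rw [← hTp] at e3
      have e4 := H.Ns_A (z i, w i) (s i)
      have e5 := (hA (z i, w i) (s i)).trans (mul_le_mul_of_nonneg_left (hsn i) hK0.le)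
      have e6 := mul_le_mul_of_nonneg_left e5 hηpos.le
      have e7 : η * (K * (K * N)) = (η * K ^ 2) * N := by ring
      have e8 : (η * K ^ 2) * N ≤ (1 - H.κ) / 2 * N :=
        mul_le_mul_of_nonneg_right (by linarith) hN0
      have e9 : (H.κ + (1 - H.κ) / 2) * N ≤ (H.κ + (1 - H.κ) / 2) * a :=
        mul_le_mul_of_nonneg_left ih (by linarith)
      have e10 : (H.κ + (1 - H.κ) / 2) * a = a - a * (1 - H.κ) / 2 := by ring
      have e11 : (H.κ + (1 - H.κ) / 2) * N = H.κ * N + (1 - H.κ) / 2 * N := by ring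
      linarith
  have hub : ∀ k i, i + k = L → H.Nu (z i, w i) (u i) ≤ a := by
    intro k
    induction k with
    | zero => intro i hi; rw [show i = L by omega, huL, map_zero]; exact ha0.le
    | succ k ih =>
      intro i hi
      have hi' : i < L := by omega
      have ih := ih (i + 1) (by omega)
      set N := H.Nu (z (i + 1), w (i + 1)) (u (i + 1)) with hN
      have hN0 : 0 ≤ N := apply_nonneg _ _
      have e1 := H.Nu_A (z i, w i) (u i)
      rw [huA i hi', H.Nu_Pu] at e1
      have e2 := map_add_le_add (H.Nu (T (z i, w i))) (u (i + 1)) (J i)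
      have e3 := (hKu (T (z i, w i)) (J i)).trans (mul_le_mul_of_nonneg_left (hJ i hi') hK0.le)
      have e4 := h4 (T (z i, w i)).1 (z (i + 1)) (w (i + 1))
        (by rw [← hJz]; exact (hJ i hi').trans_lt hβρ) (u (i + 1))
      rw [← hTp] at e4
      have e5 := mul_le_mul_of_nonneg_left (hun (i + 1) hi') hηpos.le
      have e6 : η * (K * N) ≤ (η * K ^ 2) * N := by
        have : η * (K * N) * 1 ≤ η * (K * N) * K :=
          mul_le_mul_of_nonneg_left hK1 (by positivity)
        linarith [show η * (K * N) * K = (η * K ^ 2) * N by ring]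
      have e8 : (η * K ^ 2) * N ≤ (1 - H.κ) / 2 * N :=
        mul_le_mul_of_nonneg_right (by linarith) hN0
      have e12 : H.Nu (T (z i, w i)) (u (i + 1) + J i) ≤ N + (1 - H.κ) / 2 * N + K * β := by
        linarith
      have e13 := e1.trans (mul_le_mul_of_nonneg_left e12 hκ0)
      have e14 : H.κ * ((1 - H.κ) / 2 * N) ≤ (1 - H.κ) / 2 * N := by
        have : 0 ≤ (1 - H.κ) / 2 * N := by positivity
        nlinarith
      have e15 : H.κ * (K * β) ≤ K * β := by nlinarith
      have e16 : (H.κ + (1 - H.κ) / 2) * N ≤ (H.κ + (1 - H.κ) / 2) * a :=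
        mul_le_mul_of_nonneg_left ih (by linarith)
      have e10 : (H.κ + (1 - H.κ) / 2) * a = a - a * (1 - H.κ) / 2 := by ring
      have e11 : (H.κ + (1 - H.κ) / 2) * N = H.κ * N + (1 - H.κ) / 2 * N := by ring
      have e17 : H.κ * (N + (1 - H.κ) / 2 * N + K * β) =
        H.κ * N + H.κ * ((1 - H.κ) / 2 * N) + H.κ * (K * β) := by ring
      linarith
  have hsb' : ∀ i ≤ L, ‖s i‖ ≤ K₁ * β := fun i hi =>
    (hsn i).trans ((mul_le_mul_of_nonneg_left (hsb i hi) hK0.le).trans haK.le)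
  have hub' : ∀ i ≤ L, ‖u i‖ ≤ K₁ * β := fun i hi =>
    (hun i hi).trans ((mul_le_mul_of_nonneg_left (hub (L - i) i (by omega)) hK0.le).trans haK.le)
  exact ⟨s, u, hsP, hss, huP, huA, hsb', hub'⟩

/-- The Newton step: a finite pseudo-orbit with errors at most `β` can be modified to one with
errors at most `β / 2`, by moving its points by at most `K β`. The correction is found by solving
the linearized equation, forwards in the stable and backwards in the unstable direction. -/
theorem exists_newton_step (H : HyperbolicData T e) [CompactSpace M] [CompactSpace Ω]
    [FiniteDimensional ℝ F] (he : Continuous e) (hinj : Function.Injective e) :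
    ∃ K > 0, ∃ ρ > 0, ∀ (L : ℕ) (w : ℕ → Ω) (z : ℕ → M) (β : ℝ),
      (∀ x i, (T (x, w i)).2 = w (i + 1)) → 0 < β → β ≤ ρ →
      (∀ i < L, ‖e (z (i + 1)) - e (T (z i, w i)).1‖ ≤ β) →
      ∃ z' : ℕ → M, (∀ i ≤ L, ‖e (z' i) - e (z i)‖ ≤ K * β) ∧
        ∀ i < L, ‖e (z' (i + 1)) - e (T (z' i, w i)).1‖ ≤ β / 2 := by
  obtain ⟨K₀, hK₀1, hCK₀, hPu₀, hPs₀, hA₀⟩ := H.exists_bound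
  obtain ⟨Ku, hKu1, hKu₀⟩ := exists_seminorm_bound H.continuous_Nu
  obtain ⟨Ks, hKs1, hKs₀⟩ := exists_seminorm_bound H.continuous_Ns
  -- One constant for all the bounds.
  obtain ⟨K, hK1, hCK, hA, hKu, hKs⟩ : ∃ K : ℝ, 1 ≤ K ∧ H.C ≤ K ∧
      (∀ p v, ‖H.A p v‖ ≤ K * ‖v‖) ∧ (∀ p v, H.Nu p v ≤ K * ‖v‖) ∧
      (∀ p v, H.Ns p v ≤ K * ‖v‖) := by
    refine ⟨max K₀ (max Ku Ks), hK₀1.trans (le_max_left _ _), hCK₀.trans (le_max_left _ _),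
      fun p v => (hA₀ p v).trans ?_, fun p v => (hKu₀ p v).trans ?_,
      fun p v => (hKs₀ p v).trans ?_⟩ <;> gcongr <;> simp
  have hK0 : 0 < K := by linarith
  have hκ0 := H.κ_nonneg
  have hκ1 : 0 < 1 - H.κ := sub_pos.2 H.κ_lt
  set K₁ : ℝ := 2 * K ^ 2 / (1 - H.κ) with hK₁
  have hK₁2 : 2 ≤ K₁ := by
    rw [hK₁, le_div_iff₀ hκ1]
    nlinarith
  -- With this `η`, the seven error terms of the new pseudo-orbit add up to at most `β / 2`.
  set η : ℝ := 1 / (24 * K * K₁) with hη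
  have hηpos : 0 < η := by positivity
  have hηK : η * (24 * K * K₁) = 1 := by rw [hη]; field_simp
  have hη1 : η ≤ 1 := by
    have : 1 ≤ 24 * K * K₁ := by nlinarith
    nlinarith
  have hηκ : 2 * (η * K ^ 2) ≤ 1 - H.κ := by
    have h1 : K₁ * (1 - H.κ) = 2 * K ^ 2 := by rw [hK₁]; field_simp
    have h2 : 2 * (η * K ^ 2) * (24 * K) = (1 - H.κ) * (η * (24 * K * K₁)) := by
      rw [show (1 - H.κ) * (η * (24 * K * K₁)) = η * 24 * K * (K₁ * (1 - H.κ)) by ring, h1]; ring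
    rw [hηK, mul_one] at h2
    nlinarith [show 0 ≤ 2 * (η * K ^ 2) by positivity]
  obtain ⟨ρ₁, hρ₁, h1⟩ := H.chord_tangent η hηpos
  obtain ⟨ρ₂, hρ₂, h2⟩ := H.chord_map η hηpos
  obtain ⟨ρ₃, hρ₃, h3⟩ := H.tangent_chord η hηpos
  obtain ⟨ρ₄, hρ₄, h4⟩ := exists_seminorm_close he hinj H.continuous_Nu hηpos
  obtain ⟨ρ₅, hρ₅, h5⟩ := exists_seminorm_close he hinj H.continuous_Ns hηpos
  obtain ⟨ρ₆, hρ₆, h6⟩ := exists_operator_close he hinj H.continuous_Pu hηpos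
  obtain ⟨ρ₇, hρ₇, h7⟩ := exists_operator_close he hinj H.continuous_Ps hηpos
  obtain ⟨m, hm, hm1, hm2, hm3, hm4, hm5, hm6, hm7⟩ : ∃ m > 0, m ≤ ρ₁ ∧ m ≤ ρ₂ ∧ m ≤ ρ₃ ∧
      m ≤ ρ₄ ∧ m ≤ ρ₅ ∧ m ≤ ρ₆ ∧ m ≤ ρ₇ := by
    refine ⟨min ρ₁ (min ρ₂ (min ρ₃ (min ρ₄ (min ρ₅ (min ρ₆ ρ₇))))), ?_, ?_⟩
    · simp only [gt_iff_lt, lt_min_iff]; tauto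
    · simp
  refine ⟨4 * K₁, by positivity, m / (8 * K₁), by positivity, ?_⟩
  intro L w z β hw hβ hβρ hJ
  have hβm : 8 * K₁ * β ≤ m := by
    rw [le_div_iff₀ (by positivity)] at hβρ; linarith
  have hβm1 : β < m := by nlinarith
  set J : ℕ → F := fun i => e (z (i + 1)) - e (T (z i, w i)).1 with hJdef
  have hTp : ∀ i, T (z i, w i) = ((T (z i, w i)).1, w (i + 1)) := fun i =>
    Prod.ext rfl (hw _ _)
  obtain ⟨s, u, hsP, hss, huP, huA, hsb', hub'⟩ := H.exists_linear_correction hK1 hCK hA hKu hKs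
    hηpos hηκ (fun x y w hxy => h4 x y w (hxy.trans_le hm4))
    (fun x y w hxy => h5 x y w (hxy.trans_le hm5)) hw hβ hβm1 (J := J) (fun i => rfl) hJ
  clear_value J
  have hJi : ∀ i, e (z (i + 1)) = J i + e (T (z i, w i)).1 := fun i => by rw [hJdef]; simp
  replace hJ : ∀ i < L, ‖J i‖ ≤ β := fun i hi => by rw [hJdef]; exact hJ i hi
  have hvb : ∀ i ≤ L, ‖s i + u i‖ ≤ 2 * (K₁ * β) := fun i hi =>
    (norm_add_le _ _).trans (by linarith [hsb' i hi, hub' i hi])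
  have hK₁β : 0 < K₁ * β := by positivity
  have hex : ∀ i, ∃ y, i ≤ L → ‖e y - e (z i) - (s i + u i)‖ ≤ η * (2 * (K₁ * β)) := by
    intro i
    by_cases hi : i ≤ L
    · obtain ⟨y, hy⟩ := h3 (z i, w i) (s i + u i) (by
        rw [← huP i hi, ← hsP i]
        simp [H.Pu_Ps, H.Ps_Pu, H.Pu_Pu, H.Ps_Ps, add_comm])
        (lt_of_le_of_lt (hvb i hi) (by linarith))
      exact ⟨y, fun _ => hy.trans (mul_le_mul_of_nonneg_left (hvb i hi) hηpos.le)⟩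
    · exact ⟨z i, fun h => absurd h hi⟩
  choose z' hz' using hex
  have hzz : ∀ i ≤ L, ‖e (z' i) - e (z i)‖ ≤ 4 * K₁ * β := by
    intro i hi
    have e1 := norm_le_norm_add_norm_sub' (e (z' i) - e (z i)) (s i + u i)
    have e2 := hz' i hi
    have e3 := hvb i hi
    have e4 : η * (2 * (K₁ * β)) ≤ 1 * (2 * (K₁ * β)) := by gcongr
    linarith
  refine ⟨z', hzz, fun i hi => ?_⟩
  have hi1 : i + 1 ≤ L := hi
  -- The new error is a sum of terms of higher order.
  set R₁ := e (z' (i + 1)) - e (z (i + 1)) - (s (i + 1) + u (i + 1)) with hR₁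
  set R₂ := e (T (z' i, w i)).1 - e (T (z i, w i)).1 - H.A (z i, w i) (e (z' i) - e (z i)) with hR₂
  set R₃ := H.A (z i, w i) (e (z' i) - e (z i) - (s i + u i)) with hR₃
  set R₄ := H.Ps (z (i + 1), w (i + 1)) (H.A (z i, w i) (s i)) -
    H.Ps (T (z i, w i)) (H.A (z i, w i) (s i)) with hR₄
  set R₅ := H.Pu (z (i + 1), w (i + 1)) (u (i + 1)) - H.Pu (T (z i, w i)) (u (i + 1)) with hR₅
  set R₆ := H.Pu (z (i + 1), w (i + 1)) (J i) - H.Pu (T (z i, w i)) (J i) with hR₆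
  set R₇ := -J i - (H.Pu (z (i + 1), w (i + 1)) (-J i) + H.Ps (z (i + 1), w (i + 1)) (-J i))
    with hR₇
  have hAs : H.Ps (T (z i, w i)) (H.A (z i, w i) (s i)) = H.A (z i, w i) (s i) := by
    rw [← H.A_Ps, hsP]
  have hsum : e (z' (i + 1)) - e (T (z' i, w i)).1 = R₁ - R₂ - R₃ + R₄ + R₅ + R₆ - R₇ := by
    simp only [hR₁, hR₂, hR₃, hR₄, hR₅, hR₆, hR₇]
    rw [huP _ hi1, hAs, hss, hJi i]
    simp only [map_sub, map_add, map_neg, huA i hi]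
    abel
  have hJm : ‖J i‖ ≤ β := hJ i hi
  have hJm' : ‖e (T (z i, w i)).1 - e (z (i + 1))‖ ≤ β := by
    rw [norm_sub_rev, hJi]; simpa using hJ i hi
  have b1 : ‖R₁‖ ≤ η * (2 * (K₁ * β)) := hz' _ hi1
  have b2 : ‖R₂‖ ≤ η * (4 * K₁ * β) :=
    (h2 (z i, w i) (z' i) (lt_of_le_of_lt (hzz i hi.le) (by linarith))).trans
      (mul_le_mul_of_nonneg_left (hzz i hi.le) hηpos.le)
  have b3 : ‖R₃‖ ≤ K * (η * (2 * (K₁ * β))) :=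
    (hA _ _).trans (mul_le_mul_of_nonneg_left (hz' i hi.le) hK0.le)
  have b4 : ‖R₄‖ ≤ η * (K * (K₁ * β)) := by
    have := h7 (T (z i, w i)).1 (z (i + 1)) (w (i + 1))
      (by rw [hJi]; simpa using (by linarith : ‖J i‖ < _))
      (H.A (z i, w i) (s i))
    rw [← hTp] at this
    exact this.trans (mul_le_mul_of_nonneg_left
      ((hA _ _).trans (mul_le_mul_of_nonneg_left (hsb' i hi.le) hK0.le)) hηpos.le)
  have b5 : ‖R₅‖ ≤ η * (K₁ * β) := by
    have := h6 (T (z i, w i)).1 (z (i + 1)) (w (i + 1))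
      (by rw [hJi]; simpa using (by linarith : ‖J i‖ < _))
      (u (i + 1))
    rw [← hTp] at this
    exact this.trans (mul_le_mul_of_nonneg_left (hub' _ hi1) hηpos.le)
  have b6 : ‖R₆‖ ≤ η * β := by
    have := h6 (T (z i, w i)).1 (z (i + 1)) (w (i + 1))
      (by rw [hJi]; simpa using (by linarith : ‖J i‖ < _)) (J i)
    rw [← hTp] at this
    exact this.trans (mul_le_mul_of_nonneg_left hJm hηpos.le)
  have b7 : ‖R₇‖ ≤ η * β := by
    have := h1 (z (i + 1), w (i + 1)) (T (z i, w i)).1 (lt_of_le_of_lt hJm' (by linarith))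
    have hneg : -J i = e (T (z i, w i)).1 - e (z (i + 1)) := by
      rw [hJi]; simp
    rw [hR₇, hneg]
    exact this.trans (mul_le_mul_of_nonneg_left hJm' hηpos.le)
  have hnorm : ‖R₁ - R₂ - R₃ + R₄ + R₅ + R₆ - R₇‖ ≤
      ‖R₁‖ + ‖R₂‖ + ‖R₃‖ + ‖R₄‖ + ‖R₅‖ + ‖R₆‖ + ‖R₇‖ := by
    have n1 := norm_sub_le (R₁ - R₂ - R₃ + R₄ + R₅ + R₆) R₇
    have n2 := norm_add_le (R₁ - R₂ - R₃ + R₄ + R₅) R₆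
    have n3 := norm_add_le (R₁ - R₂ - R₃ + R₄) R₅
    have n4 := norm_add_le (R₁ - R₂ - R₃) R₄
    have n5 := norm_sub_le (R₁ - R₂) R₃
    have n6 := norm_sub_le R₁ R₂
    linarith
  rw [hsum]
  refine hnorm.trans ?_
  have hx : 0 < η * (K₁ * β) := by positivity
  have c1 : η * β * 2 ≤ η * (K₁ * β) := by
    have := mul_le_mul_of_nonneg_left hK₁2 (show 0 ≤ η * β by positivity)
    linarith [show η * β * K₁ = η * (K₁ * β) by ring]
  have c2 : η * (K₁ * β) ≤ η * (K₁ * β) * K := by nlinarith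
  have c3 : η * (K₁ * β) * K * 24 = β := by
    rw [show η * (K₁ * β) * K * 24 = η * (24 * K * K₁) * β by ring, hηK, one_mul]
  have d2 : η * (2 * (K₁ * β)) = 2 * (η * (K₁ * β)) := by ring
  have d3 : η * (4 * K₁ * β) = 4 * (η * (K₁ * β)) := by ring
  have d4 : K * (η * (2 * (K₁ * β))) = 2 * (η * (K₁ * β) * K) := by ring
  have d5 : η * (K * (K₁ * β)) = η * (K₁ * β) * K := by ring
  linarith

/-- Finite pseudo-orbits are close to orbits: the errors, plus a small multiple of the distance
to the given pseudo-orbit, attain a minimum on a compact product, and by the Newton step the errors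
vanish there. -/
theorem exists_finite_shadowing (H : HyperbolicData T e) [CompactSpace M] [CompactSpace Ω]
    [FiniteDimensional ℝ F] (he : Continuous e) (hinj : Function.Injective e) :
    ∃ K > 0, ∃ ρ > 0, ∀ (L : ℕ) (w : ℕ → Ω) (z : ℕ → M) (β : ℝ),
      (∀ x i, (T (x, w i)).2 = w (i + 1)) → 0 < β → β ≤ ρ →
      (∀ i < L, ‖e (z (i + 1)) - e (T (z i, w i)).1‖ ≤ β) →
      ∃ z' : ℕ → M, (∀ i ≤ L, ‖e (z' i) - e (z i)‖ ≤ K * β) ∧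
        ∀ i < L, z' (i + 1) = (T (z' i, w i)).1 := by
  obtain ⟨K, hK, ρ, hρ, hN⟩ := H.exists_newton_step he hinj
  refine ⟨4 * K, by positivity, ρ, hρ, fun L w z β hw hβ hβρ hJ => ?_⟩
  -- A Newton step decreases `jump` by half and increases `dist'` by at most `K` times `jump`; with
  -- the weight `1 / (4 * K)` it decreases the functional below unless `jump` vanishes.
  let jump : (ℕ → M) → NNReal := fun y =>
    (Finset.range L).sup fun i => ‖e (y (i + 1)) - e (T (y i, w i)).1‖₊
  let dist' : (ℕ → M) → (ℕ → M) → NNReal := fun y y' =>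
    (Finset.range (L + 1)).sup fun i => ‖e (y i) - e (y' i)‖₊
  have hjump : ∀ y (c : ℝ), 0 ≤ c →
      ((jump y : ℝ) ≤ c ↔ ∀ i < L, ‖e (y (i + 1)) - e (T (y i, w i)).1‖ ≤ c) := by
    intro y c hc
    lift c to NNReal using hc
    simp only [jump, NNReal.coe_le_coe, Finset.sup_le_iff, Finset.mem_range, ← coe_nnnorm]
  have hdist : ∀ y y' (c : ℝ), 0 ≤ c →
      ((dist' y y' : ℝ) ≤ c ↔ ∀ i ≤ L, ‖e (y i) - e (y' i)‖ ≤ c) := by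
    intro y y' c hc
    lift c to NNReal using hc
    simp only [dist', NNReal.coe_le_coe, Finset.sup_le_iff, Finset.mem_range, ← coe_nnnorm,
      Nat.lt_succ_iff]
  have htri : ∀ y y', (dist' y z : ℝ) ≤ dist' y y' + dist' y' z := by
    intro y y'
    rw [hdist _ _ _ (by positivity)]
    intro i hi
    have h1 := (hdist y y' _ (by positivity)).1 le_rfl i hi
    have h2 := (hdist y' z _ (by positivity)).1 le_rfl i hi
    have h3 := norm_sub_le_norm_sub_add_norm_sub (e (y i)) (e (y' i)) (e (z i))
    linarith
  have hcont : Continuous fun y : ℕ → M => (jump y : ℝ) + 1 / (4 * K) * dist' y z := by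
    have h1 : Continuous jump := Continuous.finset_sup_apply (fun i _ => by fun_prop)
    have h2 : Continuous fun y => dist' y z := Continuous.finset_sup_apply (fun i _ => by fun_prop)
    fun_prop
  obtain ⟨y, -, hy⟩ := isCompact_univ.exists_isMinOn ⟨z, mem_univ z⟩ hcont.continuousOn
  have hyz : (jump y : ℝ) + 1 / (4 * K) * dist' y z ≤ β := by
    have h1 : (jump y : ℝ) + 1 / (4 * K) * dist' y z ≤ jump z + 1 / (4 * K) * dist' z z :=
      hy (mem_univ z)
    have h2 : (dist' z z : ℝ) ≤ 0 := (hdist z z 0 le_rfl).2 (by simp)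
    have h3 := (hjump z β hβ.le).2 hJ
    have h4 : (dist' z z : ℝ) = 0 := le_antisymm h2 (by positivity)
    rw [h4, mul_zero, add_zero] at h1
    exact h1.trans h3
  have hd0 : 0 ≤ 1 / (4 * K) * (dist' y z : ℝ) := by positivity
  have hj0 : (jump y : ℝ) = 0 := by
    by_contra hne
    have hpos : 0 < (jump y : ℝ) := lt_of_le_of_ne (by positivity) (Ne.symm hne)
    obtain ⟨y', h1, h2⟩ := hN L w y (jump y) hw hpos (by linarith)
      ((hjump y _ hpos.le).1 le_rfl)
    rw [← hdist y' y _ (by positivity)] at h1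
    rw [← hjump y' _ (by positivity)] at h2
    have h3 : (jump y : ℝ) + 1 / (4 * K) * dist' y z ≤ jump y' + 1 / (4 * K) * dist' y' z :=
      hy (mem_univ y')
    have h4 := mul_le_mul_of_nonneg_left (htri y' y) (show 0 ≤ 1 / (4 * K) by positivity)
    have h5 := mul_le_mul_of_nonneg_left h1 (show 0 ≤ 1 / (4 * K) by positivity)
    have h6 : 1 / (4 * K) * (K * (jump y : ℝ)) = jump y / 4 := by field_simp
    rw [mul_add] at h4
    linarith
  refine ⟨y, (hdist y z _ (by positivity)).1 ?_, fun i hi => ?_⟩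
  · have : 1 / (4 * K) * (dist' y z : ℝ) ≤ β := by linarith
    rw [one_div, inv_mul_le_iff₀ (by positivity)] at this
    exact this
  · have := (hjump y 0 le_rfl).1 hj0.le i hi
    exact hinj (sub_eq_zero.1 (norm_le_zero_iff.1 this))

/-- Hyperbolic skew products have the shadowing property along the fibres: by finite shadowing, the
sets of points which shadow a pseudo-orbit on finite windows are nonempty, compact and nested. -/
theorem fiberShadowing (H : HyperbolicData T e) [CompactSpace M] [CompactSpace Ω]
    [FiniteDimensional ℝ F] (he : Continuous e) (hinj : Function.Injective e) {θ : Ω ≃ₜ Ω}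
    (hT : ∀ p, (T p).2 = θ p.2) : FiberShadowing T θ e := by
  obtain ⟨K, hK, ρ, hρ, hS⟩ := H.exists_finite_shadowing he hinj
  intro ε hε
  refine ⟨min ρ (ε / K), by positivity, fun w z hz => ?_⟩
  set β := min ρ (ε / K) with hβ
  have hβ0 : 0 < β := by positivity
  have hKβ : K * β ≤ ε := by
    calc K * β ≤ K * (ε / K) := by gcongr; exact min_le_right _ _
      _ = ε := by field_simp
  have hθ : ∀ i : ℤ, (θ ^ (i + 1)) w = θ ((θ ^ i) w) := fun i => by
    rw [add_comm, zpow_add, zpow_one, Homeomorph.mul_apply]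
  let C : ℕ → Set M := fun L => {x | ∀ i : ℤ, |i| ≤ L → ‖e ((T ^ i) (x, w)).1 - e (z i)‖ ≤ ε}
  have hCc : ∀ L, IsClosed (C L) := by
    intro L
    simp only [C, ofPred_forall]
    refine isClosed_iInter fun i => isClosed_iInter fun _ => isClosed_le ?_ continuous_const
    have : Continuous (T ^ i) := (T ^ i).continuous
    fun_prop
  have hCne : ∀ L, (C L).Nonempty := by
    intro L
    obtain ⟨y, h1, h2⟩ := hS (2 * L) (fun i => (θ ^ ((i : ℤ) - L)) w)
      (fun i => z ((i : ℤ) - L)) β (fun x i => by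
        rw [hT]; push_cast; rw [show (i : ℤ) + 1 - L = (i - L) + 1 by ring, hθ]) hβ0
      (min_le_left _ _) (fun i _ => by
        have := hz ((i : ℤ) - L)
        rw [show (i : ℤ) - L + 1 = ((i + 1 : ℕ) : ℤ) - L by push_cast; ring] at this
        exact this)
    have h3 : ∀ i ≤ 2 * L, (T ^ ((i : ℤ) - L)) ((T ^ (L : ℤ)) (y 0, (θ ^ (-(L : ℤ))) w)) =
        (y i, (θ ^ ((i : ℤ) - L)) w) := by
      intro i
      induction i with
      | zero =>
        intro _
        rw [← Homeomorph.mul_apply, ← zpow_add]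
        simp
      | succ i ih =>
        intro hi
        have := ih (by omega)
        rw [show ((i + 1 : ℕ) : ℤ) - L = 1 + (i - L) by push_cast; ring, zpow_add T, zpow_one,
          Homeomorph.mul_apply, this, h2 i (by omega), add_comm, hθ]
        exact Prod.ext rfl (hT _)
    obtain ⟨x, hx⟩ : ∃ x, (T ^ (L : ℤ)) (y 0, (θ ^ (-(L : ℤ))) w) = (x, w) := by
      have := h3 L (by omega)
      simp only [sub_self, zpow_zero, Homeomorph.one_apply] at this
      exact ⟨_, this⟩
    refine ⟨x, fun i hi => ?_⟩
    obtain ⟨k, hk⟩ : ∃ k : ℕ, (k : ℤ) - L = i := ⟨(i + L).toNat, by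
      rw [abs_le] at hi; rw [Int.toNat_of_nonneg (by omega)]; ring⟩
    have hk' : k ≤ 2 * L := by rw [abs_le] at hi; omega
    have := h1 k hk'
    rw [hk] at this
    have h4 := h3 k hk'
    rw [hx, hk] at h4
    rw [h4]
    exact this.trans hKβ
  obtain ⟨x, hx⟩ := IsCompact.nonempty_iInter_of_sequence_nonempty_isCompact_isClosed C
    (fun L x hx i hi => hx i (hi.trans (by push_cast; omega))) hCne (hCc 0).isCompact hCc
  refine ⟨x, fun i => ?_⟩
  exact mem_iInter.1 hx i.natAbs i (by simp)

end HyperbolicData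

end Shadowing

/-! ### Continuous families of diffeomorphisms in charts -/

section Charts

variable {d : ℕ} {M : Type*} [TopologicalSpace M] [ChartedSpace (EuclideanSpace ℝ (Fin d)) M]
  {Ω : Type*} [TopologicalSpace Ω] {F : Type*} [NormedAddCommGroup F] [NormedSpace ℝ F]

theorem norm_fderiv_sub_le_of_iteratedFDeriv {E G : Type*} [NormedAddCommGroup E] [NormedSpace ℝ E]
    [NormedAddCommGroup G] [NormedSpace ℝ G] (a b : E → G) (u : E) :
    ‖fderiv ℝ a u - fderiv ℝ b u‖ ≤ ‖iteratedFDeriv ℝ 1 a u - iteratedFDeriv ℝ 1 b u‖ := by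
  refine ContinuousLinearMap.opNorm_le_bound _ (norm_nonneg _) fun v => ?_
  have := (iteratedFDeriv ℝ 1 a u - iteratedFDeriv ℝ 1 b u).le_opNorm (fun _ => v)
  simpa [iteratedFDeriv_one_apply] using this

/-- A `C^2` diffeomorphism read in two smooth charts is `C^2`. -/
theorem contDiffAt_chart_diffeo (h : DiffTwo d M)
    {φ ψ : OpenPartialHomeomorph M (EuclideanSpace ℝ (Fin d))}
    (hφ : φ ∈ IsManifold.maximalAtlas (𝓡 d) ∞ M) (hψ : ψ ∈ IsManifold.maximalAtlas (𝓡 d) ∞ M)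
    {u : EuclideanSpace ℝ (Fin d)} (hu : u ∈ φ.target) (hu' : h (φ.symm u) ∈ ψ.source) :
    ContDiffAt ℝ 2 (fun v => ψ (h (φ.symm v))) u := by
  have h1 : ContMDiffAt (𝓡 d) (𝓡 d) 2 φ.symm u :=
    (contMDiffAt_symm_of_mem_maximalAtlas hφ hu).of_le (by norm_cast)
  have h2 : ContMDiffAt (𝓡 d) (𝓡 d) 2 ψ (h (φ.symm u)) :=
    (contMDiffAt_of_mem_maximalAtlas hψ hu').of_le (by norm_cast)
  exact ((h2.comp _ h.contMDiff.contMDiffAt).comp u h1).contDiffAt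

theorem contDiffAt_embedding_diffeo (h : DiffTwo d M) {e : M → F}
    (he : ContMDiff (𝓡 d) 𝓘(ℝ, F) ∞ e)
    {φ : OpenPartialHomeomorph M (EuclideanSpace ℝ (Fin d))}
    (hφ : φ ∈ IsManifold.maximalAtlas (𝓡 d) ∞ M)
    {u : EuclideanSpace ℝ (Fin d)} (hu : u ∈ φ.target) :
    ContDiffAt ℝ 2 (fun v => e (h (φ.symm v))) u := by
  have h1 : ContMDiffAt (𝓡 d) (𝓡 d) 2 φ.symm u :=
    (contMDiffAt_symm_of_mem_maximalAtlas hφ hu).of_le (by norm_cast)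
  have h2 : ContMDiffAt (𝓡 d) 𝓘(ℝ, F) 2 e (h (φ.symm u)) := he.contMDiffAt.of_le (by norm_cast)
  exact ((h2.comp _ h.contMDiff.contMDiffAt).comp u h1).contDiffAt

/-- In charts, the derivative of a continuous family of `C^2` diffeomorphisms is jointly
continuous. -/
theorem continuousAt_fderiv_chart {f : Ω → DiffTwo d M} (hf : Continuous f) (x₀ : M) (w₀ : Ω)
    {φ ψ : OpenPartialHomeomorph M (EuclideanSpace ℝ (Fin d))}
    (hφ : φ ∈ IsManifold.maximalAtlas (𝓡 d) ∞ M) (hψ : ψ ∈ IsManifold.maximalAtlas (𝓡 d) ∞ M)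
    (hx : x₀ ∈ φ.source) (hx' : f w₀ x₀ ∈ ψ.source) :
    ContinuousAt (fun q : EuclideanSpace ℝ (Fin d) × Ω =>
      fderiv ℝ (fun v => ψ (f q.2 (φ.symm v))) q.1) (φ x₀, w₀) := by
  have : LocallyCompactSpace M :=
    ChartedSpace.locallyCompactSpace (EuclideanSpace ℝ (Fin d)) M
  have hcont : Continuous (f w₀) := (f w₀).continuous
  have hU : φ.source ∩ (f w₀) ⁻¹' ψ.source ∈ 𝓝 x₀ :=
    inter_mem (φ.open_source.mem_nhds hx)
      (hcont.continuousAt.preimage_mem_nhds (ψ.open_source.mem_nhds hx'))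
  obtain ⟨K, hK, hKU, hKc⟩ := local_compact_nhds hU
  have hK' : ∀ᶠ u in 𝓝 (φ x₀), u ∈ φ.target ∧ φ.symm u ∈ K := by
    refine Filter.Eventually.and (φ.open_target.mem_nhds (φ.map_source hx)) ?_
    refine (φ.continuousAt_symm (φ.map_source hx)).eventually_mem ?_
    rwa [φ.left_inv hx]
  have hC : ContinuousAt (fun u => fderiv ℝ (fun v => ψ (f w₀ (φ.symm v))) u) (φ x₀) := by
    have := contDiffAt_chart_diffeo (f w₀) hφ hψ (φ.map_source hx) (by rwa [φ.left_inv hx])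
    exact (this.fderiv_right (m := 1) (by norm_num)).continuousAt
  rw [ContinuousAt, Metric.tendsto_nhds]
  intro ε hε
  have hopen : IsOpen (c2Neighborhood (f w₀) φ ψ K (ε / 2)) :=
    TopologicalSpace.isOpen_generateFrom_of_mem ⟨f w₀, φ, ψ, K, ε / 2, hφ, hψ, hKc,
      fun x hx => (hKU hx).1, fun x hx => (hKU hx).2, half_pos hε, rfl⟩
  have hnear : ∀ᶠ w in 𝓝 w₀, f w ∈ c2Neighborhood (f w₀) φ ψ K (ε / 2) := by
    refine hf.continuousAt.preimage_mem_nhds (hopen.mem_nhds ⟨fun x hx => (hKU hx).2, ?_⟩)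
    intro j _ x _
    simpa using half_pos hε
  have h2 := (Metric.tendsto_nhds.1 hC (ε / 2) (half_pos hε)).and hK'
  rw [nhds_prod_eq]
  filter_upwards [h2.prod_mk hnear] with q hq
  obtain ⟨⟨h3, h4, h5⟩, h6⟩ := hq
  have h7 := h6.2 1 (by norm_num) _ h5
  rw [φ.right_inv h4] at h7
  have h8 := (norm_fderiv_sub_le_of_iteratedFDeriv _ _ _).trans_lt h7
  rw [← dist_eq_norm] at h8
  refine (dist_triangle _ _ _).trans_lt ((add_lt_add h8 h3).trans_eq (add_halves ε))

variable [IsManifold (𝓡 d) ∞ M]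

/-- The derivative in charts of a continuous family of `C^2` diffeomorphisms followed by a smooth
map to a vector space is jointly continuous. -/
theorem continuousAt_fderiv_embedding {f : Ω → DiffTwo d M} (hf : Continuous f) {e : M → F}
    (he : ContMDiff (𝓡 d) 𝓘(ℝ, F) ∞ e) (x₀ : M) (w₀ : Ω)
    {φ : OpenPartialHomeomorph M (EuclideanSpace ℝ (Fin d))}
    (hφ : φ ∈ IsManifold.maximalAtlas (𝓡 d) ∞ M) (hx : x₀ ∈ φ.source) :
    ContinuousAt (fun q : EuclideanSpace ℝ (Fin d) × Ω =>
      fderiv ℝ (fun v => e (f q.2 (φ.symm v))) q.1) (φ x₀, w₀) := by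
  set ψ := chartAt (EuclideanSpace ℝ (Fin d)) (f w₀ x₀) with hψdef
  have hψ : ψ ∈ IsManifold.maximalAtlas (𝓡 d) ∞ M := IsManifold.chart_mem_maximalAtlas _
  have hx' : f w₀ x₀ ∈ ψ.source := mem_chart_source _ _
  have hev : ContinuousAt (fun q : EuclideanSpace ℝ (Fin d) × Ω => f q.2 (φ.symm q.1))
      (φ x₀, w₀) := by
    have h1 := (continuous_eval hf).continuousAt (x := (x₀, w₀))
    have h2 : ContinuousAt (fun q : EuclideanSpace ℝ (Fin d) × Ω => (φ.symm q.1, q.2))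
        (φ x₀, w₀) :=
      (ContinuousAt.comp (x := (φ x₀, w₀)) (f := Prod.fst) (g := φ.symm)
        (φ.continuousAt_symm (φ.map_source hx)) continuousAt_fst).prodMk continuousAt_snd
    refine ContinuousAt.comp (g := fun p : M × Ω => f p.2 p.1) ?_ h2
    simpa [φ.left_inv hx] using h1
  have hmem : ∀ᶠ q : EuclideanSpace ℝ (Fin d) × Ω in 𝓝 (φ x₀, w₀),
      q.1 ∈ φ.target ∧ f q.2 (φ.symm q.1) ∈ ψ.source := by
    refine (continuousAt_fst.eventually_mem (φ.open_target.mem_nhds (φ.map_source hx))).and ?_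
    refine hev.eventually_mem (ψ.open_source.mem_nhds ?_)
    simpa [φ.left_inv hx] using hx'
  have hE : ContDiffAt ℝ 2 (fun v => e (ψ.symm v)) (ψ (f w₀ x₀)) := by
    simpa using contDiffAt_embedding_diffeo (Diffeomorph.refl (𝓡 d) M 2) he hψ
      (ψ.map_source hx')
  have hD : ContinuousAt (fun q : EuclideanSpace ℝ (Fin d) × Ω =>
      (fderiv ℝ (fun v => e (ψ.symm v)) (ψ (f q.2 (φ.symm q.1)))).comp
        (fderiv ℝ (fun v => ψ (f q.2 (φ.symm v))) q.1)) (φ x₀, w₀) := by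
    refine ContinuousAt.clm_comp ?_ (continuousAt_fderiv_chart hf x₀ w₀ hφ hψ hx hx')
    have h1 : ContinuousAt (fderiv ℝ (fun v => e (ψ.symm v))) (ψ (f w₀ x₀)) :=
      (hE.fderiv_right (m := 1) (by norm_num)).continuousAt
    have h2 : ContinuousAt (fun q : EuclideanSpace ℝ (Fin d) × Ω => ψ (f q.2 (φ.symm q.1)))
        (φ x₀, w₀) := by
      refine ContinuousAt.comp (g := ψ) ?_ hev
      simpa [φ.left_inv hx] using ψ.continuousAt hx'
    refine ContinuousAt.comp (g := fderiv ℝ (fun v => e (ψ.symm v))) ?_ h2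
    simpa [φ.left_inv hx] using h1
  refine hD.congr ?_
  filter_upwards [hmem] with q hq
  have h1 : DifferentiableAt ℝ (fun v => ψ (f q.2 (φ.symm v))) q.1 :=
    (contDiffAt_chart_diffeo (f q.2) hφ hψ hq.1 hq.2).differentiableAt (by norm_num)
  have h2 : DifferentiableAt ℝ (fun v => e (ψ.symm v)) (ψ (f q.2 (φ.symm q.1))) := by
    have : ContDiffAt ℝ 2 (fun v => e (ψ.symm v)) (ψ (f q.2 (φ.symm q.1))) := by
      simpa using contDiffAt_embedding_diffeo (Diffeomorph.refl (𝓡 d) M 2) he hψ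
        (ψ.map_source hq.2)
    exact this.differentiableAt (by norm_num)
  rw [← fderiv_comp q.1 h2 h1]
  refine Filter.EventuallyEq.fderiv_eq ?_
  have h3 : ContinuousAt (fun v => f q.2 (φ.symm v)) q.1 :=
    ((f q.2).continuous.continuousAt).comp (φ.continuousAt_symm hq.1)
  filter_upwards [h3.eventually_mem (ψ.open_source.mem_nhds hq.2)] with v hv
  simp [ψ.left_inv hv]

/-- Joint strict differentiability: the first order expansion in a chart of a continuous family of
`C^2` diffeomorphisms, followed by a smooth map to a vector space. -/
theorem eventually_chart_expansion {f : Ω → DiffTwo d M} (hf : Continuous f) {e : M → F}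
    (he : ContMDiff (𝓡 d) 𝓘(ℝ, F) ∞ e) (x₀ : M) (w₀ : Ω)
    {φ : OpenPartialHomeomorph M (EuclideanSpace ℝ (Fin d))}
    (hφ : φ ∈ IsManifold.maximalAtlas (𝓡 d) ∞ M) (hx : x₀ ∈ φ.source) {η : ℝ} (hη : 0 < η) :
    ∀ᶠ q : (EuclideanSpace ℝ (Fin d) × EuclideanSpace ℝ (Fin d)) × Ω in
      𝓝 ((φ x₀, φ x₀), w₀),
      ‖e (f q.2 (φ.symm q.1.2)) - e (f q.2 (φ.symm q.1.1)) -
        fderiv ℝ (fun v => e (f w₀ (φ.symm v))) (φ x₀) (q.1.2 - q.1.1)‖ ≤ η * ‖q.1.2 - q.1.1‖ := by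
  have h1 := Metric.tendsto_nhds.1 (continuousAt_fderiv_embedding hf he x₀ w₀ hφ hx) η hη
  have h2 : ∀ᶠ q : EuclideanSpace ℝ (Fin d) × Ω in 𝓝 (φ x₀, w₀), q.1 ∈ φ.target :=
    continuousAt_fst.eventually_mem (φ.open_target.mem_nhds (φ.map_source hx))
  have h3 := h1.and h2
  rw [nhds_prod_eq] at h3
  obtain ⟨pa, hpa, pb, hpb, hab⟩ := eventually_prod_iff.1 h3
  obtain ⟨r, hr, hball⟩ := Metric.eventually_nhds_iff_ball.1 hpa
  have h4 : ∀ᶠ u in 𝓝 (φ x₀), u ∈ Metric.ball (φ x₀) r := Metric.ball_mem_nhds _ hr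
  have h5 := (h4.prod_mk h4).prod_mk hpb
  rw [← nhds_prod_eq, ← nhds_prod_eq] at h5
  filter_upwards [h5] with q hq
  obtain ⟨⟨hu, hu'⟩, hw⟩ := hq
  refine (convex_ball (φ x₀) r).norm_image_sub_le_of_norm_fderiv_le'
    (f := fun v => e (f q.2 (φ.symm v))) (𝕜 := ℝ) (fun u hu => ?_) (fun u hu => ?_) hu hu'
  · exact (contDiffAt_embedding_diffeo (f q.2) he hφ
      (hab (hball u hu) hw).2).differentiableAt (by norm_num)
  · have := (hab (hball u hu) hw).1
    rw [dist_eq_norm] at this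
    exact this.le

/-- The chain rule for the derivative along the fibre, computed in a chart. -/
theorem mfderiv_embedding_diffeo (h : DiffTwo d M) {e : M → F}
    (he : ContMDiff (𝓡 d) 𝓘(ℝ, F) ∞ e) (x₀ : M) {x : M}
    (hx : x ∈ (chartAt (EuclideanSpace ℝ (Fin d)) x₀).source) (v : TangentSpace (𝓡 d) x) :
    mfderiv (𝓡 d) 𝓘(ℝ, F) e (h x) (mfderiv (𝓡 d) (𝓡 d) h x v) =
      fderiv ℝ (fun u => e (h ((chartAt (EuclideanSpace ℝ (Fin d)) x₀).symm u)))
        (chartAt (EuclideanSpace ℝ (Fin d)) x₀ x)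
        ((trivializationAt (EuclideanSpace ℝ (Fin d)) (TangentSpace (𝓡 d)) x₀).continuousLinearMapAt
          ℝ x v) := by
  set c := chartAt (EuclideanSpace ℝ (Fin d)) x₀ with hc
  have h1 : HasMFDerivAt (𝓡 d) 𝓘(ℝ, F) (fun y => e (h y)) x
      ((mfderiv (𝓡 d) 𝓘(ℝ, F) e (h x)).comp (mfderiv (𝓡 d) (𝓡 d) h x)) :=
    HasMFDerivAt.comp x ((he.mdifferentiable (by simp)) (h x)).hasMFDerivAt
      ((h.contMDiff.mdifferentiable (by simp)) x).hasMFDerivAt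
  have h2 : HasFDerivAt (fun u => e (h (c.symm u)))
      (fderiv ℝ (fun u => e (h (c.symm u))) (c x)) (c x) :=
    ((contDiffAt_embedding_diffeo h he (IsManifold.chart_mem_maximalAtlas x₀)
      (c.map_source hx)).differentiableAt (by norm_num)).hasFDerivAt
  have h3 : HasMFDerivAt (𝓡 d) 𝓘(ℝ, EuclideanSpace ℝ (Fin d)) (extChartAt (𝓡 d) x₀) x
      (mfderiv (𝓡 d) 𝓘(ℝ, EuclideanSpace ℝ (Fin d)) (extChartAt (𝓡 d) x₀) x) :=
    (mdifferentiableAt_extChartAt hx).hasMFDerivAt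
  have h4 := HasMFDerivAt.comp x (g := fun u => e (h (c.symm u))) (f := extChartAt (𝓡 d) x₀)
    h2.hasMFDerivAt h3
  have h5 : HasMFDerivAt (𝓡 d) 𝓘(ℝ, F) (fun y => e (h y)) x _ := h4.congr_of_eventuallyEq (by
    filter_upwards [c.open_source.mem_nhds hx] with y hy
    simp [← hc, c.left_inv hy])
  rw [TangentBundle.continuousLinearMapAt_trivializationAt hx]
  exact DFunLike.congr_fun (hasMFDerivAt_unique h1 h5) v

/-- The derivative along the fibres maps continuous families of tangent vectors to continuous
families of vectors. -/
theorem continuousAt_mfderiv_apply {f : Ω → DiffTwo d M} (hf : Continuous f) {e : M → F}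
    (he : ContMDiff (𝓡 d) 𝓘(ℝ, F) ∞ e) {p₀ : M × Ω}
    {X : ∀ p : M × Ω, TangentSpace (𝓡 d) p.1}
    (hX : ContinuousAt (fun p => (⟨p.1, X p⟩ : TangentBundle (𝓡 d) M)) p₀) :
    ContinuousAt (fun p : M × Ω => (mfderiv (𝓡 d) 𝓘(ℝ, F) e (f p.2 p.1)
      (mfderiv (𝓡 d) (𝓡 d) (f p.2) p.1 (X p)) : F)) p₀ := by
  set c := chartAt (EuclideanSpace ℝ (Fin d)) p₀.1 with hc
  have hmem : ∀ᶠ p : M × Ω in 𝓝 p₀, p.1 ∈ c.source :=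
    continuousAt_fst.eventually_mem (c.open_source.mem_nhds (mem_chart_source _ _))
  have h1 : ContinuousAt (fun p : M × Ω => (trivializationAt (EuclideanSpace ℝ (Fin d))
      (TangentSpace (𝓡 d)) p₀.1 ⟨p.1, X p⟩).2) p₀ := by
    rw [FiberBundle.continuousAt_totalSpace] at hX
    exact hX.2
  have h2 : ContinuousAt (fun p : M × Ω =>
      fderiv ℝ (fun u => e (f p.2 (c.symm u))) (c p.1)) p₀ := by
    refine ContinuousAt.comp (f := fun p : M × Ω => (c p.1, p.2)) (g := fun q :
      EuclideanSpace ℝ (Fin d) × Ω => fderiv ℝ (fun v => e (f q.2 (c.symm v))) q.1)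
      (continuousAt_fderiv_embedding hf he p₀.1 p₀.2 (IsManifold.chart_mem_maximalAtlas _)
      (mem_chart_source _ _)) ?_
    exact ((c.continuousAt (mem_chart_source _ _)).comp continuousAt_fst).prodMk continuousAt_snd
  refine (h2.clm_apply h1).congr ?_
  filter_upwards [hmem] with p hp
  rw [mfderiv_embedding_diffeo (f p.2) he p₀.1 hp, ← hc]
  congr 1
  rw [Bundle.Trivialization.continuousLinearMapAt_apply]
  rw [Bundle.Trivialization.coe_linearMapAt_of_mem]
  simpa using hp

end Charts

/-! ### Dual frames and left inverses -/

section LinearAlgebra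

variable {F : Type*} [NormedAddCommGroup F] [InnerProductSpace ℝ F]

/-- Linearly independent vectors which depend continuously on a parameter have coordinate
functionals which depend continuously on it, and which vanish on the orthogonal complement. They are
given by the inverse of the Gram matrix. -/
theorem exists_continuousAt_dual_frame {X ι : Type*} [TopologicalSpace X] [Fintype ι]
    [DecidableEq ι] {p₀ : X} {W : ι → X → F} (hW : ∀ k, ContinuousAt (W k) p₀)
    (hli : ∀ᶠ p in 𝓝 p₀, LinearIndependent ℝ fun k => W k p) :
    ∃ ψ : ι → X → F →L[ℝ] ℝ, (∀ k, ContinuousAt (ψ k) p₀) ∧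
      ∀ᶠ p in 𝓝 p₀, (∀ k l, ψ k p (W l p) = if k = l then 1 else 0) ∧
        ∀ v, (∀ l, inner ℝ (W l p) v = 0) → ∀ k, ψ k p v = 0 := by
  set G : X → Matrix ι ι ℝ := fun p => Matrix.gram ℝ fun k => W k p with hG
  have hGc : ContinuousAt G p₀ := by
    refine continuousAt_pi.2 fun i => continuousAt_pi.2 fun j => ?_
    exact (hW i).inner (hW j)
  have hdet : ∀ᶠ p in 𝓝 p₀, (G p).det ≠ 0 :=
    hli.mono fun p hp => Matrix.det_gram_ne_zero_iff_linearIndependent.2 hp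
  have hGi : ContinuousAt (fun p => (G p)⁻¹) p₀ := by
    have h1 : ContinuousAt (fun p => (G p).det) p₀ :=
      (Continuous.matrix_det continuous_id).continuousAt.comp hGc
    have h2 : ContinuousAt (fun p => (G p).adjugate) p₀ :=
      (Continuous.matrix_adjugate continuous_id).continuousAt.comp hGc
    simp only [Matrix.inv_def, Ring.inverse_eq_inv']
    exact (h1.inv₀ hdet.self_of_nhds).smul h2
  refine ⟨fun k p => ∑ l, (G p)⁻¹ k l • innerSL ℝ (W l p), fun k => ?_, ?_⟩
  · refine tendsto_finsetSum _ fun l _ => ?_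
    have h1 : ContinuousAt (fun p => (G p)⁻¹ k l) p₀ :=
      continuousAt_pi.1 (continuousAt_pi.1 hGi k) l
    exact h1.smul ((innerSL ℝ).continuous.continuousAt.comp (hW l))
  · filter_upwards [hdet] with p hp
    refine ⟨fun k m => ?_, fun v hv k => ?_⟩
    · have h1 := congrFun (congrFun (Matrix.nonsing_inv_mul (G p) (isUnit_iff_ne_zero.2 hp)) k) m
      rw [Matrix.mul_apply, Matrix.one_apply] at h1
      rw [← h1]
      simp [hG, Matrix.gram_apply]
    · simp [hv]

/-- The left inverse of an injective linear map into a Euclidean space which vanishes on the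
orthogonal complement of its range. -/
theorem exists_orthogonal_left_inverse [FiniteDimensional ℝ F] {V : Type*} [AddCommGroup V]
    [Module ℝ V] {D : V →ₗ[ℝ] F} (hD : Function.Injective D) :
    ∃ B : F →ₗ[ℝ] V, (∀ ξ, B (D ξ) = ξ) ∧ ∀ ξ v, inner ℝ (D ξ) (v - D (B v)) = 0 := by
  set E := LinearEquiv.ofInjective D hD with hE
  set P := (LinearMap.range D).orthogonalProjectionOnto with hP
  have hDE : ∀ y, D (E.symm y) = y := fun y => by
    have := congrArg Subtype.val (E.apply_symm_apply y)
    exact this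
  refine ⟨E.symm.toLinearMap ∘ₗ P.toLinearMap, fun ξ => ?_, fun ξ v => ?_⟩
  · apply hD
    simp only [LinearMap.comp_apply, LinearEquiv.coe_coe, hDE, ContinuousLinearMap.coe_coe]
    have : D ξ ∈ LinearMap.range D := LinearMap.mem_range_self D ξ
    exact Submodule.starProjection_eq_self_iff.2 this
  · simp only [LinearMap.comp_apply, LinearEquiv.coe_coe, hDE, ContinuousLinearMap.coe_coe]
    exact Submodule.sub_starProjection_mem_orthogonal (K := LinearMap.range D) v _
      (LinearMap.mem_range_self D ξ)

end LinearAlgebra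

/-! ### The hyperbolic splitting in ambient coordinates -/

section Ambient

variable {d : ℕ} {M : Type*} [TopologicalSpace M] [ChartedSpace (EuclideanSpace ℝ (Fin d)) M]
  {Ω : Type*} [TopologicalSpace Ω]
  {F : Type*} [NormedAddCommGroup F] [InnerProductSpace ℝ F]

/-- The derivative at `x` of a map to a vector space, as a linear map on the tangent space. -/
def embeddingDeriv (e : M → F) (x : M) : TangentSpace (𝓡 d) x →ₗ[ℝ] F :=
  (mfderiv (𝓡 d) 𝓘(ℝ, F) e x).toLinearMap

/-- The derivative of a diffeomorphism as a linear map between tangent spaces. -/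
def fiberDeriv (h : DiffTwo d M) (x : M) :
    TangentSpace (𝓡 d) x →ₗ[ℝ] TangentSpace (𝓡 d) (h x) :=
  (mfderiv (𝓡 d) (𝓡 d) h x).toLinearMap

theorem fiberDeriv_refl (x : M) (ξ : TangentSpace (𝓡 d) x) :
    fiberDeriv (Diffeomorph.refl (𝓡 d) M 2) x ξ = ξ :=
  DFunLike.congr_fun (mfderiv_id (I := 𝓡 d) (x := x)) ξ

/-- A family of linear maps on the tangent spaces, composed with the left inverse `B`, is continuous
if it maps an adapted frame to continuous families of vectors. -/
theorem continuousAt_comp_coordinates [FiniteDimensional ℝ F]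
    {B : ∀ x : M, F →ₗ[ℝ] TangentSpace (𝓡 d) x}
    {ι : Type*} [Fintype ι] {Z : ι → ∀ p : M × Ω, TangentSpace (𝓡 d) p.1}
    {p₀ : M × Ω} {ψ : ι → M × Ω → F →L[ℝ] ℝ} (hψ : ∀ k, ContinuousAt (ψ k) p₀)
    (hBψ : ∀ᶠ p in 𝓝 p₀, ∀ v, B p.1 v = ∑ k, ψ k p v • Z k p)
    {S : ∀ p : M × Ω, TangentSpace (𝓡 d) p.1 →ₗ[ℝ] F}
    (hS : ∀ k, ContinuousAt (fun p => S p (Z k p)) p₀) :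
    ContinuousAt (fun p => LinearMap.toContinuousLinearMap (S p ∘ₗ B p.1)) p₀ := by
  have h1 : ContinuousAt (fun p => ∑ k, (ψ k p).smulRight (S p (Z k p))) p₀ := by
    refine tendsto_finsetSum _ fun k _ => ?_
    exact ((ContinuousLinearMap.smulRightL ℝ F F).continuous₂.continuousAt
      (x := (ψ k p₀, S p₀ (Z k p₀)))).comp₂ (hψ k) (hS k)
  refine h1.congr ?_
  filter_upwards [hBψ] with p hp
  ext1 v
  simp [hp]

variable [IsManifold (𝓡 d) ∞ M]

/-- Near every point there is a continuous frame of the tangent spaces which consists of frames of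
the two summands of the splitting. -/
theorem exists_adapted_frame {Eu Es : ∀ p : M × Ω, Submodule ℝ (TangentSpace (𝓡 d) p.1)}
    (hEu : DependsContinuously Eu) (hEs : DependsContinuously Es)
    (hc : ∀ p, IsCompl (Eu p) (Es p)) (p₀ : M × Ω) :
    ∃ (m n : ℕ) (Z : Fin m ⊕ Fin n → ∀ p : M × Ω, TangentSpace (𝓡 d) p.1),
      (∀ k, ContinuousAt (fun p => (⟨p.1, Z k p⟩ : TangentBundle (𝓡 d) M)) p₀) ∧
      ∀ᶠ p in 𝓝 p₀, LinearIndependent ℝ (fun k => Z k p) ∧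
        Submodule.span ℝ (range fun k => Z k p) = ⊤ ∧
        (∀ k, Z (Sum.inl k) p ∈ Eu p) ∧ ∀ k, Z (Sum.inr k) p ∈ Es p := by
  obtain ⟨U, hU, m, X, hX, hX'⟩ := hEu p₀
  obtain ⟨V, hV, n, Y, hY, hY'⟩ := hEs p₀
  refine ⟨m, n, fun k p => Sum.elim (fun i => X i p) (fun i => Y i p) k, ?_, ?_⟩
  · rintro (k | k)
    · exact (hX k).continuousAt hU
    · exact (hY k).continuousAt hV
  · filter_upwards [hU, hV] with p hpU hpV
    obtain ⟨h1, h2⟩ := hX' p hpU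
    obtain ⟨h3, h4⟩ := hY' p hpV
    refine ⟨?_, ?_, fun k => ?_, fun k => ?_⟩
    · refine (LinearIndependent.sum_type h1 h3 ?_)
      rw [h2, h4]
      exact (hc p).disjoint
    · have : (range fun k => Sum.elim (fun i => X i p) (fun i => Y i p) k) =
          (range fun i => X i p) ∪ range fun i => Y i p := Set.Sum.elim_range _ _
      rw [this, Submodule.span_union, h2, h4]
      exact (hc p).sup_eq_top
    · rw [← h2]; exact Submodule.subset_span ⟨k, rfl⟩
    · rw [← h4]; exact Submodule.subset_span ⟨k, rfl⟩

/-- In an adapted frame, the orthogonal left inverse of the derivative of an immersion has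
continuous coordinates. -/
theorem exists_continuousAt_coordinates {e : M → F} (he : ContMDiff (𝓡 d) 𝓘(ℝ, F) ∞ e)
    {B : ∀ x : M, F →ₗ[ℝ] TangentSpace (𝓡 d) x}
    (hB : ∀ x ξ, B x (embeddingDeriv (d := d) e x ξ) = ξ)
    (hB' : ∀ x ξ v, inner ℝ (embeddingDeriv (d := d) e x ξ) (v - embeddingDeriv e x (B x v)) = 0)
    {ι : Type*} [Fintype ι] [DecidableEq ι] {Z : ι → ∀ p : M × Ω, TangentSpace (𝓡 d) p.1}
    {p₀ : M × Ω}
    (hZ : ∀ k, ContinuousAt (fun p => (⟨p.1, Z k p⟩ : TangentBundle (𝓡 d) M)) p₀)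
    (hZ' : ∀ᶠ p in 𝓝 p₀, LinearIndependent ℝ (fun k => Z k p) ∧
        Submodule.span ℝ (range fun k => Z k p) = ⊤) :
    ∃ ψ : ι → M × Ω → F →L[ℝ] ℝ, (∀ k, ContinuousAt (ψ k) p₀) ∧
      ∀ᶠ p in 𝓝 p₀, ∀ v, B p.1 v = ∑ k, ψ k p v • Z k p := by
  have hinj : ∀ x, Function.Injective (embeddingDeriv (d := d) e x) :=
    fun x => Function.LeftInverse.injective (hB x)
  obtain ⟨ψ, hψ, hψ'⟩ := exists_continuousAt_dual_frame (p₀ := p₀)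
    (W := fun k p => embeddingDeriv e p.1 (Z k p)) (fun k => by
      have := continuousAt_mfderiv_apply (f := fun _ : Ω => Diffeomorph.refl (𝓡 d) M 2)
        continuous_const he (hZ k)
      refine this.congr (Eventually.of_forall fun p => ?_)
      exact congrArg (embeddingDeriv e p.1) (fiberDeriv_refl p.1 (Z k p)))
      (hZ'.mono fun p hp => hp.1.map' _ (LinearMap.ker_eq_bot.2 (hinj _)))
  refine ⟨ψ, hψ, ?_⟩
  filter_upwards [hψ', hZ'] with p hp hp' v
  obtain ⟨c, hc⟩ := (Submodule.mem_span_range_iff_exists_fun ℝ).1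
    (show B p.1 v ∈ Submodule.span ℝ (range fun k => Z k p) by rw [hp'.2]; trivial)
  rw [← hc]
  refine Finset.sum_congr rfl fun k _ => ?_
  congr 1
  have h1 : ψ k p (v - embeddingDeriv e p.1 (B p.1 v)) = 0 :=
    hp.2 _ (fun l => hB' _ _ _) k
  rw [map_sub, sub_eq_zero, ← hc] at h1
  rw [h1, map_sum, map_sum]
  simp [hp.1]

end Ambient

/-! ### Tangent vectors and chords -/

section Chords

variable {d : ℕ} {M : Type*} [TopologicalSpace M] [ChartedSpace (EuclideanSpace ℝ (Fin d)) M]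
  [IsManifold (𝓡 d) ∞ M] {Ω : Type*} [TopologicalSpace Ω]
  {F : Type*} [NormedAddCommGroup F] [InnerProductSpace ℝ F]

/-- The Riemannian norm of a component of a tangent vector, in ambient coordinates, is
continuous. -/
theorem continuousAt_riemannianNorm [RiemannianBundle (fun x : M => TangentSpace (𝓡 d) x)]
    [IsContMDiffRiemannianBundle (𝓡 d) ∞ (EuclideanSpace ℝ (Fin d))
      (fun x : M => TangentSpace (𝓡 d) x)]
    {ι : Type*} [Fintype ι] {Z : ι → ∀ p : M × Ω, TangentSpace (𝓡 d) p.1}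
    {p₀ : M × Ω} {ψ : ι → M × Ω → F →L[ℝ] ℝ} (hψ : ∀ k, ContinuousAt (ψ k) p₀)
    (hZ : ∀ k, ContinuousAt (fun p => (⟨p.1, Z k p⟩ : TangentBundle (𝓡 d) M)) p₀)
    {S : ∀ p : M × Ω, F →ₗ[ℝ] TangentSpace (𝓡 d) p.1} {ε : ι → ℝ}
    (hS : ∀ᶠ p in 𝓝 p₀, ∀ v, S p v = ∑ k, (ε k * ψ k p v) • Z k p) (v₀ : F) :
    ContinuousAt (fun q : (M × Ω) × F => ‖S q.1 q.2‖) (p₀, v₀) := by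
  obtain ⟨g, hg, hg'⟩ := IsContMDiffRiemannianBundle.exists_contMDiff (IB := 𝓡 d) (n := ∞)
    (F := EuclideanSpace ℝ (Fin d)) (E := fun x : M => TangentSpace (𝓡 d) x)
  have : IsContinuousRiemannianBundle (EuclideanSpace ℝ (Fin d))
    (fun x : M => TangentSpace (𝓡 d) x) := ⟨g, hg.continuous, hg'⟩
  have h1 : ContinuousAt (fun q : (M × Ω) × F => Real.sqrt (∑ k, ∑ l,
      (ε k * ψ k q.1 q.2) * ((ε l * ψ l q.1 q.2) * inner ℝ (Z k q.1) (Z l q.1)))) (p₀, v₀) := by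
    refine Real.continuous_sqrt.continuousAt.comp ?_
    have hfst : ContinuousAt (fun q : (M × Ω) × F => q.1) (p₀, v₀) := continuousAt_fst
    have hcoef : ∀ k, ContinuousAt (fun q : (M × Ω) × F => ε k * ψ k q.1 q.2) (p₀, v₀) :=
      fun k => continuousAt_const.mul ((ContinuousAt.comp (f := Prod.fst) (x := (p₀, v₀))
        (hψ k) hfst).clm_apply continuousAt_snd)
    have hinner : ∀ k l, ContinuousAt (fun q : (M × Ω) × F => inner ℝ (Z k q.1) (Z l q.1))
        (p₀, v₀) := fun k l => by
      have := ContinuousAt.inner_bundle (F := EuclideanSpace ℝ (Fin d))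
        (E := fun x : M => TangentSpace (𝓡 d) x) (hZ k) (hZ l)
      exact ContinuousAt.comp (f := Prod.fst) (x := (p₀, v₀)) this hfst
    exact tendsto_finsetSum _ fun k _ => tendsto_finsetSum _ fun l _ =>
      (hcoef k).mul ((hcoef l).mul (hinner k l))
  refine h1.congr ?_
  have h2 : ∀ᶠ q : (M × Ω) × F in 𝓝 (p₀, v₀), ∀ v, S q.1 v = ∑ k, (ε k * ψ k q.1 v) • Z k q.1 :=
    (continuous_fst.tendsto' (p₀, v₀) p₀ rfl).eventually hS
  filter_upwards [h2] with q hq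
  rw [hq, @norm_eq_sqrt_real_inner, sum_inner]
  congr 1
  refine Finset.sum_congr rfl fun k _ => ?_
  rw [inner_sum]
  refine Finset.sum_congr rfl fun l _ => ?_
  rw [real_inner_smul_left, real_inner_smul_right]

/-- The first order expansion along the fibres in ambient coordinates: if `A p₀` is the
derivative of `x ↦ e (f_ω x)` at `p₀` and `A` is continuous there, then `A p` maps small chords of
`e` to the corresponding chords, up to higher order. -/
theorem eventually_chord_map [FiniteDimensional ℝ F] {f : Ω → DiffTwo d M} (hf : Continuous f)
    {e : M → F} (he : ContMDiff (𝓡 d) 𝓘(ℝ, F) ∞ e)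
    (himm : ∀ x, Function.Injective (embeddingDeriv (d := d) e x)) {A : M × Ω → F →L[ℝ] F}
    {p₀ : M × Ω} (hA : ContinuousAt A p₀)
    (hA₀ : ∀ ξ, A p₀ (embeddingDeriv e p₀.1 ξ) =
      embeddingDeriv e (f p₀.2 p₀.1) (fiberDeriv (f p₀.2) p₀.1 ξ)) {η : ℝ} (hη : 0 < η) :
    ∀ᶠ q : (M × Ω) × M in 𝓝 (p₀, p₀.1),
      ‖e (f q.1.2 q.2) - e (f q.1.2 q.1.1) - A q.1 (e q.2 - e q.1.1)‖ ≤
        η * ‖e q.2 - e q.1.1‖ := by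
  set c := chartAt (EuclideanSpace ℝ (Fin d)) p₀.1 with hc
  have hx : p₀.1 ∈ c.source := mem_chart_source _ _
  set t := (trivializationAt (EuclideanSpace ℝ (Fin d)) (TangentSpace (𝓡 d)) p₀.1) with ht
  set J := fderiv ℝ (fun v => e (c.symm v)) (c p₀.1) with hJ
  set G := fderiv ℝ (fun v => e (f p₀.2 (c.symm v))) (c p₀.1) with hG
  have hsurj : Function.Surjective (t.continuousLinearMapAt ℝ p₀.1) := fun v =>
    ⟨t.symmL ℝ p₀.1 v, t.continuousLinearMapAt_symmL (by simp [ht]) v⟩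
  have hJt : ∀ ξ, embeddingDeriv e p₀.1 ξ = J (t.continuousLinearMapAt ℝ p₀.1 ξ) := fun ξ =>
    (congrArg (embeddingDeriv e p₀.1) (fiberDeriv_refl p₀.1 ξ)).symm.trans
      (mfderiv_embedding_diffeo (Diffeomorph.refl (𝓡 d) M 2) he p₀.1 hx ξ)
  have hGt : ∀ ξ, embeddingDeriv e (f p₀.2 p₀.1) (fiberDeriv (f p₀.2) p₀.1 ξ) =
      G (t.continuousLinearMapAt ℝ p₀.1 ξ) := fun ξ =>
    mfderiv_embedding_diffeo (f p₀.2) he p₀.1 hx ξ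
  have hAJ : ∀ u, A p₀ (J u) = G u := fun u => by
    obtain ⟨ξ, rfl⟩ := hsurj u
    rw [← hJt, ← hGt, hA₀]
  have hJinj : Function.Injective J := by
    refine (injective_iff_map_eq_zero J).2 fun u hu => ?_
    obtain ⟨ξ, rfl⟩ := hsurj u
    rw [← hJt] at hu
    rw [(injective_iff_map_eq_zero _).1 (himm p₀.1) ξ hu, map_zero]
  obtain ⟨K, hK, hKJ⟩ := J.toLinearMap.exists_antilipschitzWith (LinearMap.ker_eq_bot.2 hJinj)
  have hKJ' : ∀ u, ‖u‖ ≤ K * ‖J u‖ := fun u => by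
    have := hKJ.le_mul_dist u 0
    simpa using this
  have hK0 : (0 : ℝ) < K := by exact_mod_cast hK
  set a : ℝ := ‖A p₀‖ with ha
  have ha0 : 0 ≤ a := norm_nonneg _
  set η' : ℝ := min (1 / (2 * K)) (η / (4 * K * (1 + a))) with hη'
  have hη'0 : 0 < η' := by positivity
  have hη'1 : K * η' ≤ 1 / 2 := by
    calc K * η' ≤ K * (1 / (2 * K)) := by gcongr; exact min_le_left _ _
      _ = 1 / 2 := by field_simp
  have hη'2 : η' * (1 + a) * (2 * K) ≤ η / 2 := by
    calc η' * (1 + a) * (2 * K) ≤ η / (4 * K * (1 + a)) * (1 + a) * (2 * K) := by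
          gcongr; exact min_le_right _ _
      _ = η / 2 := by field_simp; ring
  have hcq : ContinuousAt (fun q : (M × Ω) × M => ((c q.1.1, c q.2), q.1.2)) (p₀, p₀.1) := by
    have h1 : ContinuousAt c p₀.1 := c.continuousAt hx
    have h2 : ContinuousAt (fun q : (M × Ω) × M => c q.1.1) (p₀, p₀.1) :=
      ContinuousAt.comp (g := c) (f := fun q : (M × Ω) × M => q.1.1) (x := (p₀, p₀.1)) h1
        (by fun_prop)
    have h3 : ContinuousAt (fun q : (M × Ω) × M => c q.2) (p₀, p₀.1) :=
      ContinuousAt.comp (g := c) (f := fun q : (M × Ω) × M => q.2) (x := (p₀, p₀.1)) h1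
        (by fun_prop)
    exact (h2.prodMk h3).prodMk (by fun_prop)
  have e1 := hcq.eventually (eventually_chart_expansion (f := fun _ : Ω =>
    Diffeomorph.refl (𝓡 d) M 2) continuous_const he p₀.1 p₀.2
    (IsManifold.chart_mem_maximalAtlas _) hx hη'0)
  have e2 := hcq.eventually (eventually_chart_expansion hf he p₀.1 p₀.2
    (IsManifold.chart_mem_maximalAtlas _) hx hη'0)
  have e3 : ∀ᶠ q : (M × Ω) × M in 𝓝 (p₀, p₀.1), q.1.1 ∈ c.source ∧ q.2 ∈ c.source := by
    refine ContinuousAt.eventually_mem (f := fun q : (M × Ω) × M => q.1.1) (by fun_prop)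
      (c.open_source.mem_nhds hx) |>.and ?_
    exact ContinuousAt.eventually_mem (f := fun q : (M × Ω) × M => q.2) (by fun_prop)
      (c.open_source.mem_nhds hx)
  have e4 : ∀ᶠ q : (M × Ω) × M in 𝓝 (p₀, p₀.1), dist (A q.1) (A p₀) < η / 2 :=
    (continuous_fst.tendsto' (p₀, p₀.1) p₀ rfl).eventually
        (Metric.tendsto_nhds.1 hA _ (half_pos hη))
  filter_upwards [e1, e2, e3, e4] with q h1 h2 h3 h4
  simp only [Diffeomorph.coe_refl, id, ← hc, c.left_inv h3.1, c.left_inv h3.2] at h1 h2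
  set u := c q.2 - c q.1.1 with hu
  set Δ := e q.2 - e q.1.1 with hΔ
  have h5 : ‖u‖ ≤ 2 * K * ‖Δ‖ := by
    have h6 := norm_le_norm_add_norm_sub Δ (J u)
    have h7 := hKJ' u
    have h8 : ‖u‖ ≤ K * ‖Δ‖ + (K * η') * ‖u‖ := by
      calc ‖u‖ ≤ K * ‖J u‖ := h7
        _ ≤ K * (‖Δ‖ + η' * ‖u‖) := by gcongr; exact h6.trans (by gcongr)
        _ = _ := by ring
    have h9 : (K * η') * ‖u‖ ≤ 1 / 2 * ‖u‖ := by gcongr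
    linarith
  have h6 : e (f q.1.2 q.2) - e (f q.1.2 q.1.1) - A q.1 Δ =
      (e (f q.1.2 q.2) - e (f q.1.2 q.1.1) - G u) - A p₀ (Δ - J u) - (A q.1 - A p₀) Δ := by
    rw [map_sub (A p₀) Δ (J u), hAJ, sub_apply]; abel
  rw [h6]
  have h7 : ‖A p₀ (Δ - J u)‖ ≤ a * (η' * ‖u‖) := (A p₀).le_opNorm_of_le h1
  have h8 : ‖(A q.1 - A p₀) Δ‖ ≤ η / 2 * ‖Δ‖ := by
    rw [dist_eq_norm] at h4
    exact (A q.1 - A p₀).le_of_opNorm_le h4.le Δ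
  have h9 := norm_sub_le ((e (f q.1.2 q.2) - e (f q.1.2 q.1.1) - G u) - A p₀ (Δ - J u))
    ((A q.1 - A p₀) Δ)
  have h10 := norm_sub_le (e (f q.1.2 q.2) - e (f q.1.2 q.1.1) - G u) (A p₀ (Δ - J u))
  have h11 : η' * (1 + a) * ‖u‖ ≤ η / 2 * ‖Δ‖ := by
    calc η' * (1 + a) * ‖u‖ ≤ η' * (1 + a) * (2 * K * ‖Δ‖) := by gcongr
      _ = (η' * (1 + a) * (2 * K)) * ‖Δ‖ := by ring
      _ ≤ _ := by gcongr
  have h12 : η' * (1 + a) * ‖u‖ = η' * ‖u‖ + a * (η' * ‖u‖) := by ring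
  linarith

/-- Small vectors in the range of a continuous family of projections onto the tangent spaces are
chords of `e`, up to higher order. -/
theorem eventually_tangent_chord [FiniteDimensional ℝ F] {e : M → F}
    (he : ContMDiff (𝓡 d) 𝓘(ℝ, F) ∞ e) {B : ∀ x : M, F →ₗ[ℝ] TangentSpace (𝓡 d) x}
    {P : M × Ω → F →L[ℝ] F} {p₀ : M × Ω} (hP : ContinuousAt P p₀)
    (hP₀ : ∀ v, P p₀ v = embeddingDeriv e p₀.1 (B p₀.1 v)) {η : ℝ} (hη : 0 < η) :
    ∀ᶠ q : (M × Ω) × F in 𝓝 (p₀, 0), P q.1 q.2 = q.2 →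
      ∃ y, ‖e y - e q.1.1 - q.2‖ ≤ η * ‖q.2‖ := by
  set c := chartAt (EuclideanSpace ℝ (Fin d)) p₀.1 with hc
  have hx : p₀.1 ∈ c.source := mem_chart_source _ _
  set t := (trivializationAt (EuclideanSpace ℝ (Fin d)) (TangentSpace (𝓡 d)) p₀.1) with ht
  set J := fderiv ℝ (fun v => e (c.symm v)) (c p₀.1) with hJ
  have hJt : ∀ ξ, embeddingDeriv e p₀.1 ξ = J (t.continuousLinearMapAt ℝ p₀.1 ξ) := fun ξ =>
    (congrArg (embeddingDeriv e p₀.1) (fiberDeriv_refl p₀.1 ξ)).symm.trans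
      (mfderiv_embedding_diffeo (Diffeomorph.refl (𝓡 d) M 2) he p₀.1 hx ξ)
  -- The coordinates in the chart of the tangent vector which is represented by `v`.
  set R : F →L[ℝ] EuclideanSpace ℝ (Fin d) := LinearMap.toContinuousLinearMap
    ((t.continuousLinearMapAt ℝ p₀.1).toLinearMap ∘ₗ B p₀.1) with hR
  have hJR : ∀ v, J (R v) = P p₀ v := fun v => by rw [hP₀, hJt]; rfl
  set r : ℝ := ‖R‖ with hr
  have hr0 : 0 ≤ r := norm_nonneg _
  set η' : ℝ := η / (2 * (1 + r)) with hη'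
  have hη'0 : 0 < η' := by positivity
  have hη'r : η' * r ≤ η / 2 := by
    rw [hη', div_mul_eq_mul_div, div_le_div_iff₀ (by positivity) two_pos]
    nlinarith
  have hcu : ContinuousAt (fun q : (M × Ω) × F => c q.1.1) (p₀, 0) :=
    ContinuousAt.comp (g := c) (f := fun q : (M × Ω) × F => q.1.1) (x := (p₀, (0 : F)))
      (c.continuousAt hx) (by fun_prop)
  have hcu' : ContinuousAt (fun q : (M × Ω) × F => c q.1.1 + R q.2) (p₀, 0) :=
    hcu.add (by fun_prop)
  have hcq : Tendsto (fun q : (M × Ω) × F => ((c q.1.1, c q.1.1 + R q.2), q.1.2)) (𝓝 (p₀, 0))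
      (𝓝 ((c p₀.1, c p₀.1), p₀.2)) := by
    have : ContinuousAt (fun q : (M × Ω) × F => ((c q.1.1, c q.1.1 + R q.2), q.1.2)) (p₀, 0) :=
      (hcu.prodMk hcu').prodMk (by fun_prop)
    simpa [ContinuousAt] using this
  have e1 := hcq.eventually (eventually_chart_expansion (f := fun _ : Ω =>
    Diffeomorph.refl (𝓡 d) M 2) continuous_const he p₀.1 p₀.2
    (IsManifold.chart_mem_maximalAtlas _) hx hη'0)
  have e3 : ∀ᶠ q : (M × Ω) × F in 𝓝 (p₀, 0), q.1.1 ∈ c.source :=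
    ContinuousAt.eventually_mem (f := fun q : (M × Ω) × F => q.1.1) (by fun_prop)
      (c.open_source.mem_nhds hx)
  have e4 : ∀ᶠ q : (M × Ω) × F in 𝓝 (p₀, 0), dist (P q.1) (P p₀) < η / 2 :=
    (continuous_fst.tendsto' (p₀, (0 : F)) p₀ rfl).eventually
        (Metric.tendsto_nhds.1 hP _ (half_pos hη))
  filter_upwards [e1, e3, e4] with q h1 h3 h4 hq
  refine ⟨c.symm (c q.1.1 + R q.2), ?_⟩
  simp only [Diffeomorph.coe_refl, id, ← hc, c.left_inv h3, add_sub_cancel_left] at h1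
  rw [← hJ, hJR] at h1
  have h5 : e (c.symm (c q.1.1 + R q.2)) - e q.1.1 - q.2 =
      (e (c.symm (c q.1.1 + R q.2)) - e q.1.1 - P p₀ q.2) - (P q.1 - P p₀) q.2 := by
    rw [sub_apply, hq]; abel
  rw [h5]
  refine (norm_sub_le _ _).trans ?_
  have h6 : ‖(P q.1 - P p₀) q.2‖ ≤ η / 2 * ‖q.2‖ := by
    rw [dist_eq_norm] at h4
    exact (P q.1 - P p₀).le_of_opNorm_le h4.le q.2
  have h7 : η' * ‖R q.2‖ ≤ η / 2 * ‖q.2‖ := by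
    calc η' * ‖R q.2‖ ≤ η' * (r * ‖q.2‖) := by gcongr; exact R.le_opNorm _
      _ = (η' * r) * ‖q.2‖ := by ring
      _ ≤ _ := by gcongr
  linarith

end Chords

/-! ### Hyperbolicity in ambient coordinates -/

section AnosovToAmbient

variable {d : ℕ} {M : Type*} [TopologicalSpace M] [ChartedSpace (EuclideanSpace ℝ (Fin d)) M]
  [IsManifold (𝓡 d) ∞ M] {Ω : Type*} [TopologicalSpace Ω]
  {F : Type*} [NormedAddCommGroup F] [InnerProductSpace ℝ F]

/-- Two continuous families of seminorms dominate the norm on the range of a continuous family of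
operators, if they have no common zero there. -/
theorem exists_norm_le_seminorm_add [FiniteDimensional ℝ F] {X : Type*} [TopologicalSpace X]
    [CompactSpace X] {N N' : X → Seminorm ℝ F} {P : X → F →L[ℝ] F}
    (hN : Continuous fun q : X × F => N q.1 q.2) (hN' : Continuous fun q : X × F => N' q.1 q.2)
    (hP : Continuous P) (h : ∀ p v, P p v = v → N p v = 0 → N' p v = 0 → v = 0) :
    ∃ C, ∀ p v, P p v = v → ‖v‖ ≤ C * (N p v + N' p v) := by
  have : ProperSpace F := FiniteDimensional.proper ℝ F
  set S : Set (X × F) := univ ×ˢ Metric.sphere (0 : F) 1 with hS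
  have hSc : IsCompact S := isCompact_univ.prod (isCompact_sphere _ _)
  set g : X × F → ℝ := fun q => N q.1 q.2 + N' q.1 q.2 + ‖P q.1 q.2 - q.2‖ with hg
  have hgc : Continuous g := by fun_prop
  rcases S.eq_empty_or_nonempty with hE | hne
  · refine ⟨0, fun p v _ => ?_⟩
    have hv : v = 0 := by
      by_contra hv
      have : (p, (‖v‖⁻¹ : ℝ) • v) ∈ S := by simp [hS, norm_smul, hv]
      rw [hE] at this
      exact this
    simp [hv]
  · obtain ⟨q, hqS, hq⟩ := hSc.exists_isMinOn hne hgc.continuousOn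
    have hpos : 0 < g q := by
      have h0 : 0 ≤ g q := by simp only [hg]; positivity
      refine lt_of_le_of_ne h0 fun h1 => ?_
      have a1 : 0 ≤ N q.1 q.2 := apply_nonneg _ _
      have a2 : 0 ≤ N' q.1 q.2 := apply_nonneg _ _
      have a3 : 0 ≤ ‖P q.1 q.2 - q.2‖ := norm_nonneg _
      have h2 : N q.1 q.2 + N' q.1 q.2 + ‖P q.1 q.2 - q.2‖ = 0 := h1.symm
      have h3 := h q.1 q.2 (sub_eq_zero.1 (norm_le_zero_iff.1 (by linarith))) (by linarith)
        (by linarith)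
      have h4 : ‖q.2‖ = 1 := by simpa using hqS.2
      rw [h3, norm_zero] at h4
      exact zero_ne_one h4
    refine ⟨(g q)⁻¹, fun p v hv => ?_⟩
    rcases eq_or_ne v 0 with rfl | hv0
    · simp
    have hv' : 0 < ‖v‖ := norm_pos_iff.2 hv0
    have h1 : g q ≤ g (p, (‖v‖⁻¹ : ℝ) • v) := hq (by simp [hS, norm_smul, hv0])
    have h2 : g (p, (‖v‖⁻¹ : ℝ) • v) = ‖v‖⁻¹ * (N p v + N' p v) := by
      simp only [hg, map_smul_eq_mul, norm_inv, norm_norm, map_smul, hv, sub_self, norm_zero]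
      ring
    rw [h2] at h1
    rw [inv_mul_eq_div, le_div_iff₀ hpos]
    calc ‖v‖ * g q ≤ ‖v‖ * (‖v‖⁻¹ * (N p v + N' p v)) := by gcongr
      _ = _ := by field_simp

/-- A skew product which is Anosov on fibers is hyperbolic in the coordinates of every embedding of
the fibre into a Euclidean space. -/
theorem exists_hyperbolicData [FiniteDimensional ℝ F] [T2Space M] [CompactSpace M]
    [CompactSpace Ω] [T2Space Ω]
    [RiemannianBundle (fun x : M => TangentSpace (𝓡 d) x)]
    [IsContMDiffRiemannianBundle (𝓡 d) ∞ (EuclideanSpace ℝ (Fin d))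
      (fun x : M => TangentSpace (𝓡 d) x)]
    {e : M → F} (he : ContMDiff (𝓡 d) 𝓘(ℝ, F) ∞ e) (hinj : Function.Injective e)
    (himm : ∀ x, Function.Injective (embeddingDeriv (d := d) e x))
    (f : C(Ω, DiffTwo d M)) (θ : Ω ≃ₜ Ω) (hA : IsAnosovOnFibers f θ) :
    Nonempty (HyperbolicData (skewProduct f θ) e) := by
  obtain ⟨Eu, Es, lam, hlam, hEu, hEs, hyp⟩ := hA
  set T := skewProduct f θ with hT
  have hcompl : ∀ p : M × Ω, IsCompl (Eu p) (Es p) := fun p => (hyp p.1 p.2).1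
  have hmapu : ∀ p : M × Ω, (Eu p).map (fiberDeriv (f p.2) p.1) = Eu (T p) :=
    fun p => (hyp p.1 p.2).2.2.1
  have hmaps : ∀ p : M × Ω, (Es p).map (fiberDeriv (f p.2) p.1) = Es (T p) :=
    fun p => (hyp p.1 p.2).2.2.2.1
  have hexpu : ∀ (p : M × Ω), ∀ ξ ∈ Eu p, Real.exp lam * ‖ξ‖ ≤ ‖fiberDeriv (f p.2) p.1 ξ‖ :=
    fun p => (hyp p.1 p.2).2.2.2.2.1
  have hexps : ∀ (p : M × Ω), ∀ ξ ∈ Es p, ‖fiberDeriv (f p.2) p.1 ξ‖ ≤ Real.exp (-lam) * ‖ξ‖ :=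
    fun p => (hyp p.1 p.2).2.2.2.2.2
  -- The linear structure is transported to the ambient space by the derivative `D` of the embedding
  -- and its left inverse `B`, which vanishes on the normal space.
  choose B hB hB' using fun x => exists_orthogonal_left_inverse (himm x)
  let D : ∀ x : M, TangentSpace (𝓡 d) x →ₗ[ℝ] F := fun x => embeddingDeriv e x
  let Df : ∀ p : M × Ω, TangentSpace (𝓡 d) p.1 →ₗ[ℝ] TangentSpace (𝓡 d) (T p).1 :=
    fun p => fiberDeriv (f p.2) p.1
  let pu : ∀ p : M × Ω, TangentSpace (𝓡 d) p.1 →ₗ[ℝ] TangentSpace (𝓡 d) p.1 :=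
    fun p => (Eu p).projection (Es p) (hcompl p)
  let ps : ∀ p : M × Ω, TangentSpace (𝓡 d) p.1 →ₗ[ℝ] TangentSpace (𝓡 d) p.1 :=
    fun p => (Es p).projection (Eu p) (hcompl p).symm
  let Pu : M × Ω → F →L[ℝ] F := fun p => LinearMap.toContinuousLinearMap ((D p.1 ∘ₗ pu p) ∘ₗ B p.1)
  let Ps : M × Ω → F →L[ℝ] F := fun p => LinearMap.toContinuousLinearMap ((D p.1 ∘ₗ ps p) ∘ₗ B p.1)
  let A : M × Ω → F →L[ℝ] F :=
    fun p => LinearMap.toContinuousLinearMap ((D (T p).1 ∘ₗ Df p) ∘ₗ B p.1)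
  let Nu : M × Ω → Seminorm ℝ F := fun p =>
    (normSeminorm ℝ (TangentSpace (𝓡 d) p.1)).comp (pu p ∘ₗ B p.1)
  let Ns : M × Ω → Seminorm ℝ F := fun p =>
    (normSeminorm ℝ (TangentSpace (𝓡 d) p.1)).comp (ps p ∘ₗ B p.1)
  have hpu_mem : ∀ p ξ, pu p ξ ∈ Eu p := fun p ξ => Submodule.projection_apply_mem (hcompl p) ξ
  have hps_mem : ∀ p ξ, ps p ξ ∈ Es p := fun p ξ =>
    Submodule.projection_apply_mem (hcompl p).symm ξ
  have hpu_u : ∀ p, ∀ ξ ∈ Eu p, pu p ξ = ξ := fun p ξ hξ =>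
    Submodule.projection_apply_of_mem_left (hcompl p) hξ
  have hps_s : ∀ p, ∀ ξ ∈ Es p, ps p ξ = ξ := fun p ξ hξ =>
    Submodule.projection_apply_of_mem_left (hcompl p).symm hξ
  have hpu_s : ∀ p, ∀ ξ ∈ Es p, pu p ξ = 0 := fun p ξ hξ =>
    (Submodule.projection_apply_eq_zero_iff (hcompl p)).2 hξ
  have hps_u : ∀ p, ∀ ξ ∈ Eu p, ps p ξ = 0 := fun p ξ hξ =>
    (Submodule.projection_apply_eq_zero_iff (hcompl p).symm).2 hξ
  have hsum : ∀ p ξ, pu p ξ + ps p ξ = ξ := fun p ξ =>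
    Submodule.projection_add_projection_eq_self (hcompl p) ξ
  have hDfu : ∀ p, ∀ ξ ∈ Eu p, Df p ξ ∈ Eu (T p) := fun p ξ hξ => by
    have h : fiberDeriv (f p.2) p.1 ξ ∈ (Eu p).map (fiberDeriv (f p.2) p.1) :=
      Submodule.mem_map_of_mem hξ
    rw [hmapu] at h
    exact h
  have hDfs : ∀ p, ∀ ξ ∈ Es p, Df p ξ ∈ Es (T p) := fun p ξ hξ => by
    have h : fiberDeriv (f p.2) p.1 ξ ∈ (Es p).map (fiberDeriv (f p.2) p.1) :=
      Submodule.mem_map_of_mem hξ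
    rw [hmaps] at h
    exact h
  have hcomm_u : ∀ p ξ, pu (T p) (Df p ξ) = Df p (pu p ξ) := fun p ξ => by
    conv_lhs => rw [← hsum p ξ]
    rw [map_add, map_add, hpu_u _ _ (hDfu p _ (hpu_mem p ξ)),
      hpu_s _ _ (hDfs p _ (hps_mem p ξ)), add_zero]
  have hcomm_s : ∀ p ξ, ps (T p) (Df p ξ) = Df p (ps p ξ) := fun p ξ => by
    conv_lhs => rw [← hsum p ξ]
    rw [map_add, map_add, hps_u _ _ (hDfu p _ (hpu_mem p ξ)),
      hps_s _ _ (hDfs p _ (hps_mem p ξ)), zero_add]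
  have hBD : ∀ x ξ, B x (D x ξ) = ξ := hB
  have hPu : ∀ p v, Pu p v = D p.1 (pu p (B p.1 v)) := fun p v => rfl
  have hPs : ∀ p v, Ps p v = D p.1 (ps p (B p.1 v)) := fun p v => rfl
  have hAv : ∀ p v, A p v = D (T p).1 (Df p (B p.1 v)) := fun p v => rfl
  have hNu : ∀ p v, Nu p v = ‖pu p (B p.1 v)‖ := fun p v => rfl
  have hNs : ∀ p v, Ns p v = ‖ps p (B p.1 v)‖ := fun p v => rfl
  have hP : ∀ p v, Pu p v + Ps p v = D p.1 (B p.1 v) := fun p v => by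
    rw [hPu, hPs, ← map_add, hsum]
  -- Continuity, in an adapted frame.
  have hcont : ∀ p₀, ContinuousAt Pu p₀ ∧ ContinuousAt Ps p₀ ∧ ContinuousAt A p₀ ∧
      (∀ v₀, ContinuousAt (fun q : (M × Ω) × F => Nu q.1 q.2) (p₀, v₀)) ∧
      ∀ v₀, ContinuousAt (fun q : (M × Ω) × F => Ns q.1 q.2) (p₀, v₀) := by
    intro p₀
    obtain ⟨m, n, Z, hZ, hZ'⟩ := exists_adapted_frame hEu hEs hcompl p₀
    obtain ⟨ψ, hψ, hψ'⟩ := exists_continuousAt_coordinates he hB hB' hZ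
      (hZ'.mono fun p hp => ⟨hp.1, hp.2.1⟩)
    have hDZ : ∀ k, ContinuousAt (fun p => D p.1 (Z k p)) p₀ := fun k => by
      have := continuousAt_mfderiv_apply (f := fun _ : Ω => Diffeomorph.refl (𝓡 d) M 2)
        continuous_const he (hZ k)
      refine this.congr (Eventually.of_forall fun p => ?_)
      exact congrArg (embeddingDeriv e p.1) (fiberDeriv_refl p.1 (Z k p))
    have hDfZ : ∀ k, ContinuousAt (fun p => D (T p).1 (Df p (Z k p))) p₀ := fun k =>
      continuousAt_mfderiv_apply f.continuous he (hZ k)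
    have hpuZ : ∀ᶠ p in 𝓝 p₀, ∀ k, pu p (Z k p) =
        (Sum.elim (fun _ => 1) (fun _ => 0) k : ℝ) • Z k p := by
      filter_upwards [hZ'] with p hp
      rintro (k | k)
      · simpa using hpu_u p _ (hp.2.2.1 k)
      · simpa using hpu_s p _ (hp.2.2.2 k)
    have hpsZ : ∀ᶠ p in 𝓝 p₀, ∀ k, ps p (Z k p) =
        (Sum.elim (fun _ => 0) (fun _ => 1) k : ℝ) • Z k p := by
      filter_upwards [hZ'] with p hp
      rintro (k | k)
      · simpa using hps_u p _ (hp.2.2.1 k)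
      · simpa using hps_s p _ (hp.2.2.2 k)
    refine ⟨continuousAt_comp_coordinates hψ hψ' fun k => ?_,
      continuousAt_comp_coordinates hψ hψ' fun k => ?_,
      continuousAt_comp_coordinates hψ hψ' hDfZ, fun v₀ => ?_, fun v₀ => ?_⟩
    · refine ((hDZ k).const_smul (Sum.elim (fun _ => 1) (fun _ => 0) k : ℝ)).congr ?_
      filter_upwards [hpuZ] with p hp
      rw [LinearMap.comp_apply, hp, map_smul]
      rfl
    · refine ((hDZ k).const_smul (Sum.elim (fun _ => 0) (fun _ => 1) k : ℝ)).congr ?_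
      filter_upwards [hpsZ] with p hp
      rw [LinearMap.comp_apply, hp, map_smul]
      rfl
    · refine continuousAt_riemannianNorm (S := fun p => pu p ∘ₗ B p.1)
        (ε := Sum.elim (fun _ => 1) (fun _ => 0)) hψ hZ ?_ v₀
      filter_upwards [hψ', hpuZ] with p hp hp' v
      rw [LinearMap.comp_apply, hp, map_sum]
      refine Finset.sum_congr rfl fun k _ => ?_
      rw [map_smul, hp', smul_smul, mul_comm]
    · refine continuousAt_riemannianNorm (S := fun p => ps p ∘ₗ B p.1)
        (ε := Sum.elim (fun _ => 0) (fun _ => 1)) hψ hZ ?_ v₀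
      filter_upwards [hψ', hpsZ] with p hp hp' v
      rw [LinearMap.comp_apply, hp, map_sum]
      refine Finset.sum_congr rfl fun k _ => ?_
      rw [map_smul, hp', smul_smul, mul_comm]
  have hcPu : Continuous Pu := continuous_iff_continuousAt.2 fun p => (hcont p).1
  have hcPs : Continuous Ps := continuous_iff_continuousAt.2 fun p => (hcont p).2.1
  have hcA : Continuous A := continuous_iff_continuousAt.2 fun p => (hcont p).2.2.1
  have hcNu : Continuous fun q : (M × Ω) × F => Nu q.1 q.2 :=
    continuous_iff_continuousAt.2 fun q => (hcont q.1).2.2.2.1 q.2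
  have hcNs : Continuous fun q : (M × Ω) × F => Ns q.1 q.2 :=
    continuous_iff_continuousAt.2 fun q => (hcont q.1).2.2.2.2 q.2
  obtain ⟨C, hC⟩ := exists_norm_le_seminorm_add hcNu hcNs (hcPu.add hcPs) (by
    intro p v hv h1 h2
    rw [hNu, norm_eq_zero] at h1
    rw [hNs, norm_eq_zero] at h2
    have h3 : Pu p v + Ps p v = v := hv
    rw [← h3, hPu, hPs, h1, h2, map_zero, add_zero])
  have hec : Continuous e := he.continuous
  refine ⟨{
    Pu := Pu
    Ps := Ps
    A := A
    Nu := Nu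
    Ns := Ns
    κ := Real.exp (-lam)
    C := C
    κ_nonneg := (Real.exp_pos _).le
    κ_lt := by rw [Real.exp_lt_one_iff]; linarith
    continuous_Pu := hcPu
    continuous_Ps := hcPs
    continuous_A := hcA
    continuous_Nu := hcNu
    continuous_Ns := hcNs
    Pu_Pu := fun p v => by rw [hPu, hPu, hBD, hpu_u _ _ (hpu_mem _ _)]
    Ps_Ps := fun p v => by rw [hPs, hPs, hBD, hps_s _ _ (hps_mem _ _)]
    Pu_Ps := fun p v => by rw [hPu, hPs, hBD, hpu_s _ _ (hps_mem _ _), map_zero]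
    Ps_Pu := fun p v => by rw [hPs, hPu, hBD, hps_u _ _ (hpu_mem _ _), map_zero]
    A_Ps := fun p v => by rw [hAv, hAv, hPs, hPs, hBD, hBD, hcomm_s]
    exists_unstable := fun p w => ?_
    Ns_A := fun p v => by
      rw [hNs, hNs, hAv, hBD, hcomm_s]; exact hexps p _ (hps_mem _ _)
    Nu_A := fun p v => by
      rw [hNu, hNu, hAv, hBD, hcomm_u]
      have h1 := hexpu p _ (hpu_mem p (B p.1 v))
      have h2 := mul_le_mul_of_nonneg_left h1 (Real.exp_pos (-lam)).le
      rwa [← mul_assoc, ← Real.exp_add, neg_add_cancel, Real.exp_zero, one_mul] at h2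
    Ns_Ps := fun p v => by rw [hNs, hNs, hPs, hBD, hps_s _ _ (hps_mem _ _)]
    Nu_Pu := fun p v => by rw [hNu, hNu, hPu, hBD, hpu_u _ _ (hpu_mem _ _)]
    norm_Pu_le := fun p v => ?_
    norm_Ps_le := fun p v => ?_
    chord_tangent := fun η hη => ?_
    chord_map := fun η hη => ?_
    tangent_chord := fun η hη => ?_ }⟩
  · have h1 : pu (T p) (B (T p).1 w) ∈ (Eu p).map (fiberDeriv (f p.2) p.1) := by
      rw [hmapu]; exact hpu_mem _ _
    obtain ⟨ξ, hξ, hξ'⟩ := h1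
    refine ⟨D p.1 ξ, ?_, ?_⟩
    · rw [hPu, hBD, hpu_u _ _ hξ]
    · rw [hAv, hPu, hBD]; exact congrArg (D (T p).1) hξ'
  · have h1 := hC p (Pu p v) (by
      have : Pu p (Pu p v) + Ps p (Pu p v) = Pu p v := by
        rw [hPu, hPs, hPu, hBD, hpu_u _ _ (hpu_mem _ _), hps_u _ _ (hpu_mem _ _), map_zero,
          add_zero]
      exact this)
    rwa [hNu, hNs, hPu, hBD, hpu_u _ _ (hpu_mem _ _), hps_u _ _ (hpu_mem _ _), norm_zero,
      add_zero] at h1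
  · have h1 := hC p (Ps p v) (by
      have : Pu p (Ps p v) + Ps p (Ps p v) = Ps p v := by
        rw [hPu, hPs, hPs, hBD, hpu_s _ _ (hps_mem _ _), hps_s _ _ (hps_mem _ _), map_zero,
          zero_add]
      exact this)
    rwa [hNu, hNs, hPs, hBD, hps_s _ _ (hps_mem _ _), hpu_s _ _ (hps_mem _ _), norm_zero,
      zero_add] at h1
  -- Chords are almost tangent: this is the first order expansion of the constant family of the
  -- identity map.
  · obtain ⟨ρ, hρ, h⟩ := exists_pos_forall_lt_of_eventually (Y := (M × Ω) × M)
      (h := fun q => ‖e q.2 - e q.1.1‖) (by fun_prop)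
      (R := fun q => ‖e q.2 - e q.1.1 - (Pu q.1 (e q.2 - e q.1.1) + Ps q.1 (e q.2 - e q.1.1))‖ ≤
        η * ‖e q.2 - e q.1.1‖) (by
      rintro ⟨p, y⟩ hy
      obtain rfl : y = p.1 := hinj (sub_eq_zero.1 (norm_le_zero_iff.1 hy))
      refine (eventually_chord_map (f := fun _ : Ω => Diffeomorph.refl (𝓡 d) M 2)
        continuous_const he himm (A := fun p => Pu p + Ps p) (p₀ := p)
        (hcPu.add hcPs).continuousAt (fun ξ => ?_) hη).mono fun q hq => hq
      rw [fiberDeriv_refl]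
      have : Pu p (D p.1 ξ) + Ps p (D p.1 ξ) = D p.1 ξ := by rw [hP, hBD]
      exact this)
    exact ⟨ρ, hρ, fun p y hpy => h (p, y) hpy⟩
  · obtain ⟨ρ, hρ, h⟩ := exists_pos_forall_lt_of_eventually (Y := (M × Ω) × M)
      (h := fun q => ‖e q.2 - e q.1.1‖) (by fun_prop)
      (R := fun q => ‖e (T (q.2, q.1.2)).1 - e (T q.1).1 - A q.1 (e q.2 - e q.1.1)‖ ≤
        η * ‖e q.2 - e q.1.1‖) (by
      rintro ⟨p, y⟩ hy
      obtain rfl : y = p.1 := hinj (sub_eq_zero.1 (norm_le_zero_iff.1 hy))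
      refine eventually_chord_map f.continuous he himm hcA.continuousAt (fun ξ => ?_) hη
      rw [hAv]
      exact congrArg (fun ζ => D (T p).1 (Df p ζ)) (hBD _ _))
    exact ⟨ρ, hρ, fun p y hpy => h (p, y) hpy⟩
  · have : ProperSpace F := FiniteDimensional.proper ℝ F
    have : CompactSpace (Metric.closedBall (0 : F) 1) :=
      isCompact_iff_compactSpace.1 (isCompact_closedBall _ _)
    obtain ⟨ρ, hρ, h⟩ := exists_pos_forall_lt_of_eventually
      (Y := (M × Ω) × Metric.closedBall (0 : F) 1)
      (h := fun q => ‖(q.2 : F)‖) (by fun_prop)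
      (R := fun q => (Pu q.1 + Ps q.1) (q.2 : F) = q.2 →
        ∃ y, ‖e y - e q.1.1 - q.2‖ ≤ η * ‖(q.2 : F)‖) (by
      rintro ⟨p, v⟩ hv
      have hv0 : (v : F) = 0 := norm_le_zero_iff.1 hv
      have h1 := eventually_tangent_chord (P := fun p => Pu p + Ps p) (p₀ := p) he
        (hcPu.add hcPs).continuousAt (fun v => hP p v) hη
      rw [← hv0] at h1
      have h2 : ContinuousAt (fun q : (M × Ω) × Metric.closedBall (0 : F) 1 => (q.1, (q.2 : F)))
        (p, v) := by fun_prop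
      exact h2.eventually h1)
    refine ⟨min ρ 1, by positivity, fun p v hpv hv => ?_⟩
    exact h (p, ⟨v, by simpa using (hv.le.trans (min_le_right _ _))⟩)
      (hv.trans_le (min_le_left _ _)) hpv

end AnosovToAmbient

/-! ### Entropy of finite partitions -/

section PartitionEntropy

theorem negMulLog_le_sub_add {p q : ℝ} (hp : 0 ≤ p) (hq : 0 ≤ q) (h : q = 0 → p = 0) :
    Real.negMulLog p ≤ -(p * Real.log q) + (q - p) := by
  rcases hp.eq_or_lt with rfl | hp
  · simpa using hq
  have hq' : 0 < q := lt_of_le_of_ne hq fun h' => hp.ne' (h h'.symm)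
  have h1 := Real.log_le_sub_one_of_pos (div_pos hq' hp)
  rw [Real.log_div hq'.ne' hp.ne'] at h1
  have h2 := mul_le_mul_of_nonneg_left h1 hp.le
  have h3 : p * (q / p - 1) = q - p := by field_simp
  rw [h3] at h2
  rw [Real.negMulLog]
  linarith

/-- Gibbs' inequality. -/
theorem sum_negMulLog_le {A : Type*} [Fintype A] {p q : A → ℝ} (hp : ∀ a, 0 ≤ p a)
    (hq : ∀ a, 0 ≤ q a) (h : ∀ a, q a = 0 → p a = 0) (hsum : ∑ a, q a ≤ ∑ a, p a) :
    ∑ a, Real.negMulLog (p a) ≤ -∑ a, p a * Real.log (q a) := by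
  calc ∑ a, Real.negMulLog (p a) ≤ ∑ a, (-(p a * Real.log (q a)) + (q a - p a)) :=
        Finset.sum_le_sum fun a _ => negMulLog_le_sub_add (hp a) (hq a) (h a)
    _ = -∑ a, p a * Real.log (q a) + (∑ a, q a - ∑ a, p a) := by
        rw [Finset.sum_add_distrib, Finset.sum_neg_distrib, Finset.sum_sub_distrib]
    _ ≤ _ := by linarith

/-- A partition into one big set and small sets has bounded entropy. -/
theorem exists_partitionEntropy_option_le {X : Type*} [MeasurableSpace X] {μ : Measure X} (m : ℕ) :
    ∃ δ > 0, ∀ P : X → Option (Fin m), (∀ j, μ.real (P ⁻¹' {some j}) ≤ δ) →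
      partitionEntropy μ P ≤ 2 := by
  have h1 : Tendsto Real.negMulLog (𝓝 0) (𝓝 0) := by
    simpa using Real.continuous_negMulLog.tendsto 0
  obtain ⟨δ, hδ, h⟩ := Metric.eventually_nhds_iff.1
    (h1.eventually_lt_const (show (0 : ℝ) < 1 / (m + 1) by positivity))
  refine ⟨δ / 2, half_pos hδ, fun P hP => ?_⟩
  rw [partitionEntropy, Fintype.sum_option]
  have h2 : Real.negMulLog (μ.real (P ⁻¹' {none})) ≤ 1 := by
    have h0 : 0 ≤ μ.real (P ⁻¹' {none}) := measureReal_nonneg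
    have := negMulLog_le_sub_add h0 zero_le_one (fun h => absurd h one_ne_zero)
    simp at this
    linarith
  have h3 : ∑ j : Fin m, Real.negMulLog (μ.real (P ⁻¹' {some j})) ≤
      ∑ j : Fin m, 1 / ((m : ℝ) + 1) :=
    Finset.sum_le_sum fun j _ => (h (by
      rw [Real.dist_eq, sub_zero, abs_of_nonneg measureReal_nonneg]
      exact (hP j).trans_lt (half_lt_self hδ))).le
  have h4 : ∑ j : Fin m, 1 / ((m : ℝ) + 1) ≤ 1 := by
    simp
    rw [← div_eq_mul_inv, div_le_one (by positivity)]
    linarith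
  linarith

variable {X : Type*} [MeasurableSpace X] {μ : Measure X} [IsProbabilityMeasure μ]
  {A B : Type*}

/-- The measure of a fibre of a coarser finite partition. -/
theorem sum_measureReal_fiber [Fintype A] {P : X → A}
    (hP : ∀ a, MeasurableSet (P ⁻¹' {a})) (g : A → B) [DecidableEq B] (b : B) :
    ∑ a with g a = b, μ.real (P ⁻¹' {a}) = μ.real ((fun x => g (P x)) ⁻¹' {b}) := by
  rw [← measureReal_biUnion_finset]
  · congr 1
    ext x
    simp
  · intro a _ a' _ haa'
    exact Disjoint.preimage _ (by simpa using haa')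
  · exact fun a _ => hP a

theorem sum_measureReal_eq_one [Fintype A] {P : X → A} (hP : ∀ a, MeasurableSet (P ⁻¹' {a})) :
    ∑ a, μ.real (P ⁻¹' {a}) = 1 := by
  classical
  have := sum_measureReal_fiber (μ := μ) hP (fun _ => ()) ()
  simpa using this

theorem partitionEntropy_le_log_card [Fintype A] [Nonempty A] {P : X → A}
    (hP : ∀ a, MeasurableSet (P ⁻¹' {a})) :
    partitionEntropy μ P ≤ Real.log (Fintype.card A) := by
  have hc : (0 : ℝ) < Fintype.card A := by exact_mod_cast Fintype.card_pos
  have h := sum_negMulLog_le (p := fun a => μ.real (P ⁻¹' {a}))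
    (q := fun _ => (Fintype.card A : ℝ)⁻¹) (fun a => measureReal_nonneg) (fun a => by positivity)
    (fun a ha => absurd ha (by positivity)) (by
      rw [sum_measureReal_eq_one hP]; simp [hc.ne'])
  refine h.trans_eq ?_
  rw [← Finset.sum_mul, sum_measureReal_eq_one hP, Real.log_inv]
  ring

/-- A partition which is coarser than `P` has smaller entropy. -/
theorem partitionEntropy_le_of_factors [Fintype A] [Fintype B] {P : X → A} {Q : X → B}
    (hP : ∀ a, MeasurableSet (P ⁻¹' {a})) (h : ∀ x y, P x = P y → Q x = Q y) :
    partitionEntropy μ Q ≤ partitionEntropy μ P := by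
  classical
  obtain ⟨x₀⟩ := nonempty_of_isProbabilityMeasure μ
  have hgQ : ∃ g : A → B, ∀ x, g (P x) = Q x := by
    refine ⟨fun a => if ha : ∃ x, P x = a then Q ha.choose else Q x₀, fun x => ?_⟩
    have hx : ∃ y, P y = P x := ⟨x, rfl⟩
    simp only [hx, dif_pos]
    exact h _ _ hx.choose_spec
  obtain ⟨g, hg⟩ := hgQ
  obtain rfl : (fun x => g (P x)) = Q := funext hg
  have hle : ∀ a, μ.real (P ⁻¹' {a}) ≤ μ.real ((fun x => g (P x)) ⁻¹' {g a}) := fun a =>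
    measureReal_mono fun x hx => by
      have : P x = a := hx
      simp [this]
  have h1 : ∀ b, Real.negMulLog (μ.real ((fun x => g (P x)) ⁻¹' {b})) =
      ∑ a with g a = b, -(μ.real (P ⁻¹' {a}) *
        Real.log (μ.real ((fun x => g (P x)) ⁻¹' {g a}))) := by
    intro b
    rw [Real.negMulLog, ← sum_measureReal_fiber hP g b, neg_mul, Finset.sum_mul,
      ← Finset.sum_neg_distrib]
    refine Finset.sum_congr rfl fun a ha => ?_
    rw [(Finset.mem_filter.1 ha).2, sum_measureReal_fiber hP g b]
  rw [partitionEntropy, Finset.sum_congr rfl fun b _ => h1 b,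
    Finset.sum_fiberwise Finset.univ g fun a => -(μ.real (P ⁻¹' {a}) *
        Real.log (μ.real ((fun x => g (P x)) ⁻¹' {g a})))]
  refine Finset.sum_le_sum fun a _ => ?_
  rw [Real.negMulLog, neg_mul, neg_le_neg_iff]
  rcases (measureReal_nonneg (μ := μ) (s := P ⁻¹' {a})).eq_or_lt with h0 | h0
  · rw [← h0]; simp
  · exact mul_le_mul_of_nonneg_left (Real.log_le_log h0 (hle a)) h0.le

/-- Subadditivity of the entropy. -/
theorem partitionEntropy_prod_le [Fintype A] [Fintype B] {P : X → A} {Q : X → B}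
    (hP : ∀ a, MeasurableSet (P ⁻¹' {a})) (hQ : ∀ b, MeasurableSet (Q ⁻¹' {b})) :
    partitionEntropy μ (fun x => (P x, Q x)) ≤ partitionEntropy μ P + partitionEntropy μ Q := by
  classical
  have hPQ : ∀ c : A × B, MeasurableSet ((fun x => (P x, Q x)) ⁻¹' {c}) := fun c => by
    have : (fun x => (P x, Q x)) ⁻¹' {c} = P ⁻¹' {c.1} ∩ Q ⁻¹' {c.2} := by
      ext x; simp [Prod.ext_iff]
    rw [this]; exact (hP _).inter (hQ _)
  set r : A × B → ℝ := fun c => μ.real ((fun x => (P x, Q x)) ⁻¹' {c}) with hr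
  set p : A → ℝ := fun a => μ.real (P ⁻¹' {a}) with hp
  set q : B → ℝ := fun b => μ.real (Q ⁻¹' {b}) with hq
  have hrp : ∀ a, ∑ b, r (a, b) = p a := fun a => by
    have h := sum_measureReal_fiber (μ := μ) hPQ (Prod.fst) a
    rw [hp]
    simp only
    refine Eq.trans ?_ h
    rw [Finset.sum_filter, Fintype.sum_prod_type, Finset.sum_eq_single a]
    · simp [hr]
    · intro a' _ ha'; simp [ha']
    · simp
  have hrq : ∀ b, ∑ a, r (a, b) = q b := fun b => by
    have h := sum_measureReal_fiber (μ := μ) hPQ (Prod.snd) b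
    rw [hq]
    simp only
    refine Eq.trans ?_ h
    rw [Finset.sum_filter, Fintype.sum_prod_type_right, Finset.sum_eq_single b]
    · simp [hr]
    · intro b' _ hb'; simp [hb']
    · simp
  have hp0 : ∀ a, 0 ≤ p a := fun a => measureReal_nonneg
  have hq0 : ∀ b, 0 ≤ q b := fun b => measureReal_nonneg
  have hr0 : ∀ c, 0 ≤ r c := fun c => measureReal_nonneg
  have hrlep : ∀ c, r c ≤ p c.1 := fun c => measureReal_mono fun x hx => congrArg Prod.fst hx
  have hrleq : ∀ c, r c ≤ q c.2 := fun c => measureReal_mono fun x hx => congrArg Prod.snd hx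
  have hzero : ∀ c : A × B, p c.1 * q c.2 = 0 → r c = 0 := fun c hc => by
    rcases mul_eq_zero.1 hc with h | h
    · exact le_antisymm ((hrlep c).trans h.le) (hr0 c)
    · exact le_antisymm ((hrleq c).trans h.le) (hr0 c)
  have h := sum_negMulLog_le (p := r) (q := fun c => p c.1 * q c.2) hr0
    (fun c => mul_nonneg (hp0 _) (hq0 _)) hzero (by
      rw [Fintype.sum_prod_type]
      simp only [← Finset.mul_sum]
      rw [← Finset.sum_mul]
      rw [sum_measureReal_eq_one hP, sum_measureReal_eq_one hQ, sum_measureReal_eq_one hPQ]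
      norm_num)
  have h2 : ∑ c, r c * Real.log (p c.1 * q c.2) =
      ∑ a, p a * Real.log (p a) + ∑ b, q b * Real.log (q b) := by
    have h3 : ∀ c, r c * Real.log (p c.1 * q c.2) =
        r c * Real.log (p c.1) + r c * Real.log (q c.2) := fun c => by
      by_cases hc : p c.1 * q c.2 = 0
      · rw [hzero c hc]; simp
      · rw [Real.log_mul (left_ne_zero_of_mul hc) (right_ne_zero_of_mul hc)]; ring
    rw [Finset.sum_congr rfl fun c _ => h3 c, Finset.sum_add_distrib]
    congr 1
    · rw [Fintype.sum_prod_type]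
      simp only [← Finset.sum_mul, hrp]
    · rw [Fintype.sum_prod_type_right]
      simp only [← Finset.sum_mul, hrq]
  rw [h2] at h
  refine h.trans_eq ?_
  simp only [partitionEntropy, Real.negMulLog, neg_mul, Finset.sum_neg_distrib]
  ring

theorem measurableSet_itinerary_fiber {T : X → X} (hT : Measurable T) {P : X → A}
    (hP : ∀ a, MeasurableSet (P ⁻¹' {a})) (n : ℕ) (c : Fin n → A) :
    MeasurableSet (itinerary T P n ⁻¹' {c}) := by
  have : itinerary T P n ⁻¹' {c} = ⋂ i : Fin n, T^[i] ⁻¹' (P ⁻¹' {c i}) := by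
    ext x
    simp [itinerary, funext_iff]
  rw [this]
  exact MeasurableSet.iInter fun i => (hT.iterate i) (hP _)

/-- The entropy of an itinerary is at most its length times the entropy of the partition. -/
theorem partitionEntropy_itinerary_le [Fintype A] {T : X → X} (hT : MeasurePreserving T μ μ)
    {P : X → A} (hP : ∀ a, MeasurableSet (P ⁻¹' {a})) (n : ℕ) :
    partitionEntropy μ (itinerary T P n) ≤ n * partitionEntropy μ P := by
  induction n with
  | zero =>
    have := partitionEntropy_le_log_card (μ := μ)
      (measurableSet_itinerary_fiber hT.measurable hP 0)
    simpa using this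
  | succ n ih =>
    have hm := measurableSet_itinerary_fiber hT.measurable hP n
    have hm' : ∀ a, MeasurableSet ((fun x => P (T^[n] x)) ⁻¹' {a}) := fun a =>
      (hT.measurable.iterate n) (hP a)
    have h1 : partitionEntropy μ (itinerary T P (n + 1)) ≤
        partitionEntropy μ (fun x => (itinerary T P n x, P (T^[n] x))) := by
      refine partitionEntropy_le_of_factors (fun c => ?_) fun x y hxy => ?_
      · have : (fun x => (itinerary T P n x, P (T^[n] x))) ⁻¹' {c} =
            itinerary T P n ⁻¹' {c.1} ∩ (fun x => P (T^[n] x)) ⁻¹' {c.2} := by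
          ext x; simp [Prod.ext_iff]
        rw [this]; exact (hm _).inter (hm' _)
      · funext i
        refine Fin.lastCases ?_ (fun i => ?_) i
        · exact congrArg Prod.snd hxy
        · exact congrFun (congrArg Prod.fst hxy) i
    have h2 := partitionEntropy_prod_le (μ := μ) hm hm'
    have h3 : partitionEntropy μ (fun x => P (T^[n] x)) = partitionEntropy μ P := by
      refine Finset.sum_congr rfl fun a _ => ?_
      congr 1
      exact (hT.iterate n).measureReal_preimage (hP a).nullMeasurableSet
    push_cast
    linarith

end PartitionEntropy

/-! ### Finite entropy of expansive skew products -/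

section EntropyFinite

/-- A relation on a compact space which holds between any two points that are close to each other
holds between the points of equal colour for some finite measurable colouring. -/
theorem exists_finite_coloring {Y : Type*} [TopologicalSpace Y] [CompactSpace Y]
    [MeasurableSpace Y] [BorelSpace Y] {R : Y → Y → Prop}
    (hR : ∀ y, ∃ U ∈ 𝓝 y, ∀ a ∈ U, ∀ b ∈ U, R a b) :
    ∃ (n : ℕ) (c : Y → Set (Fin n)), (∀ s, MeasurableSet (c ⁻¹' {s})) ∧
      ∀ a b, c a = c b → R a b := by
  choose U hU hUR using hR
  obtain ⟨t, ht⟩ := (isCompact_univ (X := Y)).elim_nhds_subcover (fun y => interior (U y))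
    fun y _ => interior_mem_nhds.2 (hU y)
  let g := t.equivFin
  refine ⟨t.card, fun y => {i | y ∈ interior (U (g.symm i))}, fun s => ?_, fun a b hab => ?_⟩
  · have : (fun y => {i : Fin t.card | y ∈ interior (U (g.symm i))}) ⁻¹' {s} =
        ⋂ i, {y | y ∈ interior (U (g.symm i)) ↔ i ∈ s} := by
      ext y
      simp [Set.ext_iff]
    rw [this]
    refine MeasurableSet.iInter fun i => ?_
    by_cases hi : i ∈ s
    · simp only [hi, iff_true]
      exact isOpen_interior.measurableSet
    · simp only [hi, iff_false]
      exact isOpen_interior.measurableSet.compl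
  · obtain ⟨y, hy, hay⟩ := mem_iUnion₂.1 (ht.2 (mem_univ a))
    have h1 : g ⟨y, hy⟩ ∈ {i : Fin t.card | a ∈ interior (U (g.symm i))} := by simpa using hay
    have h2 : g ⟨y, hy⟩ ∈ {i : Fin t.card | b ∈ interior (U (g.symm i))} := by
      rw [← show _ = {i : Fin t.card | b ∈ interior (U (g.symm i))} from hab]; exact h1
    exact hUR y a (interior_subset hay) b (interior_subset (by simpa using h2))

theorem zpow_snd_of_add {M Ω : Type*} [TopologicalSpace M] [TopologicalSpace Ω] [AddCommGroup Ω]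
    {T : M × Ω ≃ₜ M × Ω} {α : Ω} (hT : ∀ p, (T p).2 = p.2 + α) (i : ℤ)
    (p : M × Ω) : ((T ^ i) p).2 = p.2 + i • α := by
  have hnat : ∀ (n : ℕ) p, ((T ^ n) p).2 = p.2 + n • α := fun n => by
    induction n with
    | zero => intro p; simp
    | succ n ih =>
      intro p
      rw [pow_succ, Homeomorph.mul_apply, ih, hT, add_assoc, succ_nsmul']
  obtain ⟨n, rfl | rfl⟩ := i.eq_nat_or_neg
  · rw [zpow_natCast, natCast_zsmul]; exact hnat n p
  · have h := hnat n ((T ^ (-(n : ℤ))) p)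
    rw [← Homeomorph.mul_apply, ← zpow_natCast, ← zpow_add, add_neg_cancel, zpow_zero,
      Homeomorph.one_apply] at h
    rw [h, neg_zsmul, natCast_zsmul, add_neg_cancel_right]

variable {M Ω F : Type*} [TopologicalSpace M] [TopologicalSpace Ω] [AddCommGroup Ω]
  [IsTopologicalAddGroup Ω] [NormedAddCommGroup F]

/-- Pairs of distinct points in a compact set whose base points are sufficiently close are
separated by an expansive map in a uniformly bounded time. -/
theorem FiberExpansive.exists_bound_of_isCompact [T2Space Ω] {T : M × Ω ≃ₜ M × Ω} {e : M → F}
    {ε : ℝ} (hexp : FiberExpansive T e ε) (he : Continuous e) {S : Set ((M × Ω) × (M × Ω))}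
    (hS : IsCompact S) (hne : ∀ s ∈ S, s.1 ≠ s.2) :
    ∃ V ∈ 𝓝 (0 : Ω), ∃ N : ℕ, ∀ s ∈ S, s.1.2 - s.2.2 ∈ V →
      ∃ i : ℤ, |i| ≤ N ∧ ε < ‖e ((T ^ i) s.1).1 - e ((T ^ i) s.2).1‖ := by
  refine hS.induction_on (p := fun S => ∃ V ∈ 𝓝 (0 : Ω), ∃ N : ℕ, ∀ s ∈ S, s.1.2 - s.2.2 ∈ V →
      ∃ i : ℤ, |i| ≤ N ∧ ε < ‖e ((T ^ i) s.1).1 - e ((T ^ i) s.2).1‖) ?_ ?_ ?_ ?_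
  · exact ⟨univ, univ_mem, 0, by simp⟩
  · rintro s t hst ⟨V, hV, N, h⟩
    exact ⟨V, hV, N, fun x hx => h x (hst hx)⟩
  · rintro s t ⟨V, hV, N, h⟩ ⟨V', hV', N', h'⟩
    refine ⟨V ∩ V', inter_mem hV hV', max N N', fun x hx hxV => ?_⟩
    rcases hx with hx | hx
    · obtain ⟨i, hi, hi'⟩ := h x hx hxV.1
      exact ⟨i, hi.trans (by exact_mod_cast le_max_left _ _), hi'⟩
    · obtain ⟨i, hi, hi'⟩ := h' x hx hxV.2
      exact ⟨i, hi.trans (by exact_mod_cast le_max_right _ _), hi'⟩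
  · rintro ⟨⟨x, w⟩, ⟨y, w'⟩⟩ hs
    by_cases hw : w = w'
    · subst hw
      have hxy : ¬ ∀ i : ℤ, ‖e ((T ^ i) (x, w)).1 - e ((T ^ i) (y, w)).1‖ ≤ ε := fun h =>
        hne _ hs (by rw [hexp x y w h])
      push Not at hxy
      obtain ⟨i, hi⟩ := hxy
      have hc : Continuous fun s : (M × Ω) × (M × Ω) =>
          ‖e ((T ^ i) s.1).1 - e ((T ^ i) s.2).1‖ := by
        have := (T ^ i).continuous
        fun_prop
      refine ⟨_, mem_nhdsWithin_of_mem_nhds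
        (hc.continuousAt.eventually (lt_mem_nhds (by exact hi))), univ, univ_mem, i.natAbs,
        fun s hs _ => ⟨i, by simp, hs⟩⟩
    · obtain ⟨U, V, hU, hV, hUV⟩ := t2_separation_nhds (sub_ne_zero.2 hw)
      have hc : Continuous fun s : (M × Ω) × (M × Ω) => s.1.2 - s.2.2 := by fun_prop
      refine ⟨_, mem_nhdsWithin_of_mem_nhds (hc.continuousAt.preimage_mem_nhds (by exact hU)),
        V, hV, 0, fun s hs hsV => ?_⟩
      exact absurd hsV (Set.disjoint_left.1 hUV hs)

variable [CompactSpace M] [CompactSpace Ω] [T2Space M] [T2Space Ω]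
  [SecondCountableTopology M] [SecondCountableTopology Ω]
  [MeasurableSpace M] [BorelSpace M] [MeasurableSpace Ω] [BorelSpace Ω]

/-- A fibre-expansive skew product over a rotation has finite metric entropy: up to an error of
bounded entropy, every partition is determined by the base point and a fixed finite partition of
the fibre. -/
theorem FiberExpansive.metricEntropy_lt_top {T : M × Ω ≃ₜ M × Ω} {e : M → F}
    {ε : ℝ} (hexp : FiberExpansive T e ε) (hε : 0 < ε) (he : Continuous e) {α : Ω}
    (hT : ∀ p, (T p).2 = p.2 + α) {μ : Measure (M × Ω)} [IsProbabilityMeasure μ]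
    (hμ : MeasurePreserving T μ μ) : metricEntropy T μ < ⊤ := by
  classical
  obtain ⟨kM, cM, hcM, hcM'⟩ := exists_finite_coloring (Y := M) (R := fun a b => ‖e a - e b‖ ≤ ε)
    fun y => by
      refine ⟨e ⁻¹' Metric.ball (e y) (ε / 2),
        he.continuousAt.preimage_mem_nhds (Metric.ball_mem_nhds _ (half_pos hε)),
        fun a ha b hb => ?_⟩
      rw [← dist_eq_norm]
      have h1 : dist (e a) (e y) < ε / 2 := ha
      have h2 : dist (e b) (e y) < ε / 2 := hb
      linarith [dist_triangle_right (e a) (e b) (e y)]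
  set L : ℝ := Real.log (Fintype.card (Set (Fin kM))) with hL
  have : TopologicalSpace.PseudoMetrizableSpace (M × Ω) :=
    (TopologicalSpace.metrizableSpace_of_t3_secondCountable (M × Ω)).toPseudoMetrizableSpace
  refine lt_of_le_of_lt ?_ (EReal.coe_lt_top (L + 3))
  refine iSup_le fun m => iSup_le fun Q => iSup_le fun hQ => ?_
  obtain ⟨δ, hδ, hδQ⟩ := exists_partitionEntropy_option_le (μ := μ) m
  have hK : ∀ j : Fin m, ∃ K ⊆ Q ⁻¹' {j}, IsClosed K ∧ μ (Q ⁻¹' {j} \ K) < ENNReal.ofReal δ :=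
    fun j => (hQ (measurableSet_singleton j)).exists_isClosed_sdiff_lt (measure_ne_top _ _)
      (by simpa using hδ)
  choose K hKQ hKc hKμ using hK
  set Q' : M × Ω → Option (Fin m) := fun p => if p ∈ K (Q p) then none else some (Q p) with hQ'
  have hQ'some : ∀ j, Q' ⁻¹' {some j} = Q ⁻¹' {j} \ K j := fun j => by
    ext p
    by_cases hp : p ∈ K (Q p)
    · simp only [hQ', mem_preimage, hp, if_true, mem_singleton_iff, Set.mem_sdiff]
      constructor
      · intro h; simp at h
      · rintro ⟨rfl, h⟩; exact absurd hp h
    · simp only [hQ', mem_preimage, hp, if_false, mem_singleton_iff, Set.mem_sdiff, Option.some_inj]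
      constructor
      · rintro rfl; exact ⟨rfl, hp⟩
      · exact fun h => h.1
  have hQ'm : ∀ o, MeasurableSet (Q' ⁻¹' {o}) := by
    have h1 : ∀ j, MeasurableSet (Q' ⁻¹' {some j}) := fun j => by
      rw [hQ'some]; exact (hQ (measurableSet_singleton j)).diff (hKc j).measurableSet
    rintro (_ | j)
    · have : Q' ⁻¹' {none} = (⋃ j, Q' ⁻¹' {some j})ᶜ := by
        ext p
        simp only [mem_preimage, mem_singleton_iff, mem_compl_iff, mem_iUnion]
        cases Q' p <;> simp
      rw [this]
      exact (MeasurableSet.iUnion h1).compl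
    · exact h1 j
  have hQ'e : partitionEntropy μ Q' ≤ 2 := hδQ Q' fun j => by
    rw [hQ'some]
    exact ENNReal.toReal_le_of_le_ofReal hδ.le (hKμ j).le
  -- Pairs of points in different cells of the closed partial partition.
  set S : Set ((M × Ω) × (M × Ω)) := ⋃ j : Fin m, ⋃ l : Fin m, ⋃ _ : j ≠ l, K j ×ˢ K l with hS
  have hSc : IsCompact S := isCompact_iUnion fun j => isCompact_iUnion fun l =>
    isCompact_iUnion fun _ => (hKc j).isCompact.prod (hKc l).isCompact
  have hSne : ∀ s ∈ S, s.1 ≠ s.2 := by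
    intro s hs h
    simp only [hS, mem_iUnion] at hs
    obtain ⟨j, l, hjl, h1, h2⟩ := hs
    have h3 : Q s.1 = j := hKQ j h1
    have h4 : Q s.2 = l := hKQ l h2
    exact hjl (by rw [← h3, ← h4, h])
  obtain ⟨V, hV, N, hVN⟩ := hexp.exists_bound_of_isCompact he hSc hSne
  obtain ⟨kΩ, cΩ, hcΩ, hcΩ'⟩ := exists_finite_coloring (Y := Ω) (R := fun a b => a - b ∈ V)
    fun y => by
      have h1 : Tendsto (fun q : Ω × Ω => q.1 - q.2) (𝓝 (y, y)) (𝓝 0) := by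
        have : Continuous fun q : Ω × Ω => q.1 - q.2 := by fun_prop
        simpa using this.tendsto (y, y)
      obtain ⟨U, hU, U', hU', h⟩ := mem_nhds_prod_iff.1 (h1 hV)
      exact ⟨U ∩ U', inter_mem hU hU', fun a ha b hb => h (mk_mem_prod ha.1 hb.2)⟩
  set R : M × Ω → Set (Fin kΩ) := fun p => cΩ p.2 with hRdef
  have hRm : ∀ a, MeasurableSet (R ⁻¹' {a}) := fun a => measurable_snd (hcΩ a)
  set P : M × Ω → Set (Fin kM) := fun p => cM p.1 with hPdef
  have hPm : ∀ a, MeasurableSet (P ⁻¹' {a}) := fun a => measurable_fst (hcM a)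
  have hitP : ∀ n : ℕ, ∀ c, MeasurableSet
      ((fun p => itinerary T P (n + 2 * N) ((T ^ (-(N : ℤ))) p)) ⁻¹' {c}) := fun n c =>
    (T ^ (-(N : ℤ))).continuous.measurable
      (measurableSet_itinerary_fiber T.continuous.measurable hPm _ c)
  have hprodm : ∀ {A B : Type} {g : M × Ω → A} {h : M × Ω → B},
      (∀ a, MeasurableSet (g ⁻¹' {a})) → (∀ b, MeasurableSet (h ⁻¹' {b})) →
      ∀ c, MeasurableSet ((fun p => (g p, h p)) ⁻¹' {c}) := by
    intro A B g h hg hh c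
    have : (fun p => (g p, h p)) ⁻¹' {c} = g ⁻¹' {c.1} ∩ h ⁻¹' {c.2} := by
      ext x; simp [Prod.ext_iff]
    rw [this]; exact (hg _).inter (hh _)
  have hiter : ∀ (i : ℕ) (p : M × Ω), T^[i] p = (T ^ (i : ℤ)) p := fun i p => by
    rw [zpow_natCast]
    induction i with
    | zero => rfl
    | succ i ih => rw [Function.iterate_succ_apply', ih, pow_succ', Homeomorph.mul_apply]
  have key : ∀ n : ℕ, partitionEntropy μ (itinerary T Q n) ≤
      Real.log (Fintype.card (Set (Fin kΩ))) + ((n + 2 * N : ℕ) * L + n * 2) := by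
    intro n
    have hQn := measurableSet_itinerary_fiber T.continuous.measurable hQ'm n
    have h1 : partitionEntropy μ (itinerary T Q n) ≤ partitionEntropy μ
        (fun p => (R p, (itinerary T P (n + 2 * N) ((T ^ (-(N : ℤ))) p), itinerary T Q' n p))) := by
      refine partitionEntropy_le_of_factors (hprodm hRm (hprodm (hitP n) hQn)) fun p q hpq => ?_
      simp only [Prod.mk.injEq] at hpq
      obtain ⟨hR1, hP1, hQ1⟩ := hpq
      funext i
      have hi := congrFun hQ1 i
      simp only [itinerary] at hi ⊢
      set p' := T^[i] p with hp'
      set q' := T^[i] q with hq'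
      by_contra hne
      by_cases hpK : p' ∈ K (Q p')
      · by_cases hqK : q' ∈ K (Q q')
        · obtain ⟨k, hkN, hk⟩ := hVN (p', q') (by
            simp only [hS, mem_iUnion]
            exact ⟨_, _, hne, hpK, hqK⟩) (by
            simp only [hp', hq', hiter, zpow_snd_of_add hT, add_sub_add_right_eq_sub]
            exact hcΩ' _ _ hR1)
          obtain ⟨hk1, hk2⟩ := abs_le.1 hkN
          have hlt : (i + k + N).toNat < n + 2 * N := by have := i.2; omega
          have hPk := congrFun hP1 ⟨_, hlt⟩
          have hcomp : ∀ r : M × Ω, T^[(i + k + N).toNat] ((T ^ (-(N : ℤ))) r) =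
              (T ^ k) (T^[i] r) := fun r => by
            rw [hiter, hiter, Int.toNat_of_nonneg (by omega), ← Homeomorph.mul_apply,
              ← Homeomorph.mul_apply, ← zpow_add, ← zpow_add]
            congr 2
            ring
          simp only [itinerary, hcomp] at hPk
          exact absurd hk (not_lt.2 (hcM' _ _ hPk))
        · simp [hQ', hpK, hqK] at hi
      · by_cases hqK : q' ∈ K (Q q')
        · simp [hQ', hpK, hqK] at hi
        · simp only [hQ', hpK, hqK, if_false, Option.some_inj] at hi
          exact hne hi
    have h2 := partitionEntropy_prod_le (μ := μ) hRm (hprodm (hitP n) hQn)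
    have h3 := partitionEntropy_prod_le (μ := μ) (hitP n) hQn
    have h4 := partitionEntropy_le_log_card (μ := μ) hRm
    have h5 := partitionEntropy_le_log_card (μ := μ) (hitP n)
    have h6 := partitionEntropy_itinerary_le hμ hQ'm n
    have h7 : (n : ℝ) * partitionEntropy μ Q' ≤ n * 2 :=
      mul_le_mul_of_nonneg_left hQ'e n.cast_nonneg
    have h8 : Real.log (Fintype.card (Fin (n + 2 * N) → Set (Fin kM))) = (n + 2 * N : ℕ) * L := by
      rw [Fintype.card_fun, Fintype.card_fin, Nat.cast_pow, Real.log_pow]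
    rw [h8] at h5
    linarith
  set D : ℝ := Real.log (Fintype.card (Set (Fin kΩ))) + 2 * N * L with hD
  refine limsup_le_of_le (h := ?_)
  have hev : ∀ᶠ n : ℕ in atTop, D / n < 1 :=
    (tendsto_const_div_atTop_nhds_zero_nat D).eventually_lt_const one_pos
  filter_upwards [hev, eventually_gt_atTop 0] with n hn hn0
  have hn0' : (0 : ℝ) < n := by exact_mod_cast hn0
  refine EReal.coe_le_coe_iff.2 ?_
  rw [div_le_iff₀ hn0']
  rw [div_lt_iff₀ hn0'] at hn
  have := key n
  push_cast at this
  nlinarith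

end EntropyFinite

/-! ### Coding of orbits by binary sequences -/

section Coding

variable {M Ω F : Type*} [TopologicalSpace M] [TopologicalSpace Ω] [NormedAddCommGroup F]
  [CompactSpace M]

/-- Two points of a fibre whose orbits stay close during a long time window are very close. -/
theorem FiberExpansive.exists_window [CompactSpace Ω] [AddCommGroup Ω]
    [IsTopologicalAddGroup Ω] [T2Space Ω] {T : M × Ω ≃ₜ M × Ω} {e : M → F} {ε : ℝ}
    (hexp : FiberExpansive T e ε) (he : Continuous e) {η : ℝ} (hη : 0 < η) :
    ∃ N : ℕ, ∀ p q : M × Ω, p.2 = q.2 →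
      (∀ i : ℤ, |i| ≤ N → ‖e ((T ^ i) p).1 - e ((T ^ i) q).1‖ ≤ ε) → ‖e p.1 - e q.1‖ ≤ η := by
  set S : Set ((M × Ω) × (M × Ω)) := {s | s.1.2 = s.2.2} ∩ {s | η ≤ ‖e s.1.1 - e s.2.1‖} with hS
  have hSc : IsClosed S := (isClosed_eq (by fun_prop) (by fun_prop)).inter
    (isClosed_le (by fun_prop) (by fun_prop))
  obtain ⟨V, hV, N, h⟩ := hexp.exists_bound_of_isCompact he hSc.isCompact fun s hs hne => by
    have := hs.2
    simp only [Set.mem_ofPred_eq, hne, sub_self, norm_zero] at this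
    exact absurd hη (not_lt.2 this)
  refine ⟨N, fun p q hpq hi => ?_⟩
  by_contra hlt
  obtain ⟨i, hiN, hε⟩ := h (p, q) ⟨hpq, (not_le.1 hlt).le⟩
    (by simp only [hpq, sub_self]; exact mem_of_mem_nhds hV)
  exact absurd (hi i hiN) (not_le.2 hε)

/-- In an expansive system with infinite fibres there are two orbit segments over the same base
segment which start close together and end close together, but separate in between. -/
theorem FiberExpansive.exists_separating_pair [Infinite M] [Nonempty Ω] {T : M × Ω ≃ₜ M × Ω}
    {θ : Ω ≃ₜ Ω} (hT : ∀ p, (T p).2 = θ p.2) {e : M → F} {ε : ℝ} (hexp : FiberExpansive T e ε)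
    (he : Continuous e) {δ : ℝ} (hδ : 0 < δ) :
    ∃ (x y : M) (w : Ω) (m τ : ℕ), τ ≤ m ∧ ‖e x - e y‖ < δ ∧
      ‖e ((T ^ m) (x, w)).1 - e ((T ^ m) (y, w)).1‖ < δ ∧
      ε < ‖e ((T ^ τ) (x, w)).1 - e ((T ^ τ) (y, w)).1‖ := by
  classical
  borelize M
  obtain ⟨k, c, -, hc⟩ := exists_finite_coloring (Y := M) (R := fun a b => ‖e a - e b‖ < δ)
    fun y => by
      refine ⟨e ⁻¹' Metric.ball (e y) (δ / 2),
        he.continuousAt.preimage_mem_nhds (Metric.ball_mem_nhds _ (half_pos hδ)),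
        fun a ha b hb => ?_⟩
      rw [← dist_eq_norm]
      have h1 : dist (e a) (e y) < δ / 2 := ha
      have h2 : dist (e b) (e y) < δ / 2 := hb
      linarith [dist_triangle_right (e a) (e b) (e y)]
  obtain ⟨w⟩ := ‹Nonempty Ω›
  obtain ⟨s, hs⟩ := Infinite.exists_subset_card_eq M
    (Fintype.card (Set (Fin k) × Set (Fin k)) + 1)
  have hsep : ∀ q : M × M, ∃ t : ℤ, q.1 ≠ q.2 →
      ε < ‖e ((T ^ t) (q.1, w)).1 - e ((T ^ t) (q.2, w)).1‖ := fun q => by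
    by_contra! hcon
    have h1 := hcon 0
    exact h1.1 (hexp q.1 q.2 w fun i => (hcon i).2)
  choose t ht using hsep
  -- A time window which contains the separation times of all pairs of points of `s`.
  set n : ℕ := (s ×ˢ s).sup fun q => (t q).natAbs with hn
  obtain ⟨x, hx, y, hy, hxy, hcol⟩ := Finset.exists_ne_map_eq_of_card_lt_of_maps_to
    (s := s) (t := (Finset.univ : Finset (Set (Fin k) × Set (Fin k))))
    (by rw [hs, Finset.card_univ]; exact Nat.lt_succ_self _)
    (f := fun x => (c ((T ^ (-(n : ℤ))) (x, w)).1, c ((T ^ (n : ℤ)) (x, w)).1))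
    (fun _ _ => Finset.mem_univ _)
  simp only [Prod.mk.injEq] at hcol
  have htn : (t (x, y)).natAbs ≤ n :=
    Finset.le_sup (f := fun q => (t q).natAbs) (Finset.mk_mem_product hx hy)
  set p := (T ^ (-(n : ℤ))) (x, w) with hp
  set q := (T ^ (-(n : ℤ))) (y, w) with hq
  have hp2 : p.2 = q.2 := by rw [hp, hq, zpow_snd hT, zpow_snd hT]
  have hpq : (q.1, p.2) = q := by rw [hp2]
  have hm : ∀ (i : ℕ) (r : M × Ω), (T ^ i) ((T ^ (-(n : ℤ))) r) = (T ^ ((i : ℤ) - n)) r := by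
    intro i r
    rw [← Homeomorph.mul_apply, ← zpow_natCast, ← zpow_add, sub_eq_add_neg]
  refine ⟨p.1, q.1, p.2, 2 * n, (t (x, y) + n).toNat, by omega, hc _ _ hcol.1, ?_, ?_⟩
  · rw [hpq, hp, hq, hm, hm]
    have : ((2 * n : ℕ) : ℤ) - n = n := by push_cast; ring
    rw [this]
    exact hc _ _ hcol.2
  · rw [hpq, hp, hq, hm, hm]
    have : (((t (x, y) + n).toNat : ℕ) : ℤ) - n = t (x, y) := by omega
    rw [this]
    exact ht (x, y) hxy

variable [SecondCountableTopology M] [SecondCountableTopology Ω]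
  [MeasurableSpace M] [BorelSpace M] [MeasurableSpace Ω] [BorelSpace Ω]

/-- Coding of orbits by binary sequences. Over each point `p` and for each sequence `a`, the
segments `seg ((T ^ (n * i)) p) (a i)` of length `n` are concatenated to a pseudo-orbit, which is
shadowed by the orbit of a unique point `G p a` of the fibre of `p`. -/
theorem exists_coding {T : M × Ω ≃ₜ M × Ω} {θ : Ω ≃ₜ Ω} (hT : ∀ p, (T p).2 = θ p.2) {e : M → F}
    {ε₁ ε δ : ℝ} (hexp : FiberExpansive T e ε₁) (hε : 2 * ε ≤ ε₁) (he : Continuous e)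
    (hsh : ∀ (w : Ω) (z : ℤ → M), (∀ i, ‖e (z (i + 1)) - e (T (z i, (θ ^ i) w)).1‖ ≤ δ) →
      ∃ x, ∀ i, ‖e ((T ^ i) (x, w)).1 - e (z i)‖ ≤ ε)
    {seg : M × Ω → Bool → ℕ → M} {m n : ℕ} (hmn : m < n)
    (hmeas : ∀ b l, Measurable fun q => seg q b l)
    (hstep : ∀ q b (l : ℕ), ‖e (seg q b (l + 1)) - e (T (seg q b l, ((T ^ l) q).2)).1‖ ≤ δ)
    (hstart : ∀ q b, ‖e (seg q b 0) - e q.1‖ ≤ δ)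
    (hend : ∀ q b (l : ℕ), m ≤ l → seg q b l = ((T ^ l) q).1) :
    ∃ G : M × Ω → (ℤ → Bool) → M × Ω, (∀ p a, (G p a).2 = p.2) ∧
      (∀ p a (j : ℤ), ‖e ((T ^ j) (G p a)).1 -
        e (seg ((T ^ (n * (j / n) : ℤ)) p) (a (j / n)) (j % n).toNat)‖ ≤ ε) ∧
      (∀ p a, G ((T ^ n) p) (shift a) = (T ^ n) (G p a)) ∧
      (∀ a, Measurable fun p => G p a) ∧ ∀ p, Continuous (G p) := by
  have hn0 : (0 : ℤ) < n := by omega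
  set z : M × Ω → (ℤ → Bool) → ℤ → M := fun p a j =>
    seg ((T ^ (n * (j / n) : ℤ)) p) (a (j / n)) (j % n).toNat with hz
  have hzl : ∀ (i : ℤ) (l : ℕ) (hl : l < n) p a,
      z p a (n * i + l) = seg ((T ^ (n * i : ℤ)) p) (a i) l := fun i l hl p a => by
    have h1 : (n * i + l : ℤ) / n = i := by
      rw [add_comm, Int.add_mul_ediv_left _ _ hn0.ne',
        Int.ediv_eq_zero_of_lt (by omega) (by omega), zero_add]
    have h2 : ((n * i + l : ℤ) % n).toNat = l := by
      rw [add_comm, Int.add_mul_emod_self_left, Int.emod_eq_of_lt (by omega) (by omega)]; simp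
    simp only [hz, h1, h2]
  have hrep : ∀ j : ℤ, ∃ (i : ℤ) (l : ℕ), l < n ∧ j = n * i + l := fun j =>
    ⟨j / n, (j % n).toNat, by have := Int.emod_lt_of_pos j hn0; omega, by
      rw [Int.toNat_of_nonneg (Int.emod_nonneg _ hn0.ne')]
      exact (Int.mul_ediv_add_emod j n).symm⟩
  have hpseudo : ∀ p a j, ‖e (z p a (j + 1)) - e (T (z p a j, (θ ^ j) p.2)).1‖ ≤ δ := by
    intro p a j
    obtain ⟨i, l, hl, rfl⟩ := hrep j
    have hl2 : (θ ^ (n * i + l : ℤ)) p.2 = ((T ^ l) ((T ^ (n * i : ℤ)) p)).2 := by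
      rw [← zpow_snd hT, ← Homeomorph.mul_apply, ← zpow_natCast, ← zpow_add, add_comm]
    rw [hzl i l hl, hl2]
    rcases Nat.lt_or_ge (l + 1) n with h | h
    · have h1 : (n * i + l + 1 : ℤ) = n * i + (l + 1 : ℕ) := by push_cast; ring
      rw [h1, hzl i (l + 1) h]
      exact hstep _ _ _
    · have hln : l + 1 = n := by omega
      have h1 : (n * i + l + 1 : ℤ) = n * (i + 1) + (0 : ℕ) := by
        rw [← hln]; push_cast; ring
      rw [h1, hzl (i + 1) 0 (by omega), hend _ _ l (by omega)]
      have h2 : T (((T ^ l) ((T ^ (n * i : ℤ)) p)).1, ((T ^ l) ((T ^ (n * i : ℤ)) p)).2) =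
          (T ^ (n * (i + 1) : ℤ)) p := by
        rw [Prod.mk.eta, ← Homeomorph.mul_apply, ← Homeomorph.mul_apply, ← pow_succ',
          ← zpow_natCast, ← zpow_add, hln]
        congr 2
        ring
      rw [h2]
      exact hstart _ _
  choose Z hZ using fun p a => hsh p.2 (z p a) (hpseudo p a)
  have huniq : ∀ p a x, (∀ j, ‖e ((T ^ j) (x, p.2)).1 - e (z p a j)‖ ≤ ε) → x = Z p a := by
    intro p a x hx
    refine hexp x (Z p a) p.2 fun i => ?_
    have h1 := hx i
    have h2 := hZ p a i
    have h3 : e ((T ^ i) (x, p.2)).1 - e ((T ^ i) (Z p a, p.2)).1 =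
      (e ((T ^ i) (x, p.2)).1 - e (z p a i)) - (e ((T ^ i) (Z p a, p.2)).1 - e (z p a i)) := by
      abel
    rw [h3]
    linarith [norm_sub_le (e ((T ^ i) (x, p.2)).1 - e (z p a i))
      (e ((T ^ i) (Z p a, p.2)).1 - e (z p a i))]
  have hclosed : IsClosed {s : (Ω × (ℤ → M)) × M |
      ∀ j, ‖e ((T ^ j) (s.2, s.1.1)).1 - e (s.1.2 j)‖ ≤ ε} := by
    rw [ofPred_forall]
    refine isClosed_iInter fun j => isClosed_le ?_ continuous_const
    have := (T ^ j).continuous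
    fun_prop
  refine ⟨fun p a => (Z p a, p.2), fun p a => rfl, fun p a => hZ p a, fun p a => ?_, fun a => ?_,
    fun p => ?_⟩
  · have hshift : ∀ j, z ((T ^ n) p) (shift a) j = z p a (j + n) := fun j => by
      obtain ⟨i, l, hl, rfl⟩ := hrep j
      have h1 : (n * i + l + n : ℤ) = n * (i + 1) + l := by ring
      rw [h1, hzl i l hl, hzl (i + 1) l hl, ← Homeomorph.mul_apply, ← zpow_natCast, ← zpow_add,
        mul_add, mul_one]
      rfl
    have hT2 : ((T ^ n) (Z p a, p.2)).2 = ((T ^ n) p).2 := by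
      rw [← zpow_natCast, zpow_snd hT, zpow_snd hT]
    refine Prod.ext (huniq _ _ _ fun j => ?_).symm hT2.symm
    rw [← hT2, Prod.mk.eta, hshift, ← Homeomorph.mul_apply, ← zpow_natCast, ← zpow_add]
    exact hZ p a (j + n)
  · refine Measurable.prodMk (measurable_of_isClosed fun C hC => ?_) measurable_snd
    have hzm : Measurable fun p => (p.2, z p a) := by
      refine measurable_snd.prodMk (measurable_pi_lambda _ fun j => ?_)
      exact (hmeas _ _).comp (T ^ (n * (j / n) : ℤ)).continuous.measurable
    have himg : IsClosed (Prod.fst '' ({s : (Ω × (ℤ → M)) × M |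
        ∀ j, ‖e ((T ^ j) (s.2, s.1.1)).1 - e (s.1.2 j)‖ ≤ ε} ∩ Prod.snd ⁻¹' C)) :=
      isClosedMap_fst_of_compactSpace _ (hclosed.inter (hC.preimage continuous_snd))
    convert hzm himg.measurableSet using 1
    ext p
    simp only [mem_preimage, mem_image, mem_inter_iff, Set.mem_ofPred_eq]
    constructor
    · exact fun h => ⟨((p.2, z p a), Z p a), ⟨hZ p a, h⟩, rfl⟩
    · rintro ⟨⟨⟨w, ζ⟩, x⟩, ⟨h1, h2⟩, h3⟩
      simp only [Prod.mk.injEq] at h3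
      obtain ⟨rfl, rfl⟩ := h3
      rw [← huniq p a x h1]
      exact h2
  · refine Continuous.prodMk ?_ continuous_const
    have hzc : Continuous fun a => (p.2, z p a) := by
      refine continuous_const.prodMk (continuous_pi fun j => ?_)
      exact (continuous_of_discreteTopology
        (f := fun b => seg ((T ^ (n * (j / n) : ℤ)) p) b (j % n).toNat)).comp
        (continuous_apply (j / n))
    refine continuous_iff_isClosed.2 fun C hC => ?_
    have himg : IsClosed (Prod.fst '' ({s : (Ω × (ℤ → M)) × M |
        ∀ j, ‖e ((T ^ j) (s.2, s.1.1)).1 - e (s.1.2 j)‖ ≤ ε} ∩ Prod.snd ⁻¹' C)) :=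
      isClosedMap_fst_of_compactSpace _ (hclosed.inter (hC.preimage continuous_snd))
    convert himg.preimage hzc using 1
    ext a
    simp only [mem_preimage, mem_image, mem_inter_iff, Set.mem_ofPred_eq]
    constructor
    · exact fun h => ⟨((p.2, z p a), Z p a), ⟨hZ p a, h⟩, rfl⟩
    · rintro ⟨⟨⟨w, ζ⟩, x⟩, ⟨h1, h2⟩, h3⟩
      simp only [Prod.mk.injEq] at h3
      obtain ⟨rfl, rfl⟩ := h3
      rw [← huniq p a x h1]
      exact h2

end Coding

/-! ### A family of measures parametrised by binary sequences -/

section BinaryFamily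

theorem toMeasure_pushforward_iterate {X : Type*} [TopologicalSpace X] [MeasurableSpace X]
    [BorelSpace X] (T : X ≃ₜ X) (n : ℕ) (ν : ProbabilityMeasure X) :
    (((pushforward T)^[n] ν : ProbabilityMeasure X) : Measure X) =
      (ν : Measure X).map (T ^ n : X ≃ₜ X) := by
  induction n with
  | zero => exact (Measure.map_id).symm
  | succ n ih =>
    rw [Function.iterate_succ_apply', pushforward, ProbabilityMeasure.toMeasure_map, ih,
      Measure.map_map T.continuous.measurable (T ^ n).continuous.measurable, pow_succ']
    rfl

/-- The laws of a random map which depends continuously on a parameter depend continuously on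
the parameter. -/
theorem continuous_map_of_continuous {X Y Z : Type*} [TopologicalSpace Z]
    [FirstCountableTopology Z] [TopologicalSpace Y] [MeasurableSpace Y] [OpensMeasurableSpace Y]
    [MeasurableSpace X] (ν : ProbabilityMeasure X)
    {G : X → Z → Y} (hGm : ∀ a, Measurable fun p => G p a) (hGc : ∀ p, Continuous (G p)) :
    Continuous fun a => ν.map (hGm a).aemeasurable := by
  refine continuous_iff_continuousAt.2 fun a => ?_
  refine ProbabilityMeasure.tendsto_iff_forall_integral_tendsto.2 fun g => ?_
  simp only [ProbabilityMeasure.toMeasure_map]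
  have h1 : ∀ b, ∫ y, g y ∂((ν : Measure X).map fun p => G p b) = ∫ p, g (G p b) ∂ν := fun b =>
    integral_map (hGm b).aemeasurable g.continuous.measurable.aestronglyMeasurable
  simp only [h1]
  refine tendsto_integral_filter_of_dominated_convergence (fun _ => ‖g‖) ?_ ?_
    (integrable_const _) ?_
  · exact Eventually.of_forall fun b =>
      (g.continuous.measurable.comp (hGm b)).aestronglyMeasurable
  · exact Eventually.of_forall fun b => Eventually.of_forall fun p => g.norm_coe_le_norm _
  · exact Eventually.of_forall fun p => (g.continuous.comp (hGc p)).tendsto a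

variable {M Ω F : Type*} [TopologicalSpace M] [TopologicalSpace Ω] [NormedAddCommGroup F]
  [CompactSpace M] [CompactSpace Ω] [AddCommGroup Ω] [IsTopologicalAddGroup Ω]
  [T2Space Ω] [SecondCountableTopology M] [SecondCountableTopology Ω]
  [MeasurableSpace M] [BorelSpace M] [MeasurableSpace Ω] [BorelSpace Ω]

/-- A continuous equivariant family of measures parametrised by binary sequences, whose members
with `a 0 = true` and with `a 0 = false` are separated by the integral of a function `g`.

Whenever the orbit of a random point visits a small open set `B` at a time divisible by `n`, it is
replaced for the next `m < n` times by the orbit segment of another point which departs from the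
original one at time `τ`, provided that the corresponding entry of the sequence is `true`. The
measure is the law of the point whose orbit shadows the result. -/
theorem exists_binary_family [Infinite M] {T : M × Ω ≃ₜ M × Ω} {α : Ω}
    (hT : ∀ p, (T p).2 = p.2 + α) {e : M → F} {ε₁ : ℝ} (hε₁ : 0 < ε₁)
    (hexp : FiberExpansive T e ε₁) (he : Continuous e)
    (hsh : FiberShadowing T (Homeomorph.addRight α) e) {μ : Measure (M × Ω)}
    [IsProbabilityMeasure μ] (hμ : MeasurePreserving T μ μ)
    (hpos : ∀ U : Set (M × Ω), IsOpen U → U.Nonempty → 0 < μ U) :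
    ∃ n : ℕ, 0 < n ∧ ∃ Ψ : (ℤ → Bool) → ProbabilityMeasure (M × Ω), Continuous Ψ ∧
      (∀ a, (pushforward T)^[n] (Ψ a) = Ψ (shift a)) ∧
      ∃ (g : C(M × Ω, ℝ)) (β : ℝ), 0 < β ∧
        (∀ a b, a 0 = true → b 0 = false → 3 / 4 * β ≤ ∫ p, g p ∂(Ψ a) - ∫ p, g p ∂(Ψ b)) ∧
        ∀ a b, |∫ p, g p ∂(Ψ a) - ∫ p, g p ∂(Ψ b)| ≤ 9 / 8 * β := by
  classical
  obtain ⟨δ₀, hδ₀, hsh⟩ := hsh (ε₁ / 32) (by positivity)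
  have hT' : ∀ p, (T p).2 = Homeomorph.addRight α p.2 := hT
  -- The bound `δ ≤ ε₁` forces the separation to happen strictly before the final time.
  set δ := min δ₀ ε₁ with hδ
  have hδpos : 0 < δ := lt_min hδ₀ hε₁
  obtain ⟨x, y, w₀, m, τ, hτm, hd0, hdm, hdτ⟩ := hexp.exists_separating_pair hT' he hδpos
  have hτlt : τ < m := by
    refine lt_of_le_of_ne hτm ?_
    rintro rfl
    linarith [min_le_right δ₀ ε₁]
  set e₁ := e ((T ^ τ) (y, w₀)).1 with he₁
  have hcT : ∀ l : ℕ, Continuous fun q : M × Ω => e ((T ^ l) q).1 := fun l =>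
    he.comp (continuous_fst.comp (T ^ l).continuous)
  have hcy : ∀ l : ℕ, Continuous fun q : M × Ω => e ((T ^ l) (y, q.2)).1 := fun l =>
    (hcT l).comp (by fun_prop)
  -- The set of points whose orbits follow the first segment while those of the points above
  -- `y` follow the second one.
  set B : Set (M × Ω) := {q | ‖e q.1 - e y‖ < δ} ∩
    {q | ‖e ((T ^ m) q).1 - e ((T ^ m) (y, q.2)).1‖ < δ} ∩
    {q | ‖e ((T ^ τ) q).1 - e ((T ^ τ) (x, w₀)).1‖ < ε₁ / 4} ∩
    {q | ‖e ((T ^ τ) (y, q.2)).1 - e₁‖ < ε₁ / 32} with hB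
  have hBo : IsOpen B := by
    refine (((isOpen_lt ?_ continuous_const).inter (isOpen_lt ?_ continuous_const)).inter
      (isOpen_lt ?_ continuous_const)).inter (isOpen_lt ?_ continuous_const)
    · fun_prop
    · exact ((hcT m).sub (hcy m)).norm
    · exact ((hcT τ).sub continuous_const).norm
    · exact ((hcy τ).sub continuous_const).norm
  have hBne : (x, w₀) ∈ B := by
    refine ⟨⟨⟨hd0, hdm⟩, ?_⟩, ?_⟩
    · simp only [Set.mem_ofPred_eq, sub_self, norm_zero]; positivity
    · simp only [Set.mem_ofPred_eq, he₁, sub_self, norm_zero]; positivity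
  set β := μ.real B with hβ
  have hβpos : 0 < β := ENNReal.toReal_pos (hpos B hBo ⟨_, hBne⟩).ne' (measure_ne_top _ _)
  -- The error `η` is chosen so that `2 / ε₁ * η = β / 16`, see `hφsmall`; the block length `n` is
  -- such that the window of size `N` around `τ` meets no other modified segment.
  obtain ⟨N, hN⟩ := hexp.exists_window he (η := ε₁ * β / 32) (by positivity)
  set n := m + N + 1 with hn
  set seg : M × Ω → Bool → ℕ → M := fun q b l =>
    if l < m ∧ b = true ∧ q ∈ B then ((T ^ l) (y, q.2)).1 else ((T ^ l) q).1 with hseg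
  have hsucc : ∀ (l : ℕ) (q : M × Ω), (T ^ (l + 1)) q = T ((T ^ l) q) := fun l q => by
    rw [pow_succ', Homeomorph.mul_apply]
  have hsnd : ∀ (l : ℕ) (q : M × Ω), ((T ^ l) (y, q.2)).2 = ((T ^ l) q).2 := fun l q => by
    rw [← zpow_natCast, zpow_snd hT', zpow_snd hT']
  have hstep : ∀ q b (l : ℕ),
      ‖e (seg q b (l + 1)) - e (T (seg q b l, ((T ^ l) q).2)).1‖ ≤ δ := by
    intro q b l
    by_cases hbq : b = true ∧ q ∈ B
    · rcases Nat.lt_or_ge l m with hl | hl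
      · have h1 : seg q b l = ((T ^ l) (y, q.2)).1 := if_pos ⟨hl, hbq⟩
        rw [h1, ← hsnd, Prod.mk.eta, ← hsucc]
        rcases Nat.lt_or_ge (l + 1) m with hl' | hl'
        · have h2 : seg q b (l + 1) = ((T ^ (l + 1)) (y, q.2)).1 := if_pos ⟨hl', hbq⟩
          rw [h2, sub_self, norm_zero]; exact hδpos.le
        · have h2 : seg q b (l + 1) = ((T ^ (l + 1)) q).1 := if_neg fun h => absurd h.1 (by omega)
          have h3 : l + 1 = m := by omega
          rw [h2, h3]
          exact hbq.2.1.1.2.le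
      · have h1 : seg q b l = ((T ^ l) q).1 := if_neg fun h => absurd h.1 (by omega)
        have h2 : seg q b (l + 1) = ((T ^ (l + 1)) q).1 := if_neg fun h => absurd h.1 (by omega)
        rw [h1, h2, Prod.mk.eta, hsucc, sub_self, norm_zero]; exact hδpos.le
    · have h1 : seg q b l = ((T ^ l) q).1 := if_neg fun h => hbq h.2
      have h2 : seg q b (l + 1) = ((T ^ (l + 1)) q).1 := if_neg fun h => hbq h.2
      rw [h1, h2, Prod.mk.eta, hsucc, sub_self, norm_zero]; exact hδpos.le
  have hstart : ∀ q b, ‖e (seg q b 0) - e q.1‖ ≤ δ := by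
    intro q b
    by_cases h : 0 < m ∧ b = true ∧ q ∈ B
    · have h1 : seg q b 0 = y := if_pos h
      rw [h1, norm_sub_rev]
      exact h.2.2.1.1.1.le
    · have h1 : seg q b 0 = q.1 := if_neg h
      rw [h1, sub_self, norm_zero]; exact hδpos.le
  have hend : ∀ q b (l : ℕ), m ≤ l → seg q b l = ((T ^ l) q).1 := fun q b l hl =>
    if_neg fun h => absurd h.1 (by omega)
  have hmeas : ∀ b l, Measurable fun q => seg q b l := by
    intro b l
    refine Measurable.ite ?_ ?_ ?_
    · exact (MeasurableSet.const _).inter ((MeasurableSet.const _).inter hBo.measurableSet)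
    · exact (continuous_fst.comp ((T ^ l).continuous.comp
        (by fun_prop : Continuous fun q : M × Ω => (y, q.2)))).measurable
    · exact (continuous_fst.comp (T ^ l).continuous).measurable
  obtain ⟨G, hG2, hGsh, hGeq, hGm, hGc⟩ := exists_coding hT' hexp (ε := ε₁ / 32) (δ := δ)
    (by linarith) he (fun w z hz => hsh w z fun i => (hz i).trans (min_le_left _ _))
    (m := m) (n := n) (by omega) hmeas hstep hstart hend
  -- The symbol at time zero decides which of the two segments is shadowed at first.
  have hzero : ∀ p a (l : ℕ), l < n →
      ‖e ((T ^ l) (G p a)).1 - e (seg p (a 0) l)‖ ≤ ε₁ / 32 := by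
    intro p a l hl
    have h := hGsh p a l
    have h1 : (l : ℤ) / n = 0 := Int.ediv_eq_zero_of_lt (by omega) (by omega)
    have h2 : ((l : ℤ) % n).toNat = l := by
      rw [Int.emod_eq_of_lt (by omega) (by omega)]; simp
    rwa [h1, h2, mul_zero, zpow_zero, zpow_natCast] at h
  have hneg : ∀ p a (j : ℤ), (m : ℤ) - n ≤ j → j < 0 →
      ‖e ((T ^ j) (G p a)).1 - e ((T ^ j) p).1‖ ≤ ε₁ / 32 := by
    intro p a j hj1 hj2
    have h := hGsh p a j
    have h1 : j / n = -1 := by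
      rw [Int.ediv_eq_iff_of_pos (by omega)]; constructor <;> omega
    have h2 : j % n = j + n := by
      rw [Int.emod_def, h1]; ring
    rw [h1, h2, hend _ _ _ (by omega), ← Homeomorph.mul_apply, ← zpow_natCast, ← zpow_add,
      Int.toNat_of_nonneg (by omega)] at h
    rwa [show j + n + n * (-1 : ℤ) = j by ring] at h
  have hclose : ∀ p a, ¬ (a 0 = true ∧ p ∈ B) →
      ‖e ((T ^ τ) (G p a)).1 - e ((T ^ τ) p).1‖ ≤ ε₁ * β / 32 := by
    intro p a hpa
    refine hN _ _ ?_ fun i hi => ?_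
    · rw [← zpow_natCast, zpow_snd hT', zpow_snd hT', hG2]
    · obtain ⟨hi1, hi2⟩ := abs_le.1 hi
      have h1 : ∀ q : M × Ω, (T ^ i) ((T ^ τ) q) = (T ^ (i + τ)) q := fun q => by
        rw [← Homeomorph.mul_apply, ← zpow_natCast, ← zpow_add]
      rw [h1, h1]
      refine le_trans ?_ (by linarith : ε₁ / 32 ≤ ε₁)
      rcases lt_or_ge (i + τ) 0 with h | h
      · exact hneg _ _ _ (by omega) h
      · lift i + (τ : ℤ) to ℕ using h with l hl
        have h2 := hzero p a l (by omega)
        have h3 : seg p (a 0) l = ((T ^ l) p).1 := if_neg fun h => hpa h.2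
        rw [h3] at h2
        simpa using h2
  -- The test function: a bump around the second segment at the separation time.
  set g₀ : M × Ω → ℝ := fun p => max 0 (1 - 2 / ε₁ * ‖e p.1 - e₁‖) with hg₀
  have hg₀c : Continuous g₀ := by fun_prop
  have hg₀0 : ∀ p, 0 ≤ g₀ p := fun p => le_max_left _ _
  have hg₀1 : ∀ p, g₀ p ≤ 1 := fun p => max_le zero_le_one (by
    have : 0 ≤ 2 / ε₁ * ‖e p.1 - e₁‖ := by positivity
    linarith)
  have hg₀lip : ∀ p q, |g₀ p - g₀ q| ≤ 2 / ε₁ * ‖e p.1 - e q.1‖ := by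
    intro p q
    refine (abs_max_sub_max_le_max _ _ _ _).trans (max_le (by simp; positivity) ?_)
    have h1 : 1 - 2 / ε₁ * ‖e p.1 - e₁‖ - (1 - 2 / ε₁ * ‖e q.1 - e₁‖) =
      2 / ε₁ * (‖e q.1 - e₁‖ - ‖e p.1 - e₁‖) := by ring
    rw [h1, abs_mul, abs_of_pos (by positivity : 0 < 2 / ε₁)]
    refine mul_le_mul_of_nonneg_left ?_ (by positivity)
    have := abs_norm_sub_norm_le (e q.1 - e₁) (e p.1 - e₁)
    rwa [sub_sub_sub_cancel_right, norm_sub_rev (e q.1) (e p.1)] at this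
  set φ : (ℤ → Bool) → M × Ω → ℝ := fun a p => g₀ ((T ^ τ) (G p a)) - g₀ ((T ^ τ) p) with hφ
  have hφsmall : ∀ p a, ¬ (a 0 = true ∧ p ∈ B) → |φ a p| ≤ β / 16 := by
    intro p a hpa
    refine (hg₀lip _ _).trans ?_
    calc 2 / ε₁ * ‖e ((T ^ τ) (G p a)).1 - e ((T ^ τ) p).1‖ ≤ 2 / ε₁ * (ε₁ * β / 32) :=
          mul_le_mul_of_nonneg_left (hclose p a hpa) (by positivity)
      _ = β / 16 := by field_simp; norm_num
  have hφbig : ∀ p a, a 0 = true → p ∈ B → 7 / 8 ≤ φ a p ∧ φ a p ≤ 1 := by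
    intro p a ha hp
    have h1 := hzero p a τ (by omega)
    have h2 : seg p (a 0) τ = ((T ^ τ) (y, p.2)).1 := if_pos ⟨hτlt, ha, hp⟩
    rw [h2] at h1
    have h3 : ‖e ((T ^ τ) (G p a)).1 - e₁‖ ≤ ε₁ / 16 := by
      have := norm_sub_le_norm_sub_add_norm_sub (e ((T ^ τ) (G p a)).1)
        (e ((T ^ τ) (y, p.2)).1) e₁
      have h4 : ‖e ((T ^ τ) (y, p.2)).1 - e₁‖ < ε₁ / 32 := hp.2
      linarith
    have h5 : ε₁ / 2 ≤ ‖e ((T ^ τ) p).1 - e₁‖ := by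
      have h6 : ‖e ((T ^ τ) p).1 - e ((T ^ τ) (x, w₀)).1‖ < ε₁ / 4 := hp.1.2
      have := norm_sub_le_norm_sub_add_norm_sub (e ((T ^ τ) (x, w₀)).1)
        (e ((T ^ τ) p).1) e₁
      rw [norm_sub_rev (e ((T ^ τ) (x, w₀)).1) (e ((T ^ τ) p).1)] at this
      linarith
    have h7 : g₀ ((T ^ τ) p) = 0 := by
      refine max_eq_left ?_
      have : 2 / ε₁ * (ε₁ / 2) ≤ 2 / ε₁ * ‖e ((T ^ τ) p).1 - e₁‖ :=
        mul_le_mul_of_nonneg_left h5 (by positivity)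
      have h8 : 2 / ε₁ * (ε₁ / 2) = 1 := by field_simp
      linarith
    have h9 : 7 / 8 ≤ g₀ ((T ^ τ) (G p a)) := by
      refine le_max_of_le_right ?_
      have : 2 / ε₁ * ‖e ((T ^ τ) (G p a)).1 - e₁‖ ≤ 2 / ε₁ * (ε₁ / 16) :=
        mul_le_mul_of_nonneg_left h3 (by positivity)
      have h8 : 2 / ε₁ * (ε₁ / 16) = 1 / 8 := by field_simp; norm_num
      linarith
    simp only [hφ, h7, sub_zero]
    exact ⟨h9, hg₀1 _⟩
  have hint : ∀ f : M × Ω → ℝ, Measurable f → (∀ p, 0 ≤ f p) → (∀ p, f p ≤ 1) →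
      Integrable f μ := fun f hf h0 h1 =>
    Integrable.of_bound hf.aestronglyMeasurable 1 (Eventually.of_forall fun p => by
      rw [Real.norm_eq_abs, abs_of_nonneg (h0 p)]; exact h1 p)
  have hint1 : ∀ a, Integrable (fun p => g₀ ((T ^ τ) (G p a))) μ := fun a =>
    hint _ ((hg₀c.comp (T ^ τ).continuous).measurable.comp (hGm a)) (fun _ => hg₀0 _)
      fun _ => hg₀1 _
  have hint2 : Integrable (fun p => g₀ ((T ^ τ) p)) μ :=
    hint _ (hg₀c.comp (T ^ τ).continuous).measurable (fun _ => hg₀0 _) fun _ => hg₀1 _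
  have hφint : ∀ a, Integrable (φ a) μ := fun a => (hint1 a).sub hint2
  have hfalse : ∀ a, a 0 = false → |∫ p, φ a p ∂μ| ≤ β / 16 := by
    intro a ha
    have := norm_integral_le_of_norm_le_const (μ := μ) (f := φ a) (C := β / 16)
      (Eventually.of_forall fun p => hφsmall p a fun h => by simp [ha] at h)
    simpa using this
  have hBint : Integrable (B.indicator fun _ => (1 : ℝ)) μ :=
    (integrable_const 1).indicator hBo.measurableSet
  have hBval : ∫ p, B.indicator (fun _ => (1 : ℝ)) p ∂μ = β := by
    rw [integral_indicator_const _ hBo.measurableSet]; simp [hβ]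
  have htrue : ∀ a, a 0 = true →
      13 / 16 * β ≤ ∫ p, φ a p ∂μ ∧ ∫ p, φ a p ∂μ ≤ 17 / 16 * β := by
    intro a ha
    constructor
    · have h1 : ∫ p, (7 / 8 * B.indicator (fun _ => (1 : ℝ)) p - β / 16) ∂μ ≤ ∫ p, φ a p ∂μ := by
        refine integral_mono ((hBint.const_mul _).sub (integrable_const _)) (hφint a) fun p => ?_
        by_cases hp : p ∈ B
        · simp only [indicator_of_mem hp]
          linarith [(hφbig p a ha hp).1]
        · simp only [indicator_of_notMem hp]
          linarith [(abs_le.1 (hφsmall p a fun h => hp h.2)).1]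
      rw [integral_sub (hBint.const_mul _) (integrable_const _), integral_const_mul, hBval] at h1
      simp only [integral_const, probReal_univ, one_smul] at h1
      linarith
    · have h1 : ∫ p, φ a p ∂μ ≤ ∫ p, (B.indicator (fun _ => (1 : ℝ)) p + β / 16) ∂μ := by
        refine integral_mono (hφint a) (hBint.add (integrable_const _)) fun p => ?_
        by_cases hp : p ∈ B
        · simp only [indicator_of_mem hp]
          linarith [(hφbig p a ha hp).2]
        · simp only [indicator_of_notMem hp]
          linarith [(abs_le.1 (hφsmall p a fun h => hp h.2)).2]
      rw [integral_add hBint (integrable_const _), hBval] at h1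
      simp only [integral_const, probReal_univ, one_smul] at h1
      linarith
  refine ⟨n, by omega, fun a => ProbabilityMeasure.map ⟨μ, inferInstance⟩
    (hGm a).aemeasurable, continuous_map_of_continuous _ hGm hGc,
    fun a => ?_, ⟨fun p => g₀ ((T ^ τ) p), hg₀c.comp (T ^ τ).continuous⟩, β, hβpos, ?_⟩
  · refine ProbabilityMeasure.toMeasure_injective ?_
    refine (toMeasure_pushforward_iterate T n _).trans ?_
    have hTn : MeasurePreserving (T ^ n : M × Ω ≃ₜ M × Ω) μ μ := by
      have h1 := hμ.iterate n
      have h2 : (T : M × Ω → M × Ω)^[n] = (T ^ n : M × Ω ≃ₜ M × Ω) := by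
        funext p
        have : ∀ l : ℕ, T^[l] p = (T ^ l) p := fun l => by
          induction l with
          | zero => rfl
          | succ l ih => rw [Function.iterate_succ_apply', ih, hsucc]
        exact this n
      rwa [h2] at h1
    change (μ.map fun p => G p a).map (T ^ n : M × Ω ≃ₜ M × Ω) = μ.map fun p => G p (shift a)
    rw [Measure.map_map (T ^ n).continuous.measurable (hGm a)]
    conv_rhs => rw [← hTn.map_eq]
    rw [Measure.map_map (hGm _) (T ^ n).continuous.measurable]
    congr 1
    funext p
    exact (hGeq p a).symm
  · have hval : ∀ a, ∫ p, g₀ ((T ^ τ) p) ∂(μ.map fun p => G p a) =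
        ∫ p, φ a p ∂μ + ∫ p, g₀ ((T ^ τ) p) ∂μ := fun a => by
      rw [integral_map (f := fun p => g₀ ((T ^ τ) p)) (hGm a).aemeasurable
        (hg₀c.comp (T ^ τ).continuous).measurable.aestronglyMeasurable,
        ← integral_add (hφint a) hint2]
      simp only [hφ, sub_add_cancel]
    have hval' : ∀ a, ∫ p, (⟨fun p => g₀ ((T ^ τ) p), hg₀c.comp (T ^ τ).continuous⟩ :
        C(M × Ω, ℝ)) p ∂(ProbabilityMeasure.map ⟨μ, inferInstance⟩ (hGm a).aemeasurable :
          ProbabilityMeasure (M × Ω)) = ∫ p, φ a p ∂μ + ∫ p, g₀ ((T ^ τ) p) ∂μ := hval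
    simp only [hval']
    constructor
    · intro a b ha hb
      have h1 := (htrue a ha).1
      have h2 := (abs_le.1 (hfalse b hb)).2
      linarith
    · have hrange : ∀ a, -(β / 16) ≤ ∫ p, φ a p ∂μ ∧ ∫ p, φ a p ∂μ ≤ 17 / 16 * β := by
        intro a
        cases ha : a 0
        · have := abs_le.1 (hfalse a ha)
          exact ⟨this.1, by linarith⟩
        · have := htrue a ha
          exact ⟨by linarith, this.2⟩
      intro a b
      have h1 := hrange a
      have h2 := hrange b
      rw [abs_le]
      constructor <;> linarith

end BinaryFamily

/-! ### Mixtures of binary families -/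

section Mixture

/-- A sum with weights `5⁻ˡ` is dominated by its first nonzero term. -/
theorem sum_geometric_mul_pos {k : ℕ} {D : Fin k → ℝ} {β : ℝ} (hβ : 0 < β) (j : Fin k)
    (h0 : ∀ l < j, D l = 0) (hj : 3 / 4 * β ≤ D j) (h : ∀ l, |D l| ≤ 9 / 8 * β) :
    0 < ∑ l : Fin k, (1 / 5 : ℝ) ^ (l : ℕ) * D l := by
  have hsum : ∑ l ∈ Finset.Ioi j, (1 / 5 : ℝ) ^ (l : ℕ) ≤ (1 / 5 : ℝ) ^ (j : ℕ) / 4 := by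
    have h1 : ∑ l ∈ Finset.Ioi j, (1 / 5 : ℝ) ^ (l : ℕ) =
        ∑ l ∈ (Finset.Ioi j).map Fin.valEmbedding, (1 / 5 : ℝ) ^ l := by
      rw [Finset.sum_map]; rfl
    have h2 : (Finset.Ioi j).map Fin.valEmbedding ⊆ Finset.Ico (j + 1 : ℕ) k := by
      intro l hl
      obtain ⟨i, hi, rfl⟩ := Finset.mem_map.1 hl
      have h3 : j < i := Finset.mem_Ioi.1 hi
      exact Finset.mem_Ico.2 ⟨h3, i.2⟩
    rw [h1]
    refine (Finset.sum_le_sum_of_subset_of_nonneg h2 fun _ _ _ => by positivity).trans ?_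
    refine (geom_sum_Ico_le_of_lt_one (by norm_num) (by norm_num)).trans_eq ?_
    rw [pow_succ]; ring
  have hle : ∀ l, (if l = j then (1 / 5 : ℝ) ^ (j : ℕ) * (3 / 4 * β) else 0) -
      (if j < l then (1 / 5 : ℝ) ^ (l : ℕ) * (9 / 8 * β) else 0) ≤
      (1 / 5 : ℝ) ^ (l : ℕ) * D l := by
    intro l
    have hpos : (0 : ℝ) < (1 / 5 : ℝ) ^ (l : ℕ) := by positivity
    rcases lt_trichotomy l j with hl | rfl | hl
    · simp [hl.ne, hl.not_gt, h0 l hl]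
    · simp only [if_true, lt_irrefl, if_false, sub_zero]
      exact mul_le_mul_of_nonneg_left hj hpos.le
    · simp only [hl, hl.ne', if_true, if_false, zero_sub]
      rw [← mul_neg]
      exact mul_le_mul_of_nonneg_left (abs_le.1 (h l)).1 hpos.le
  refine lt_of_lt_of_le ?_ (Finset.sum_le_sum fun l _ => hle l)
  rw [Finset.sum_sub_distrib, Finset.sum_ite_eq' Finset.univ j, ← Finset.sum_filter,
    ← Finset.sum_mul]
  have h1 : Finset.univ.filter (fun l => j < l) = Finset.Ioi j := by ext; simp
  rw [h1]
  simp only [Finset.mem_univ, if_true]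
  have hpos : (0 : ℝ) < (1 / 5 : ℝ) ^ (j : ℕ) := by positivity
  have := mul_le_mul_of_nonneg_right hsum (by positivity : 0 ≤ 9 / 8 * β)
  nlinarith [mul_pos hpos hβ]

variable {X : Type*} [MeasurableSpace X]

/-- The convex combination of the probability measures `ν j` with weights `c j`. -/
def mixture {k : ℕ} (c : Fin k → NNReal) (hc : ∑ j, c j = 1) (ν : Fin k → ProbabilityMeasure X) :
    ProbabilityMeasure X :=
  ⟨∑ j, c j • (ν j : Measure X), ⟨by
    rw [Measure.finsetSum_apply]
    simp only [Measure.smul_apply, measure_univ, ENNReal.smul_def, smul_eq_mul, mul_one]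
    exact_mod_cast hc⟩⟩

theorem integral_mixture {k : ℕ} {c : Fin k → NNReal} (hc : ∑ j, c j = 1)
    (ν : Fin k → ProbabilityMeasure X) {g : X → ℝ} (hg : ∀ j, Integrable g (ν j : Measure X)) :
    ∫ x, g x ∂(mixture c hc ν : Measure X) = ∑ j, (c j : ℝ) * ∫ x, g x ∂(ν j : Measure X) := by
  have h : (mixture c hc ν : Measure X) = ∑ j, c j • (ν j : Measure X) := rfl
  rw [h, integral_finsetSum_measure fun j _ => (hg j).smul_measure_nnreal]
  refine Finset.sum_congr rfl fun j _ => ?_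
  rw [integral_smul_nnreal_measure]
  rfl

variable [TopologicalSpace X] [BorelSpace X]

theorem pushforward_iterate_mixture (T : X ≃ₜ X) (n : ℕ) {k : ℕ} {c : Fin k → NNReal}
    (hc : ∑ j, c j = 1) (ν : Fin k → ProbabilityMeasure X) :
    (pushforward T)^[n] (mixture c hc ν) = mixture c hc fun j => (pushforward T)^[n] (ν j) := by
  refine ProbabilityMeasure.toMeasure_injective ?_
  rw [toMeasure_pushforward_iterate]
  ext s hs
  have h : ∀ ν : Fin k → ProbabilityMeasure X, (mixture c hc ν : Measure X) =
    ∑ j, c j • (ν j : Measure X) := fun _ => rfl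
  rw [Measure.map_apply (T ^ n).continuous.measurable hs, h, h, Measure.finsetSum_apply,
    Measure.finsetSum_apply]
  refine Finset.sum_congr rfl fun j _ => ?_
  rw [Measure.smul_apply, Measure.smul_apply, toMeasure_pushforward_iterate,
    Measure.map_apply (T ^ n).continuous.measurable hs]

theorem pushforward_injective (T : X ≃ₜ X) : Function.Injective (pushforward T) := by
  intro ν ν' h
  refine ProbabilityMeasure.toMeasure_injective ?_
  have h1 := congrArg (fun ρ : ProbabilityMeasure X => (ρ : Measure X).map T.symm) h
  simp only [pushforward, ProbabilityMeasure.toMeasure_map] at h1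
  rwa [Measure.map_map T.symm.continuous.measurable T.continuous.measurable,
    Measure.map_map T.symm.continuous.measurable T.continuous.measurable,
    T.symm_comp_self, Measure.map_id, Measure.map_id] at h1

/-- Independent copies of a binary family of measures, mixed with rapidly decreasing weights, form
horseshoes with `2 ^ (m + 1)` symbols for every `m`, for one and the same iterate. -/
theorem hasBiInvariantHorseshoe_of_binary_family [CompactSpace X] [HasOuterApproxClosed X]
    {T : X ≃ₜ X} {n : ℕ}
    {Ψ : (ℤ → Bool) → ProbabilityMeasure X} (hΨ : Continuous Ψ)
    (heq : ∀ a, (pushforward T)^[n] (Ψ a) = Ψ (shift a)) (g : C(X, ℝ)) {β : ℝ} (hβ : 0 < β)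
    (hsep : ∀ a b, a 0 = true → b 0 = false →
      3 / 4 * β ≤ ∫ p, g p ∂(Ψ a : Measure X) - ∫ p, g p ∂(Ψ b : Measure X))
    (hbd : ∀ a b, |∫ p, g p ∂(Ψ a : Measure X) - ∫ p, g p ∂(Ψ b : Measure X)| ≤ 9 / 8 * β)
    (m : ℕ) : HasBiInvariantHorseshoe (pushforward T)^[n] (2 ^ (m + 1)) := by
  let E : Fin (2 ^ (m + 1)) ≃ (Fin (m + 1) → Bool) :=
    Fintype.equivOfCardEq (by simp)
  have hint : ∀ (g : C(X, ℝ)) (ν : ProbabilityMeasure X), Integrable g (ν : Measure X) :=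
    fun g ν => (BoundedContinuousFunction.mkOfCompact g).integrable _
  set S : NNReal := ∑ j : Fin (m + 1), (1 / 5) ^ (j : ℕ) with hS
  have hSpos : 0 < S := Finset.sum_pos (fun j _ => by positivity) Finset.univ_nonempty
  set c : Fin (m + 1) → NNReal := fun j => S⁻¹ * (1 / 5) ^ (j : ℕ) with hcdef
  have hc : ∑ j, c j = 1 := by
    rw [hcdef, ← Finset.mul_sum, ← hS, inv_mul_cancel₀ hSpos.ne']
  let bits : (ℤ → Fin (2 ^ (m + 1))) → Fin (m + 1) → ℤ → Bool := fun a j i => E (a i) j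
  set Φ : (ℤ → Fin (2 ^ (m + 1))) → ProbabilityMeasure X := fun a =>
    mixture c hc fun j => Ψ (bits a j) with hΦ
  have hΦeq : ∀ a, (pushforward T)^[n] (Φ a) = Φ (shift a) := fun a => by
    rw [hΦ]
    simp only
    rw [pushforward_iterate_mixture]
    simp only [heq]
    rfl
  have hF : Function.Injective (pushforward T)^[n] := (pushforward_injective T).iterate n
  have hΦc : Continuous Φ := by
    refine ProbabilityMeasure.continuous_iff_forall_continuousMap_continuous_integral.2 fun f => ?_
    have : ∀ a, ∫ x, f x ∂(Φ a : Measure X) =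
        ∑ j, (c j : ℝ) * ∫ x, f x ∂(Ψ (bits a j) : Measure X) := fun a =>
      integral_mixture hc _ fun j => hint f _
    simp only [this]
    refine continuous_finsetSum _ fun j _ => continuous_const.mul ?_
    have hf := ProbabilityMeasure.continuous_iff_forall_continuousMap_continuous_integral.1 hΨ f
    refine hf.comp (continuous_pi fun i => ?_)
    exact (continuous_of_discreteTopology (f := fun s => E s j)).comp (continuous_apply i)
  have hΦinj : Function.Injective Φ := by
    intro a b hab
    -- All shifts of `a` and `b` have the same image.
    have hshift : ∀ i : ℤ, Φ (fun l => a (l + i)) = Φ fun l => b (l + i) := by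
      intro i
      induction i using Int.induction_on with
      | zero => simpa using hab
      | succ i ih =>
        have h1 := congrArg (pushforward T)^[n] ih
        rw [hΦeq, hΦeq] at h1
        have h2 : ∀ a : ℤ → Fin (2 ^ (m + 1)),
            shift (fun l => a (l + i)) = fun l => a (l + (i + 1)) := fun a => by
          funext l
          simp only [shift, add_assoc, add_comm (1 : ℤ)]
        rwa [h2, h2] at h1
      | pred i ih =>
        refine hF ?_
        rw [hΦeq, hΦeq]
        have h2 : ∀ a : ℤ → Fin (2 ^ (m + 1)),
            shift (fun l => a (l + (-(i : ℤ) - 1))) = fun l => a (l + -i) := fun a => by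
          funext l
          simp only [shift]
          congr 1
          ring
        rwa [h2, h2]
    by_contra hne
    have hex : ∃ j, ∃ i, bits a j i ≠ bits b j i := by
      by_contra! hcon
      refine hne (funext fun i => E.injective (funext fun j => hcon j i))
    obtain ⟨j, ⟨i, hi⟩, hmin⟩ : ∃ j, (∃ i, bits a j i ≠ bits b j i) ∧
        ∀ l < j, ∀ i, bits a l i = bits b l i := by
      classical
      obtain ⟨j, hj, hmin⟩ := WellFounded.has_min (wellFounded_lt (α := Fin (m + 1)))
        {j | ∃ i, bits a j i ≠ bits b j i} hex
      exact ⟨j, hj, fun l hl i => by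
        by_contra hcon
        exact hmin l ⟨i, hcon⟩ hl⟩
    -- After a shift the sequences differ at time zero; the first level at which they differ
    -- decides the sign of the difference of the integrals.
    have key : ∀ a b : ℤ → Fin (2 ^ (m + 1)), (∀ l < j, ∀ i, bits a l i = bits b l i) →
        bits a j 0 = true → bits b j 0 = false → Φ a ≠ Φ b := by
      intro a b hlt ha hb hab
      have h1 := sum_geometric_mul_pos (D := fun l => ∫ x, g x ∂(Ψ (bits a l) : Measure X) -
        ∫ x, g x ∂(Ψ (bits b l) : Measure X)) hβ j (fun l hl => by
          rw [show bits a l = bits b l from funext (hlt l hl), sub_self])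
          (hsep _ _ ha hb) fun l => hbd _ _
      have h2 : ∀ a, ∫ x, g x ∂(Φ a : Measure X) = (S : ℝ)⁻¹ *
          ∑ j : Fin (m + 1), (1 / 5 : ℝ) ^ (j : ℕ) * ∫ x, g x ∂(Ψ (bits a j) : Measure X) :=
        fun a => by
          rw [Finset.mul_sum]
          refine (integral_mixture hc _ fun j => hint g _).trans
            (Finset.sum_congr rfl fun l _ => ?_)
          simp only [hcdef]
          push_cast
          ring
      have h3 := congrArg (fun ν : ProbabilityMeasure X => ∫ x, g x ∂(ν : Measure X)) hab
      simp only [h2] at h3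
      have h4 := mul_left_cancel₀ (inv_ne_zero (by exact_mod_cast hSpos.ne')) h3
      simp only [mul_sub, Finset.sum_sub_distrib] at h1
      linarith
    have h5 : ∀ a : ℤ → Fin (2 ^ (m + 1)), ∀ l i', bits (fun t => a (t + i)) l i' =
      bits a l (i' + i) := fun _ _ _ => rfl
    cases ha : bits a j i
    · have hb : bits b j i = true := by
        cases hb : bits b j i
        · exact absurd (ha.trans hb.symm) hi
        · rfl
      exact key _ _ (fun l hl i' => by rw [h5, h5]; exact (hmin l hl _).symm)
        (by rw [h5, zero_add]; exact hb) (by rw [h5, zero_add]; exact ha) (hshift i).symm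
    · have hb : bits b j i = false := by
        cases hb : bits b j i
        · rfl
        · exact absurd (ha.trans hb.symm) hi
      exact key _ _ (fun l hl i' => by rw [h5, h5]; exact hmin l hl _)
        (by rw [h5, zero_add]; exact ha) (by rw [h5, zero_add]; exact hb) (hshift i)
  refine ⟨Φ, (hΦc.isClosedEmbedding hΦinj).isEmbedding, ⟨?_, hF.injOn, ?_⟩, hΦeq⟩
  · rintro _ ⟨a, rfl⟩
    exact ⟨shift a, (hΦeq a).symm⟩
  · rintro _ ⟨a, rfl⟩
    refine ⟨_, ⟨fun i => a (i - 1), rfl⟩, ?_⟩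
    rw [hΦeq]
    congr 1
    funext i
    simp [shift]

end Mixture

/-! ### Horseshoes with arbitrarily many symbols -/

section Conclusion

/-- A manifold of positive dimension is infinite. -/
theorem infinite_of_chartedSpace {d : ℕ} (hd : 0 < d) {M : Type*} [TopologicalSpace M]
    [ChartedSpace (EuclideanSpace ℝ (Fin d)) M] (x : M) : Infinite M := by
  have : Nontrivial (EuclideanSpace ℝ (Fin d)) :=
    Module.nontrivial_of_finrank_pos (R := ℝ) (by simpa using hd)
  have : (𝓝[≠] (chartAt (EuclideanSpace ℝ (Fin d)) x x)).NeBot :=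
    Module.punctured_nhds_neBot ℝ _ _
  by_contra hfin
  rw [not_infinite_iff_finite] at hfin
  refine infinite_of_mem_nhds _ (chart_target_mem_nhds (EuclideanSpace ℝ (Fin d)) x) ?_
  rw [← (chartAt (EuclideanSpace ℝ (Fin d)) x).image_source_eq_target]
  exact (toFinite _).image _

/-- For a skew product over a rotation which is expansive and has shadowing along its infinite
fibres, and which has a fully supported invariant measure, some iterate of the push-forward has
horseshoes with arbitrarily many symbols. -/
theorem exists_iterate_hasBiInvariantHorseshoe {M Ω F : Type*} [TopologicalSpace M]
    [TopologicalSpace Ω] [NormedAddCommGroup F]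
    [CompactSpace M] [CompactSpace Ω] [AddCommGroup Ω] [IsTopologicalAddGroup Ω]
    [T2Space M] [T2Space Ω] [SecondCountableTopology M] [SecondCountableTopology Ω]
    [MeasurableSpace M] [BorelSpace M] [MeasurableSpace Ω] [BorelSpace Ω]
    [Infinite M] {T : M × Ω ≃ₜ M × Ω} {α : Ω}
    (hT : ∀ p, (T p).2 = p.2 + α) {e : M → F} {ε : ℝ} (hε : 0 < ε)
    (hexp : FiberExpansive T e ε) (he : Continuous e)
    (hsh : FiberShadowing T (Homeomorph.addRight α) e) {μ : Measure (M × Ω)}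
    [IsProbabilityMeasure μ] (hμ : MeasurePreserving T μ μ) (hsupp : μ.support = univ) :
    ∃ n : ℕ, 0 < n ∧ ∀ m : ℕ, HasBiInvariantHorseshoe (pushforward T)^[n] (2 ^ (m + 1)) := by
  have : TopologicalSpace.PseudoMetrizableSpace (M × Ω) :=
    (TopologicalSpace.metrizableSpace_of_t3_secondCountable (M × Ω)).toPseudoMetrizableSpace
  have hpos : ∀ U : Set (M × Ω), IsOpen U → U.Nonempty → 0 < μ U := by
    rintro U hU ⟨p, hp⟩
    have h : p ∈ μ.support := by rw [hsupp]; exact mem_univ p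
    exact (Measure.mem_support_iff_forall p).1 h U (hU.mem_nhds hp)
  obtain ⟨n, hn, Ψ, hΨ, heq, g, β, hβ, hsep, hbd⟩ :=
    exists_binary_family hT hε hexp he hsh hμ hpos
  exact ⟨n, hn, hasBiInvariantHorseshoe_of_binary_family hΨ heq g hβ hsep hbd⟩

end Conclusion

end QuasiPeriodicForcing

end

theorem corollary2p6
    {d : ℕ} {M : Type*} [TopologicalSpace M] [T2Space M] [CompactSpace M]
    [ChartedSpace (EuclideanSpace ℝ (Fin d)) M] [IsManifold (𝓡 d) ∞ M]
    [RiemannianBundle (fun x : M => TangentSpace (𝓡 d) x)]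
    [IsContMDiffRiemannianBundle (𝓡 d) ∞ (EuclideanSpace ℝ (Fin d))
      (fun x : M => TangentSpace (𝓡 d) x)]
    [MeasurableSpace M] [BorelSpace M]
    {ι : Type*} [Countable ι] (α : UnitAddTorus ι)
    (hα : QuasiPeriodicForcing.IsMinimalHomeo (Homeomorph.addRight α))
    (f : C(UnitAddTorus ι, QuasiPeriodicForcing.DiffTwo d M))
    (htrans : QuasiPeriodicForcing.IsTransitive
      (QuasiPeriodicForcing.skewProduct f (Homeomorph.addRight α)))
    (hAnosov : QuasiPeriodicForcing.IsAnosovOnFibers f (Homeomorph.addRight α))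
    (μ : Measure (M × UnitAddTorus ι)) [IsProbabilityMeasure μ]
    (hμ : Ergodic (QuasiPeriodicForcing.skewProduct f (Homeomorph.addRight α)) μ)
    (hentropy : 0 < QuasiPeriodicForcing.metricEntropy
      (QuasiPeriodicForcing.skewProduct f (Homeomorph.addRight α)) μ)
    (hsupp : μ.support = univ)
    (γ : ℝ) (hγ : 0 < γ) :
    ∃ n k : ℕ, 0 < n ∧ 0 < k ∧
      QuasiPeriodicForcing.metricEntropy
          (QuasiPeriodicForcing.skewProduct f (Homeomorph.addRight α)) μ - (γ : EReal) ≤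
        ((1 / (n : ℝ) * Real.log k : ℝ) : EReal) ∧
      QuasiPeriodicForcing.HasBiInvariantHorseshoe
        (QuasiPeriodicForcing.pushforward
          (QuasiPeriodicForcing.skewProduct f (Homeomorph.addRight α)))^[n] k := by
  set T := QuasiPeriodicForcing.skewProduct f (Homeomorph.addRight α) with hTdef
  have hT : ∀ p, (T p).2 = p.2 + α := fun p => rfl
  have hT' : ∀ p, (T p).2 = Homeomorph.addRight α p.2 := fun p => rfl
  obtain ⟨⟨x₀, w₀⟩⟩ := nonempty_of_isProbabilityMeasure μ
  have hd : 0 < d := by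
    obtain ⟨Eu, Es, lam, -, -, -, h⟩ := hAnosov
    have h1 := (h x₀ w₀).2.1
    have : FiniteDimensional ℝ (TangentSpace (𝓡 d) x₀) :=
      inferInstanceAs (FiniteDimensional ℝ (EuclideanSpace ℝ (Fin d)))
    have h2 := Submodule.finrank_le (Eu (x₀, w₀))
    have h3 : Module.finrank ℝ (TangentSpace (𝓡 d) x₀) = d := finrank_euclideanSpace_fin
    exact h1.trans_le (h2.trans_eq h3)
  -- Expansivity alone is compatible with finite fibres, in which no two orbits separate.
  have : Infinite M := QuasiPeriodicForcing.infinite_of_chartedSpace hd x₀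
  have : SecondCountableTopology M :=
    ChartedSpace.secondCountable_of_sigmaCompact (EuclideanSpace ℝ (Fin d)) M
  obtain ⟨N, e, hes, hec, hei⟩ := exists_embedding_euclidean_of_compact (I := 𝓡 d) (M := M)
  obtain ⟨H⟩ := QuasiPeriodicForcing.exists_hyperbolicData hes hec.injective hei f
    (Homeomorph.addRight α) hAnosov
  obtain ⟨ε, hε, hexp⟩ := H.exists_fiberExpansive hec.injective hT'
  have hsh := H.fiberShadowing hec.continuous hec.injective hT'
  have hmp : MeasurePreserving T μ μ := hμ.toMeasurePreserving
  obtain ⟨n, hn, hhorse⟩ := QuasiPeriodicForcing.exists_iterate_hasBiInvariantHorseshoe hT hε hexp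
    hec.continuous hsh hmp hsupp
  have hlt := hexp.metricEntropy_lt_top hε hec.continuous hT hmp
  have hn' : (0 : ℝ) < n := by exact_mod_cast hn
  have hlog : 0 < Real.log 2 := Real.log_pos one_lt_two
  obtain ⟨h, hh⟩ : ∃ h : ℝ, QuasiPeriodicForcing.metricEntropy T μ = h :=
    ⟨_, (EReal.coe_toReal hlt.ne (EReal.bot_lt_zero.trans hentropy).ne').symm⟩
  -- The iterate `n` is fixed, while the number of symbols is at our disposal.
  obtain ⟨m, hm⟩ := exists_nat_gt (n * h / Real.log 2)
  refine ⟨n, 2 ^ (m + 1), hn, by positivity, ?_, hhorse m⟩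
  rw [hh, ← EReal.coe_sub, EReal.coe_le_coe_iff]
  rw [div_lt_iff₀ hlog] at hm
  push_cast
  rw [Real.log_pow, one_div, inv_mul_eq_div, le_div_iff₀ hn']
  push_cast
  nlinarith [mul_pos hγ hn']
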